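/- Let $k$ be an algebraically closed field of characteristic $0$, $V$ a finite-dimensional $\mathbb Z/2$-graded $k$-vector space with an even bilinear form $l$ satisfying $l(x,y)=(-1)^{\bar x\bar y}l(y,x)$ (a scalar product; nondegeneracy is not needed). Let $a_i$ be a homogeneous basis of the parity-shifted space $\Pi V$ coming from a homogeneous basis of $V$, $p_i=\bar a_i$, and let $l_{ij}$ be the matrix of $l$ in it. **The space $F$.** $F=\mathrm{Sym}\big(\bigoplus_{j\ge1}\Pi((\Pi V)^{\otimes j})^{\mathbb Z/j}\big)$ is the supercommutative algebra generated by the cyclic words $(a_{\rho_1}\dots a_{\rho_r})^c$, of parity $1+\sum\bar a_{\rho_i}$, with rotation relations $(a\,w)^c=(-1)^{\bar a\bar w}(w\,a)^c$; the empty word is $0$. $F_n$ is spanned by the products of cyclic words of total length $n$. For $\kappa\in k$ let $\Delta^{(\kappa)}:F_n\to F_{n-2}$ be the second-order operator that sends a product of cyclic words to the sum, over all unordered pairs of its letters, of their contractions by $l$, with Koszul signs. The contraction of letters of two different words has coefficient $1$, the contraction of two letters of one word has coefficient $\kappa$: with words written as $\pi w$, $\pi$ an odd symbol, $$\pi a u\cdot\pi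 b u'\mapsto(-1)^{\bar a+\bar u+\bar b\bar u}\,l(a,b)\,\pi uu',\qquad \pi a u b u'\mapsto \kappa\,(-1)^{\bar b\bar u+\bar u}\,l(a,b)\,\pi u\cdot\pi u'.$$ For $\kappa=1$ this is the noncommutative Batalin–Vilkovisky differential. **The matrix side.** Let $U=k^{N|N}$ with the odd involution $p$ exchanging the even and odd basis vectors, let $q(U)=\{G\in\mathrm{End}(U):[G,p]=0\}$ (supercommutator), $\mathrm{otr}(G)=\tfrac12\mathrm{tr}(Gp)$ ($\mathrm{tr}$ the supertrace), and let $GQ(U)=\{g\in GL(U): gpg^{-1}=p\}$, a supergroup. It acts by conjugation on $q(U)$, hence on $S=\bigoplus_n S^n\mathrm{Hom}(q(U),\Pi V)$, the algebra of polynomial functions on $\mathrm{Hom}(\Pi V,q(U))$. Let $A_i$ be the $q(U)$-valued linear function on $\mathrm{Hom}(\Pi V,q(U))$ corresponding to $a_i$, with coordinates $X_{i,\alpha}^{\beta},Y_{i,\alpha}^{\beta}$ given by the blocks $\begin{pmatrix}X&Y\\-Y&X\end{pmatrix}$ of $q(U)$, of parities $p_i$, $p_i+1$. Let $\Delta_{\mathrm{mat}}=\tfrac12\sum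 B(m,m')\,\partial_{m'}\partial_m$ be the BV operator on $S$ of the odd form $B$ induced by $l$ and by the odd form $\langle G,G'\rangle=\mathrm{otr}(GG')$ on $q(U)$: the sums run over the coordinates, $B(X_{i,\alpha}^{\beta},Y_{j,\beta}^{\alpha})=-l_{ij}$, $B(Y_{i,\alpha}^{\beta},X_{j,\beta}^{\alpha})=(-1)^{p_j}l_{ij}$, and $B=0$ on other pairs of coordinates. **Theorem.** Let $n\le N$ and let $c\in k$ be nonzero. The algebra map $\mu_c:F\to S$ with $$(a_{\rho_1}\dots a_{\rho_r})^c\cdots(a_{\tau_1}\dots a_{\tau_t})^c\ \mapsto\ \big(c\,\mathrm{otr}(A_{\rho_1}\cdots A_{\rho_r})\big)\cdots\big(c\,\mathrm{otr}(A_{\tau_1}\cdots A_{\tau_t})\big)$$ is well defined and restricts to a bijection of $F_n$ onto the invariants $\big(S^n\mathrm{Hom}(q(U),\Pi V)\big)^{GQ(U)}$. The operators $\Delta^{(\kappa)}$ map $F_n$ to $F_{n-2}$, and $\Delta_{\mathrm{mat}}$ maps $\big(S^n\mathrm{Hom}(q(U),\Pi V)\big)^{GQ(U)}$ to $\big(S^{n-2}\mathrm{Hom}(q(U),\Pi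 V)\big)^{GQ(U)}$ (both are $0$ for $n<2$), and they coincide under this identification: $$c^{-1}\,\Delta_{\mathrm{mat}}(\mu_c(x))=\mu_c\big(\Delta^{(2/c^2)}x\big)\qquad(x\in F_n).$$ In particular, for $c^2=2$ the operator $c^{-1}\Delta_{\mathrm{mat}}$ is the noncommutative BV differential $\Delta^{(1)}$; for $c=1$ (odd traces as they stand) $\Delta_{\mathrm{mat}}$ is $\Delta^{(2)}$, in which the contractions inside one word are summed over ordered pairs of letters. -/

import Mathlib

universe u v

/-- The sign `(-1)^z` of a parity `z : ZMod 2`, as an element of a ring. -/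
def ksgn (k : Type u) [Ring k] (z : ZMod 2) : k := if z = 0 then 1 else -1

theorem ksgn_add (k : Type u) [Ring k] (x y : ZMod 2) :
    ksgn k (x + y) = ksgn k x * ksgn k y := by
  have h : (1 : ZMod 2) + 1 = 0 := by decide
  have h2 : ∀ z : ZMod 2, z = 0 ∨ z = 1 := by decide
  unfold ksgn
  rcases h2 x with rfl | rfl <;> rcases h2 y with rfl | rfl <;> simp [h]

theorem ksgn_zero (k : Type u) [Ring k] : ksgn k 0 = 1 := by simp [ksgn]

theorem ksgn_mul_self (k : Type u) [Ring k] (x : ZMod 2) : ksgn k x * ksgn k x = 1 := by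
  unfold ksgn; split_ifs <;> simp

theorem ksgn_one (k : Type u) [Ring k] : ksgn k 1 = -1 := by simp [ksgn]

theorem triangular_mul_comm {k : Type u} [Field k] {A : Type v} [Ring A] [Algebra k A]
    {a b d a' b' d' : A} {s : k} (h₁ : a * a' = s • (a' * a))
    (h₂ : a * b' + b * d' = s • (a' * b + b' * d)) (h₃ : d * d' = s • (d' * d)) :
    !![a, b; 0, d] * !![a', b'; 0, d'] = s • (!![a', b'; 0, d'] * !![a, b; 0, d]) := by
  rw [Matrix.mul_fin_two, Matrix.mul_fin_two]
  ext i j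
  fin_cases i <;> fin_cases j <;> simp [h₁, h₂, h₃]

/-- The span of the products of the elements `g x` of total parity `e`. -/
def parityPart (k : Type u) [Field k] {A : Type v} [Ring A] [Algebra k A] {G : Type}
    (g : G → A) (par : G → ZMod 2) (e : ZMod 2) : Submodule k A :=
  Submodule.span k {f | ∃ w : List G, (w.map par).sum = e ∧ f = (w.map g).prod}

section parityPart

variable {k : Type u} [Field k] {A : Type v} [Ring A] [Algebra k A] {G : Type}
  {g : G → A} {par : G → ZMod 2}

theorem gen_mem_parityPart (x : G) : g x ∈ parityPart k g par (par x) :=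
  Submodule.subset_span ⟨[x], by simp, by simp⟩

theorem one_mem_parityPart : (1 : A) ∈ parityPart k g par 0 :=
  Submodule.subset_span ⟨[], by simp, by simp⟩

theorem mul_mem_parityPart {d e : ZMod 2} {x y : A} (hx : x ∈ parityPart k g par d)
    (hy : y ∈ parityPart k g par e) : x * y ∈ parityPart k g par (d + e) := by
  have h := Submodule.mul_mem_mul hx hy
  unfold parityPart at h
  rw [Submodule.span_mul_span] at h
  refine Submodule.span_mono ?_ h
  rintro _ ⟨_, ⟨w, hw, rfl⟩, _, ⟨w', hw', rfl⟩, rfl⟩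
  exact ⟨w ++ w', by simp [hw, hw'], by simp⟩

theorem parityPart_comm
    (hg : ∀ x y, g x * g y = ksgn k (par x * par y) • (g y * g x)) {d e : ZMod 2} {x y : A}
    (hx : x ∈ parityPart k g par d) (hy : y ∈ parityPart k g par e) :
    x * y = ksgn k (d * e) • (y * x) := by
  have h1 : ∀ (a : G) (w : List G), g a * (w.map g).prod =
      ksgn k (par a * (w.map par).sum) • ((w.map g).prod * g a) := by
    intro a w
    induction w with
    | nil => simp [ksgn_zero]
    | cons b w ih =>
      simp only [List.map_cons, List.prod_cons, List.sum_cons]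
      rw [← mul_assoc, hg, smul_mul_assoc, mul_assoc, ih, mul_smul_comm, smul_smul, ← ksgn_add,
        mul_assoc, mul_add]
  have h2 : ∀ w w' : List G, (w.map g).prod * (w'.map g).prod =
      ksgn k ((w.map par).sum * (w'.map par).sum) • ((w'.map g).prod * (w.map g).prod) := by
    intro w w'
    induction w with
    | nil => simp [ksgn_zero]
    | cons b w ih =>
      simp only [List.map_cons, List.prod_cons, List.sum_cons]
      rw [mul_assoc, ih, mul_smul_comm, ← mul_assoc, h1, smul_mul_assoc, smul_smul, ← ksgn_add,
        mul_assoc, add_mul, add_comm]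
  induction hx using Submodule.span_induction with
  | mem x hx =>
    obtain ⟨w, rfl, rfl⟩ := hx
    induction hy using Submodule.span_induction with
    | mem y hy => obtain ⟨w', rfl, rfl⟩ := hy; exact h2 w w'
    | zero => simp
    | add y z _ _ hy hz => rw [mul_add, add_mul, smul_add, hy, hz]
    | smul c y _ hy => rw [mul_smul_comm, smul_mul_assoc, hy, smul_comm]
  | zero => simp
  | add x z _ _ hx hz => rw [mul_add, add_mul, smul_add, hx, hz]
  | smul c x _ hx => rw [mul_smul_comm, smul_mul_assoc, hx, smul_comm]

end parityPart

/-- The defining relation of the free supercommutative algebra on generators of parity `par`. -/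
inductive SuperPoly.Rel (k : Type u) [Field k] {G : Type} (par : G → ZMod 2) :
    FreeAlgebra k G → FreeAlgebra k G → Prop
  | swap (x y : G) : SuperPoly.Rel k par (FreeAlgebra.ι k x * FreeAlgebra.ι k y)
      (ksgn k (par x * par y) • (FreeAlgebra.ι k y * FreeAlgebra.ι k x))

/-- The super symmetric algebra `S(M)` of the super vector space `M` with homogeneous basis `G`
(in characteristic zero the relations force odd generators to square to zero). -/
def SuperPoly (k : Type u) [Field k] {G : Type} (par : G → ZMod 2) : Type u :=
  RingQuot (SuperPoly.Rel k par)

instance (k : Type u) [Field k] {G : Type} (par : G → ZMod 2) : Ring (SuperPoly k par) :=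
  inferInstanceAs (Ring (RingQuot (SuperPoly.Rel k par)))

instance (k : Type u) [Field k] {G : Type} (par : G → ZMod 2) : Algebra k (SuperPoly k par) :=
  inferInstanceAs (Algebra k (RingQuot (SuperPoly.Rel k par)))

namespace SuperPoly

variable {k : Type u} [Field k] {G : Type} {par : G → ZMod 2}

/-- The projection from the free algebra. -/
def mk (k : Type u) [Field k] {G : Type} (par : G → ZMod 2) :
    FreeAlgebra k G →ₐ[k] SuperPoly k par :=
  RingQuot.mkAlgHom k (SuperPoly.Rel k par)

theorem mk_rel {x y : FreeAlgebra k G} (h : SuperPoly.Rel k par x y) :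
    mk k par x = mk k par y :=
  RingQuot.mkAlgHom_rel k h

/-- Algebra maps out of `SuperPoly` are given by values on the generators. -/
def lift {A : Type v} [Ring A] [Algebra k A] (f : G → A)
    (hf : ∀ x y, f x * f y = ksgn k (par x * par y) • (f y * f x)) : SuperPoly k par →ₐ[k] A :=
  RingQuot.liftAlgHom k ⟨FreeAlgebra.lift k f, by
    rintro _ _ ⟨x, y⟩
    simpa using hf x y⟩

/-- The generators. -/
def gen (k : Type u) [Field k] {G : Type} (par : G → ZMod 2) (x : G) : SuperPoly k par :=
  mk k par (FreeAlgebra.ι k x)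

theorem gen_swap (x y : G) :
    gen k par x * gen k par y = ksgn k (par x * par y) • (gen k par y * gen k par x) := by
  have := mk_rel (SuperPoly.Rel.swap (k := k) (par := par) x y)
  simpa [gen] using this

/-- The symmetric power `S^n(M)`. -/
def power (k : Type u) [Field k] {G : Type} (par : G → ZMod 2) (n : ℕ) :
    Submodule k (SuperPoly k par) :=
  Submodule.span k {f | ∃ w : List G, w.length = n ∧ f = (w.map (gen k par)).prod}

/-- The algebra map `f ↦ !![s f, ∂f; 0, f]` where `∂` is the left derivative along `x` and
`s` is the sign automorphism `f ↦ (-1)^{|x||f|} f`. -/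
def derivHom (k : Type u) [Field k] {G : Type} [DecidableEq G] (par : G → ZMod 2) (x : G) :
    SuperPoly k par →ₐ[k] Matrix (Fin 2) (Fin 2) (SuperPoly k par) :=
  lift (fun y => !![ksgn k (par x * par y) • gen k par y, if y = x then 1 else 0;
      0, gen k par y]) <| by
    intro y z
    have e := gen_swap (k := k) (par := par) y z
    refine triangular_mul_comm ?_ ?_ e
    · simp only [smul_mul_smul_comm, e, smul_smul]; congr 1; ring
    · by_cases hy : y = x <;> by_cases hz : z = x
      · subst hy; subst hz
        simp only [if_true, one_mul, mul_one, smul_add, smul_smul, ksgn_mul_self, one_smul]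
        rw [add_comm]
      · subst hy; simp [hz, smul_smul, ksgn_mul_self]
      · subst hz; simp [hy, mul_comm (par y)]
      · simp [hy, hz]

/-- The left partial derivative: the `k`-linear map with `∂_x y = δ_{xy}`, `∂_x 1 = 0` and
`∂_x (f g) = ∂_x f · g + (-1)^{|x||f|} f · ∂_x g`. -/
def pderiv (k : Type u) [Field k] {G : Type} [DecidableEq G] (par : G → ZMod 2) (x : G) :
    SuperPoly k par →ₗ[k] SuperPoly k par where
  toFun f := derivHom k par x f 0 1
  map_add' := by simp
  map_smul' := by simp

/-- The constant coefficient second order operator `½ ∑ B(x,y) ∂_y ∂_x`. For an odd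
supersymmetric form `B` on `M` this is the Batalin-Vilkovisky operator of the algebra `S(M)`. -/
noncomputable def bvOperator {G : Type} [DecidableEq G] [Fintype G] (par : G → ZMod 2)
    (B : G → G → k) : SuperPoly k par →ₗ[k] SuperPoly k par :=
  (1 / 2 : k) • ∑ x, ∑ y, B x y • (pderiv k par y ∘ₗ pderiv k par x)

end SuperPoly

section Queer

variable {k : Type u} [Field k] {R : Type v} [Ring R] [Algebra k R] {N : ℕ}

/-- The index set of the standard basis of `U = k^{N|N}`: `Sum.inl` even, `Sum.inr` odd. -/
abbrev QIdx (N : ℕ) : Type := Fin N ⊕ Fin N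

/-- The parity of a basis vector of `U`. -/
def qIdxPar {N : ℕ} : QIdx N → ZMod 2 := Sum.elim (fun _ => 0) (fun _ => 1)

/-- The odd involution `p` of `U`, exchanging the even and the odd basis vectors. -/
def oddInv (R : Type v) [Ring R] (N : ℕ) : Matrix (QIdx N) (QIdx N) R :=
  Matrix.fromBlocks 0 1 1 0

/-- The matrix `M` (acting on the right `R`-module `U ⊗ R`) is an element of parity `d` of
`q(U) ⊗ R`: the entries have the parities of a supermatrix of parity `d`, and the
supercommutator `[M, p] = M p - (-1)^d p M` vanishes. Here `𝓡` is the grading of the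
superalgebra `R`. For `R = k` these are the matrices with blocks `X, Y, -Y, X`. -/
def IsQ (𝓡 : ZMod 2 → Submodule k R) (d : ZMod 2) (M : Matrix (QIdx N) (QIdx N) R) : Prop :=
  (∀ a b, M a b ∈ 𝓡 (d + qIdxPar a + qIdxPar b)) ∧
    M * oddInv R N = ksgn k d • (oddInv R N * M)

/-- The supertrace of a supermatrix of parity `d`. -/
def superTrace (k : Type u) [Field k] {R : Type v} [Ring R] [Algebra k R] {N : ℕ} (d : ZMod 2)
    (M : Matrix (QIdx N) (QIdx N) R) : R :=
  ∑ a, M (Sum.inl a) (Sum.inl a) - ksgn k d • ∑ a, M (Sum.inr a) (Sum.inr a)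

/-- The odd trace `otr M = ½ tr (M p)` of an element of parity `d` of `q(U) ⊗ R`. -/
noncomputable def oddTrace (k : Type u) [Field k] {R : Type v} [Ring R] [Algebra k R] {N : ℕ}
    (d : ZMod 2) (M : Matrix (QIdx N) (QIdx N) R) : R :=
  (1 / 2 : k) • superTrace k (d + 1) (M * oddInv R N)

theorem mul_oddInv_apply (M : Matrix (QIdx N) (QIdx N) R) (a b : QIdx N) :
    (M * oddInv R N) a b = M a b.swap := by
  rcases b with b | b <;>
    simp [oddInv, Matrix.mul_apply, Matrix.fromBlocks, Matrix.one_apply]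

theorem oddInv_mul_apply (M : Matrix (QIdx N) (QIdx N) R) (a b : QIdx N) :
    (oddInv R N * M) a b = M a.swap b := by
  rcases a with a | a <;>
    simp [oddInv, Matrix.mul_apply, Matrix.fromBlocks, Matrix.one_apply]

variable {𝓡 : ZMod 2 → Submodule k R}

theorem IsQ.swap_apply {d : ZMod 2} {M : Matrix (QIdx N) (QIdx N) R} (h : IsQ 𝓡 d M)
    (a b : QIdx N) : M a b.swap = ksgn k d • M a.swap b := by
  have := congrFun (congrFun h.2 a) b
  rwa [mul_oddInv_apply, Matrix.smul_apply, oddInv_mul_apply] at this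

theorem IsQ.oddTrace_eq [CharZero k] {d : ZMod 2} {M : Matrix (QIdx N) (QIdx N) R}
    (h : IsQ 𝓡 d M) : oddTrace k d M = ∑ a, M (Sum.inl a) (Sum.inr a) := by
  have h1 : ∀ a : Fin N, M (Sum.inr a) (Sum.inl a) = ksgn k d • M (Sum.inl a) (Sum.inr a) :=
    fun a => h.swap_apply (Sum.inr a) (Sum.inr a)
  simp only [oddTrace, superTrace, mul_oddInv_apply, Sum.swap_inl, Sum.swap_inr, h1,
    ← Finset.smul_sum, smul_smul, ksgn_add, ksgn_one]
  rw [mul_comm (ksgn k d), mul_assoc, ksgn_mul_self]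
  simp only [mul_one, neg_smul, one_smul, sub_neg_eq_add, ← two_smul k, smul_smul]
  norm_num

theorem IsQ.mul (hmul : ∀ i j x y, x ∈ 𝓡 i → y ∈ 𝓡 j → x * y ∈ 𝓡 (i + j)) {d e : ZMod 2}
    {A B : Matrix (QIdx N) (QIdx N) R} (hA : IsQ 𝓡 d A) (hB : IsQ 𝓡 e B) :
    IsQ 𝓡 (d + e) (A * B) := by
  refine ⟨fun a b => ?_, ?_⟩
  · rw [Matrix.mul_apply]
    refine Submodule.sum_mem _ fun c _ => ?_
    have h := hmul _ _ _ _ (hA.1 a c) (hB.1 c b)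
    have e2 : ∀ d e a b c : ZMod 2, d + a + c + (e + c + b) = d + e + a + b := by decide
    rwa [e2] at h
  · rw [Matrix.mul_assoc, hB.2, Matrix.mul_smul, ← Matrix.mul_assoc, hA.2, Matrix.smul_mul,
      smul_smul, Matrix.mul_assoc, ksgn_add, mul_comm (ksgn k e)]

theorem IsQ.oddTrace_mul_comm [CharZero k]
    (hmul : ∀ i j x y, x ∈ 𝓡 i → y ∈ 𝓡 j → x * y ∈ 𝓡 (i + j))
    (hcomm : ∀ i j x y, x ∈ 𝓡 i → y ∈ 𝓡 j → x * y = ksgn k (i * j) • (y * x)) {d e : ZMod 2}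
    {A B : Matrix (QIdx N) (QIdx N) R} (hA : IsQ 𝓡 d A) (hB : IsQ 𝓡 e B) :
    oddTrace k (d + e) (A * B) = ksgn k (d * e) • oddTrace k (e + d) (B * A) := by
  have hl : ∀ {f : ZMod 2} {M : Matrix (QIdx N) (QIdx N) R}, IsQ 𝓡 f M → ∀ a b : Fin N,
      M (Sum.inr a) (Sum.inr b) = ksgn k f • M (Sum.inl a) (Sum.inl b) :=
    fun hM a b => hM.swap_apply (Sum.inr a) (Sum.inl b)
  rw [(hA.mul hmul hB).oddTrace_eq, (hB.mul hmul hA).oddTrace_eq]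
  simp only [Matrix.mul_apply, Fintype.sum_sum_type, hl hA, hl hB, Finset.smul_sum, smul_add,
    Finset.sum_add_distrib]
  rw [add_comm, Finset.sum_comm, Finset.sum_comm (γ := Fin N) (α := Fin N)
    (f := fun x i => A (Sum.inl x) (Sum.inl i) * B (Sum.inl i) (Sum.inr x))]
  congr 1
  · refine Finset.sum_congr rfl fun a _ => Finset.sum_congr rfl fun b _ => ?_
    rw [mul_smul_comm, hcomm _ _ _ _ (hA.1 _ _) (hB.1 _ _), smul_smul, ← ksgn_add]
    congr 2
    simp only [qIdxPar, Sum.elim_inl, Sum.elim_inr]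
    have : ∀ d e : ZMod 2, e + (d + 0 + 1) * (e + 0 + 0) = d * e := by decide
    exact this d e
  · refine Finset.sum_congr rfl fun a _ => Finset.sum_congr rfl fun b _ => ?_
    rw [mul_smul_comm, hcomm _ _ _ _ (hA.1 _ _) (hB.1 _ _), smul_smul, ← ksgn_add]
    congr 2
    simp only [qIdxPar, Sum.elim_inl, Sum.elim_inr]
    have : ∀ d e : ZMod 2, (d + 0 + 0) * (e + 0 + 1) = d * e + d := by decide
    exact this d e

end Queer

section MatrixSide

/-- Coordinates of `Hom(ΠV, q(U))`: `(0, i, α, β)` is the entry `X_{i,α}^β` and `(1, i, α, β)`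
the entry `Y_{i,α}^β` of the image of the `i`-th basis vector of `ΠV`, with blocks as in `IsQ`.
They form a basis of the super vector space `Hom(q(U), ΠV)`. -/
abbrev QVar (d N : ℕ) : Type := ZMod 2 × Fin d × Fin N × Fin N

variable {d : ℕ}

/-- The parity of a coordinate, `p i` being the parity of the `i`-th basis vector of `ΠV`. -/
def qVarPar (p : Fin d → ZMod 2) (N : ℕ) (x : QVar d N) : ZMod 2 := p x.2.1 + x.1

/-- The algebra `⊕ S^n Hom(q(U), ΠV)`, of polynomial functions on `Hom(ΠV, q(U))`. -/
abbrev MatrixAlg (k : Type u) [Field k] (p : Fin d → ZMod 2) (N : ℕ) : Type u :=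
  SuperPoly k (qVarPar p N)

/-- The `q(U)`-valued linear function `A_i` on `Hom(ΠV, q(U))` of the `i`-th basis vector. -/
def genericMatrix (k : Type u) [Field k] (p : Fin d → ZMod 2) (N : ℕ) (i : Fin d) :
    Matrix (QIdx N) (QIdx N) (MatrixAlg k p N) :=
  let X : Matrix (Fin N) (Fin N) (MatrixAlg k p N) :=
    Matrix.of fun a b => SuperPoly.gen k (qVarPar p N) (0, i, a, b)
  let Y : Matrix (Fin N) (Fin N) (MatrixAlg k p N) :=
    Matrix.of fun a b => SuperPoly.gen k (qVarPar p N) (1, i, a, b)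
  Matrix.fromBlocks X Y (ksgn k (p i) • Y) (ksgn k (p i) • X)

/-- The parity of the word `a_{w 1} … a_{w r}` in `(ΠV)^{⊗ r}`. -/
def wordPar (p : Fin d → ZMod 2) (w : List (Fin d)) : ZMod 2 := (w.map p).sum

/-- The function `otr(A_{w 1} ⋯ A_{w r})` on `Hom(ΠV, q(U))`. -/
noncomputable def oddTraceWord (k : Type u) [Field k] (p : Fin d → ZMod 2) (N : ℕ)
    (w : List (Fin d)) : MatrixAlg k p N :=
  oddTrace k (wordPar p w) (w.map (genericMatrix k p N)).prod

/-- The odd form on `Hom(q(U), ΠV) = ΠV ⊗ q(U)^*` induced by the form `L` on `V` and by the odd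
form `⟨G, G'⟩ = otr(G G')` on `q(U)`: `(a ⊗ g, b ⊗ h) ↦ (-1)^{|g||b|} l(a, b) η(g, h)`, where
`η` is the form on `q(U)^*` given by `η(⟨G,·⟩, ⟨G',·⟩) = (-1)^{|G|} ⟨G, G'⟩`, that is
`η(y_α^β, x_β^α) = 1`, `η(x_α^β, y_β^α) = -1`, and `η = 0` on other pairs of coordinates. -/
def oddForm {k : Type u} [Field k] (p : Fin d → ZMod 2) (N : ℕ) (L : Fin d → Fin d → k)
    (x y : QVar d N) : k :=
  if x.1 + y.1 = 1 ∧ x.2.2.1 = y.2.2.2 ∧ x.2.2.2 = y.2.2.1 then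
    ksgn k (x.1 * p y.2.1) * L x.2.1 y.2.1 * ksgn k y.1
  else 0

/-- The matrix Batalin-Vilkovisky Laplacian on `⊕ S^n Hom(q(U), ΠV)`. -/
noncomputable def matrixBV {k : Type u} [Field k] (p : Fin d → ZMod 2) (N : ℕ)
    (L : Fin d → Fin d → k) : MatrixAlg k p N →ₗ[k] MatrixAlg k p N :=
  SuperPoly.bvOperator (qVarPar p N) (oddForm p N L)

/-- Invariance of a function on `Hom(ΠV, q(U))` under the supergroup
`GQ(U) = {g ∈ GL(U) | g p g⁻¹ = p}`, in terms of points over supercommutative algebras `R`: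
an `R`-point of `Hom(ΠV, q(U))` is a parity preserving algebra map from the algebra of functions
to `R`, and `f` takes the same value on any two `R`-points `φ` and `ψ = g φ g⁻¹`, `g ∈ GQ(U)(R)`. -/
def IsGQInvariant {k : Type u} [Field k] {p : Fin d → ZMod 2} {N : ℕ}
    (f : MatrixAlg k p N) : Prop :=
  ∀ (R : Type u) [Ring R] [Algebra k R] (𝓡 : ZMod 2 → Submodule k R) [GradedAlgebra 𝓡],
    (∀ i j, ∀ a ∈ 𝓡 i, ∀ b ∈ 𝓡 j, a * b = ksgn k (i * j) • (b * a)) →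
    ∀ φ ψ : MatrixAlg k p N →ₐ[k] R,
      (∀ x, φ (SuperPoly.gen k _ x) ∈ 𝓡 (qVarPar p N x)) →
      (∀ x, ψ (SuperPoly.gen k _ x) ∈ 𝓡 (qVarPar p N x)) →
      ∀ g g' : Matrix (QIdx N) (QIdx N) R, IsQ 𝓡 0 g → g * g' = 1 → g' * g = 1 →
        (∀ i, (genericMatrix k p N i).map ψ = g * (genericMatrix k p N i).map φ * g') →
        ψ f = φ f

/-- The invariants `(S^n Hom(q(U), ΠV))^{GQ(U)}`. -/
def gqInvariants (k : Type u) [Field k] (p : Fin d → ZMod 2) (N n : ℕ) :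
    Set (MatrixAlg k p N) :=
  {f | f ∈ SuperPoly.power k (qVarPar p N) n ∧ IsGQInvariant f}

end MatrixSide

section Cyclic

variable {d : ℕ}

/-- The relations between the generators `(a_{w 1} … a_{w r})^c`, of parity `1 + |w|`, of
`Sym(⊕_{j ≥ 1} Π ((ΠV)^{⊗ j})^{ℤ/j})`. The empty word is set to zero. -/
inductive CyclicAlg.Rel (k : Type u) [Field k] (p : Fin d → ZMod 2) :
    FreeAlgebra k (List (Fin d)) → FreeAlgebra k (List (Fin d)) → Prop
  | swap (v w : List (Fin d)) : CyclicAlg.Rel k p (FreeAlgebra.ι k v * FreeAlgebra.ι k w)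
      (ksgn k ((wordPar p v + 1) * (wordPar p w + 1)) • (FreeAlgebra.ι k w * FreeAlgebra.ι k v))
  | rot (a : Fin d) (w : List (Fin d)) : CyclicAlg.Rel k p (FreeAlgebra.ι k (a :: w))
      (ksgn k (p a * wordPar p w) • FreeAlgebra.ι k (w ++ [a]))
  | nil : CyclicAlg.Rel k p (FreeAlgebra.ι k []) 0

/-- The algebra `F = Sym(⊕_{j ≥ 1} Π ((ΠV)^{⊗ j})^{ℤ/j})`, where `ΠV` has a homogeneous basis
`a_i` of parities `p i` and invariants are identified with coinvariants. -/
def CyclicAlg (k : Type u) [Field k] (p : Fin d → ZMod 2) : Type u :=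
  RingQuot (CyclicAlg.Rel k p)

instance (k : Type u) [Field k] (p : Fin d → ZMod 2) : Ring (CyclicAlg k p) :=
  inferInstanceAs (Ring (RingQuot (CyclicAlg.Rel k p)))

instance (k : Type u) [Field k] (p : Fin d → ZMod 2) : Algebra k (CyclicAlg k p) :=
  inferInstanceAs (Algebra k (RingQuot (CyclicAlg.Rel k p)))

namespace CyclicAlg

variable {k : Type u} [Field k] {p : Fin d → ZMod 2}

/-- The projection from the free algebra. -/
def mk (k : Type u) [Field k] (p : Fin d → ZMod 2) :
    FreeAlgebra k (List (Fin d)) →ₐ[k] CyclicAlg k p :=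
  RingQuot.mkAlgHom k (CyclicAlg.Rel k p)

theorem mk_rel {x y : FreeAlgebra k (List (Fin d))} (h : CyclicAlg.Rel k p x y) :
    mk k p x = mk k p y :=
  RingQuot.mkAlgHom_rel k h

theorem mk_surjective : Function.Surjective (mk k p) :=
  RingQuot.mkAlgHom_surjective k (CyclicAlg.Rel k p)

/-- Algebra maps out of `CyclicAlg` are given by values on the cyclic words. -/
def lift {A : Type v} [Ring A] [Algebra k A] (f : List (Fin d) → A)
    (hswap : ∀ v w, f v * f w =
      ksgn k ((wordPar p v + 1) * (wordPar p w + 1)) • (f w * f v))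
    (hrot : ∀ a w, f (a :: w) = ksgn k (p a * wordPar p w) • f (w ++ [a]))
    (hnil : f [] = 0) : CyclicAlg k p →ₐ[k] A :=
  RingQuot.liftAlgHom k ⟨FreeAlgebra.lift k f, by
    rintro _ _ (⟨v, w⟩ | ⟨a, w⟩ | _)
    · simpa using hswap v w
    · simpa using hrot a w
    · simpa using hnil⟩

/-- The cyclic word `(a_{w 1} … a_{w r})^c`. -/
def cyc (k : Type u) [Field k] (p : Fin d → ZMod 2) (w : List (Fin d)) : CyclicAlg k p :=
  mk k p (FreeAlgebra.ι k w)

theorem lift_cyc {A : Type v} [Ring A] [Algebra k A] (f : List (Fin d) → A)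
    (hswap : ∀ v w, f v * f w =
      ksgn k ((wordPar p v + 1) * (wordPar p w + 1)) • (f w * f v))
    (hrot : ∀ a w, f (a :: w) = ksgn k (p a * wordPar p w) • f (w ++ [a]))
    (hnil : f [] = 0) (w : List (Fin d)) : lift f hswap hrot hnil (cyc k p w) = f w := by
  have h : lift f hswap hrot hnil (cyc k p w) = FreeAlgebra.lift k f (FreeAlgebra.ι k w) :=
    RingQuot.liftAlgHom_mkAlgHom_apply _ _ _ _
  rw [h, FreeAlgebra.lift_ι_apply]

/-- The component `F_n`, spanned by the products of cyclic words of total length `n`. -/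
def component (k : Type u) [Field k] (p : Fin d → ZMod 2) (n : ℕ) :
    Submodule k (CyclicAlg k p) :=
  Submodule.span k {x | ∃ ws : List (List (Fin d)),
    (ws.map List.length).sum = n ∧ x = (ws.map (cyc k p)).prod}

theorem cyc_swap (v w : List (Fin d)) : cyc k p v * cyc k p w =
    ksgn k ((wordPar p v + 1) * (wordPar p w + 1)) • (cyc k p w * cyc k p v) := by
  have := mk_rel (CyclicAlg.Rel.swap (k := k) (p := p) v w)
  simpa [cyc] using this

theorem cyc_rot (a : Fin d) (w : List (Fin d)) :
    cyc k p (a :: w) = ksgn k (p a * wordPar p w) • cyc k p (w ++ [a]) := by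
  have := mk_rel (CyclicAlg.Rel.rot (k := k) (p := p) a w)
  simpa [cyc] using this

theorem cyc_nil : cyc k p [] = 0 := by
  have := mk_rel (CyclicAlg.Rel.nil (k := k) (p := p))
  simpa [cyc] using this

theorem cyc_append_comm (v w : List (Fin d)) :
    cyc k p (v ++ w) = ksgn k (wordPar p v * wordPar p w) • cyc k p (w ++ v) := by
  induction v generalizing w with
  | nil => simp [wordPar, ksgn_zero]
  | cons a v ih =>
    have := ih (w ++ [a])
    rw [List.cons_append, cyc_rot, List.append_assoc, this, smul_smul, ← ksgn_add]
    simp only [List.append_assoc, List.cons_append, List.nil_append]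
    congr 2
    simp only [wordPar, List.map_append, List.sum_append, List.map_cons, List.sum_cons,
      List.map_nil, List.sum_nil]
    generalize (List.map p v).sum = x
    generalize (List.map p w).sum = y
    generalize p a = z
    revert x y z; decide

/-- The Koszul sign for cutting the cyclic word `w` before its letter number `i`. -/
def rotSgn (k : Type u) [Field k] (p : Fin d → ZMod 2) (w : List (Fin d)) (i : ℕ) : k :=
  ksgn k (wordPar p (w.take i) * wordPar p (w.drop i))

/-- The sum over all ways of cutting the cyclic word `w` open, with Koszul signs. -/
def rotSum {A : Type u} [AddCommGroup A] [Module k A] (p : Fin d → ZMod 2)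
    (f : List (Fin d) → A) (w : List (Fin d)) : A :=
  ∑ i ∈ Finset.range w.length, rotSgn k p w i • f (w.rotate i)

theorem rotSum_nil {A : Type u} [AddCommGroup A] [Module k A] (f : List (Fin d) → A) :
    rotSum (k := k) p f [] = 0 := by simp [rotSum]

theorem rotSum_rot {A : Type u} [AddCommGroup A] [Module k A] (f : List (Fin d) → A)
    (a : Fin d) (w : List (Fin d)) :
    rotSum (k := k) p f (a :: w) = ksgn k (p a * wordPar p w) • rotSum (k := k) p f (w ++ [a]) := by
  have h : ∀ i ∈ Finset.range (w.length + 1),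
      ksgn k (p a * wordPar p w) • (rotSgn k p (w ++ [a]) i • f ((w ++ [a]).rotate i)) =
        rotSgn k p (a :: w) (i + 1) • f ((a :: w).rotate (i + 1)) := by
    intro i hi
    have hi' : i ≤ w.length := Nat.lt_succ_iff.mp (Finset.mem_range.mp hi)
    rw [List.rotate_cons_succ, smul_smul]
    congr 1
    rw [rotSgn, rotSgn, ← ksgn_add, List.take_append_of_le_length hi',
      List.drop_append_of_le_length hi']
    congr 1
    have hw : wordPar p w = wordPar p (w.take i) + wordPar p (w.drop i) := by
      conv_lhs => rw [← List.take_append_drop i w]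
      simp [wordPar]
    rw [hw]
    simp only [wordPar, List.map_append, List.sum_append, List.map_cons, List.sum_cons,
      List.map_nil, List.sum_nil, List.take_succ_cons, List.drop_succ_cons]
    generalize (List.map p (List.take i w)).sum = x
    generalize (List.map p (List.drop i w)).sum = y
    generalize p a = z
    revert x y z; decide
  have hl : (w ++ [a]).length = w.length + 1 := by simp
  unfold rotSum
  rw [hl, List.length_cons, Finset.smul_sum, Finset.sum_congr rfl h,
    Finset.sum_range_succ (fun i => rotSgn k p (a :: w) (i + 1) • f ((a :: w).rotate (i + 1))),
    Finset.sum_range_succ']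
  congr 1
  have h1 : (a :: w).rotate (w.length + 1) = a :: w := by
    rw [← List.length_cons (a := a)]; exact List.rotate_length _
  rw [h1]
  simp [rotSgn, wordPar]

theorem rotSum_smul {A : Type u} [AddCommGroup A] [Module k A] (f : List (Fin d) → A)
    (c : k) (w : List (Fin d)) :
    rotSum (k := k) p (fun v => c • f v) w = c • rotSum (k := k) p f w := by
  simp only [rotSum, Finset.smul_sum]
  exact Finset.sum_congr rfl fun i _ => smul_comm _ _ _

theorem rotSum_mem {A : Type u} [AddCommGroup A] [Module k A] {f : List (Fin d) → A}
    {w : List (Fin d)} {S : Submodule k A}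
    (h : ∀ v, wordPar p v = wordPar p w → f v ∈ S) : rotSum (k := k) p f w ∈ S := by
  refine Submodule.sum_mem _ fun i _ => Submodule.smul_mem _ _ (h _ ?_)
  exact ((List.rotate_perm w i).map p).sum_eq

/-- The contraction of the first letters of `v` and `w`, gluing the rests into one cyclic word:
`π a u · π b u' = (-1)^{|a|+|u|+|b||u|} π π a b u u' ↦ (-1)^{|a|+|u|+|b||u|} l(a, b) π u u'`. -/
def mergeTerm (p : Fin d → ZMod 2) (L : Fin d → Fin d → k) :
    List (Fin d) → List (Fin d) → CyclicAlg k p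
  | a :: u, b :: u' =>
    (ksgn k (p a + wordPar p u + p b * wordPar p u) * L a b) • cyc k p (u ++ u')
  | _, _ => 0

/-- The contractions of the first letter of `w` with each of its other letters, cutting the rest
into two cyclic words: `π a u b u' = (-1)^{|b||u|} π a b u u' ↦ (-1)^{|b||u|} l(a, b) π π u u'
= (-1)^{|b||u|+|u|} l(a, b) π u · π u'`. -/
def splitTerm (p : Fin d → ZMod 2) (L : Fin d → Fin d → k) : List (Fin d) → CyclicAlg k p
  | a :: w => ∑ j : Fin w.length,
      (ksgn k (p (w.get j) * wordPar p (w.take j) + wordPar p (w.take j)) * L a (w.get j)) •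
        (cyc k p (w.take j) * cyc k p (w.drop (j + 1)))
  | [] => 0

/-- The sum over all pairs of a letter of `v` and a letter of `w` of their contraction. -/
def merge (p : Fin d → ZMod 2) (L : Fin d → Fin d → k) (v w : List (Fin d)) : CyclicAlg k p :=
  rotSum (k := k) p (fun v' => rotSum (k := k) p (fun w' => mergeTerm p L v' w') w) v

/-- The sum over all pairs of letters of `w` of their contraction. Each pair occurs in both
orders, with equal contributions; hence the factor `½`. -/
noncomputable def split (p : Fin d → ZMod 2) (L : Fin d → Fin d → k) (w : List (Fin d)) :
    CyclicAlg k p :=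
  (1 / 2 : k) • rotSum (k := k) p (splitTerm p L) w

/-- `L` is the Gram matrix of an even supersymmetric form on `V`, in a homogeneous basis whose
parities are those of `p` shifted by one. -/
structure IsEvenGram (p : Fin d → ZMod 2) (L : Fin d → Fin d → k) : Prop where
  even : ∀ i j, p i ≠ p j → L i j = 0
  symm : ∀ i j, L i j = ksgn k ((p i + 1) * (p j + 1)) * L j i

/-- The parity of a cyclic word. -/
def cycPar (p : Fin d → ZMod 2) (w : List (Fin d)) : ZMod 2 := wordPar p w + 1

variable {L : Fin d → Fin d → k}

theorem mergeTerm_symm (hL : IsEvenGram p L) (v w : List (Fin d)) :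
    mergeTerm p L v w = ksgn k (cycPar p v * cycPar p w) • mergeTerm p L w v := by
  rcases v with _ | ⟨a, v⟩ <;> rcases w with _ | ⟨b, w⟩ <;> simp only [mergeTerm, smul_zero]
  by_cases hab : p a = p b
  · rw [cyc_append_comm, hL.symm a b, smul_smul, smul_smul, hab]
    congr 1
    simp only [← mul_assoc]
    rw [mul_right_comm, ← ksgn_add, ← ksgn_add, ← ksgn_add]
    congr 2
    simp only [cycPar, wordPar, List.map_cons, List.sum_cons, hab]
    generalize (List.map p v).sum = x
    generalize (List.map p w).sum = y
    generalize p b = z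
    revert x y z; decide
  · rw [hL.even a b hab, hL.even b a (Ne.symm hab)]; simp

theorem merge_symm (hL : IsEvenGram p L) (v w : List (Fin d)) :
    merge p L v w = ksgn k (cycPar p v * cycPar p w) • merge p L w v := by
  have hp : ∀ (w : List (Fin d)) (i : ℕ), cycPar p (w.rotate i) = cycPar p w := fun w i => by
    unfold cycPar wordPar; rw [((List.rotate_perm w i).map p).sum_eq]
  unfold merge rotSum
  simp only [Finset.smul_sum]
  rw [Finset.sum_comm]
  refine Finset.sum_congr rfl fun i _ => Finset.sum_congr rfl fun j _ => ?_
  rw [mergeTerm_symm hL, hp, hp, smul_smul, smul_smul, smul_smul, smul_smul]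
  congr 1
  ring

theorem merge_mem (hL : IsEvenGram p L) (v w : List (Fin d)) :
    merge p L v w ∈ parityPart k (cyc k p) (cycPar p) (cycPar p v + cycPar p w + 1) := by
  refine rotSum_mem fun v' hv => rotSum_mem fun w' hw => ?_
  rcases v' with _ | ⟨a, v'⟩ <;> rcases w' with _ | ⟨b, w'⟩ <;> simp only [mergeTerm, zero_mem]
  by_cases hab : p a = p b
  · refine Submodule.smul_mem _ _ ?_
    have h := gen_mem_parityPart (k := k) (g := cyc k p) (par := cycPar p) (v' ++ w')
    have e : cycPar p (v' ++ w') = cycPar p v + cycPar p w + 1 := by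
      unfold cycPar
      rw [← hv, ← hw]
      simp only [wordPar, List.map_append, List.map_cons, List.sum_append, List.sum_cons, hab]
      generalize (List.map p v').sum = x
      generalize (List.map p w').sum = y
      generalize p b = z
      revert x y z; decide
    rwa [e] at h
  · rw [hL.even a b hab]; simp

theorem split_mem (hL : IsEvenGram p L) (w : List (Fin d)) :
    split p L w ∈ parityPart k (cyc k p) (cycPar p) (cycPar p w + 1) := by
  refine Submodule.smul_mem _ _ (rotSum_mem fun w' hw => ?_)
  rcases w' with _ | ⟨a, w'⟩ <;> simp only [splitTerm, zero_mem]
  refine Submodule.sum_mem _ fun j _ => ?_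
  by_cases hab : p a = p (w'.get j)
  · refine Submodule.smul_mem _ _ ?_
    have h := mul_mem_parityPart
      (gen_mem_parityPart (k := k) (g := cyc k p) (par := cycPar p) (w'.take j))
      (gen_mem_parityPart (k := k) (g := cyc k p) (par := cycPar p) (w'.drop (j + 1)))
    have hd : w' = w'.take j ++ w'.get j :: w'.drop (j + 1) := by simp
    have e : cycPar p (w'.take j) + cycPar p (w'.drop (j + 1)) = cycPar p w + 1 := by
      unfold cycPar
      rw [← hw]
      conv_rhs => rw [hd]
      simp only [wordPar, List.map_append, List.map_cons, List.sum_append, List.sum_cons, hab]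
      generalize (List.map p (List.take (j : ℕ) w')).sum = x
      generalize (List.map p (List.drop ((j : ℕ) + 1) w')).sum = y
      generalize p (w'.get j) = z
      revert x y z; decide
    rwa [e] at h
  · rw [hL.even _ _ hab]; simp

/-- The algebra map `f ↦ !![s f, {v, f}; 0, f]` where `{v, ·}` is the derivation of parity
`|v| + 1` extending `merge v`, and `s f = (-1)^{(|v|+1)|f|} f`. -/
def bracketHom (hL : IsEvenGram p L) (v : List (Fin d)) :
    CyclicAlg k p →ₐ[k] Matrix (Fin 2) (Fin 2) (CyclicAlg k p) :=
  lift (fun w => !![ksgn k ((cycPar p v + 1) * cycPar p w) • cyc k p w, merge p L v w;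
      0, cyc k p w])
    (by
      intro w w'
      have e := cyc_swap (k := k) (p := p) w w'
      have h1 := fun x => parityPart_comm (k := k) (cyc_swap (k := k) (p := p)) (merge_mem hL v w)
        (gen_mem_parityPart (k := k) (g := cyc k p) (par := cycPar p) x)
      have h2 := fun x => parityPart_comm (k := k) (cyc_swap (k := k) (p := p)) (merge_mem hL v w')
        (gen_mem_parityPart (k := k) (g := cyc k p) (par := cycPar p) x)
      refine triangular_mul_comm ?_ ?_ e
      · simp only [smul_mul_smul_comm, e, smul_smul]; congr 1; ring
      · rw [h1 w', h2 w, smul_mul_assoc, smul_mul_assoc, smul_add, smul_smul, smul_smul,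
          ← ksgn_add, ← ksgn_add, add_comm]
        change _ + _ = ksgn k (cycPar p w * cycPar p w' + _) • _ +
          ksgn k (cycPar p w * cycPar p w' + _) • _
        generalize cycPar p w = x
        generalize cycPar p w' = y
        generalize cycPar p v = z
        have e1 : ∀ x y z : ZMod 2, (z + x + 1) * y = x * y + (z + 1) * y := by decide
        have e2 : ∀ x y z : ZMod 2, x * y + (z + y + 1) * x = (z + 1) * x := by decide
        rw [e1, e2])
    (by
      intro a w
      have hp : cycPar p (a :: w) = cycPar p (w ++ [a]) := by simp [cycPar, wordPar, add_comm]
      have hm : merge p L v (a :: w) = ksgn k (p a * wordPar p w) • merge p L v (w ++ [a]) := by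
        simp only [merge, rotSum_rot _ a w]
        rw [rotSum_smul]
      rw [hp, hm, cyc_rot]
      ext i j
      fin_cases i <;> fin_cases j <;> simp [smul_smul, mul_comm])
    (by
      have : merge p L v [] = 0 := by simp [merge, rotSum]
      rw [this, cyc_nil, smul_zero]
      ext i j
      fin_cases i <;> fin_cases j <;> rfl)

theorem bracketHom_cyc (hL : IsEvenGram p L) (v w : List (Fin d)) :
    bracketHom hL v (cyc k p w) =
      !![ksgn k ((cycPar p v + 1) * cycPar p w) • cyc k p w, merge p L v w; 0, cyc k p w] :=
  lift_cyc _ _ _ _ w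

theorem bracketHom_apply_one_one (hL : IsEvenGram p L) (v : List (Fin d)) (f : CyclicAlg k p) :
    bracketHom hL v f 1 0 = 0 ∧ bracketHom hL v f 1 1 = f := by
  obtain ⟨f, rfl⟩ := mk_surjective f
  induction f using FreeAlgebra.induction with
  | grade0 r => simp [Matrix.algebraMap_matrix_apply]
  | grade1 w =>
    have h := bracketHom_cyc hL v w
    unfold cyc at h
    rw [h]
    exact ⟨rfl, rfl⟩
  | mul a b ha hb =>
    simp only [map_mul, Matrix.mul_apply, Fin.sum_univ_two, ha.1, ha.2, hb.1, hb.2]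
    simp
  | add a b ha hb => simp [ha.1, ha.2, hb.1, hb.2]

/-- The derivation `{v, ·}`. -/
def bracket (hL : IsEvenGram p L) (v : List (Fin d)) : CyclicAlg k p →ₗ[k] CyclicAlg k p where
  toFun f := bracketHom hL v f 0 1
  map_add' := by simp
  map_smul' := by simp

theorem bracket_cyc_mul (hL : IsEvenGram p L) (v w : List (Fin d)) (f : CyclicAlg k p) :
    bracket hL v (cyc k p w * f) = merge p L v w * f +
      ksgn k ((cycPar p v + 1) * cycPar p w) • (cyc k p w * bracket hL v f) := by
  simp only [bracket, LinearMap.coe_mk, AddHom.coe_mk, map_mul, bracketHom_cyc]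
  rw [Matrix.mul_apply, Fin.sum_univ_two, (bracketHom_apply_one_one hL v f).2]
  simp [add_comm]

theorem bracket_ext (hL : IsEvenGram p L) (v v' : List (Fin d)) (c : k)
    (hp : cycPar p v = cycPar p v') (hm : ∀ w, merge p L v w = c • merge p L v' w) :
    bracket hL v = c • bracket hL v' := by
  have key : ∀ (f : FreeAlgebra k (List (Fin d))) (g : CyclicAlg k p),
      bracket hL v g = c • bracket hL v' g →
      bracket hL v (mk k p f * g) =
        c • bracket hL v' (mk k p f * g) := by
    intro f
    induction f using FreeAlgebra.induction with
    | grade0 r =>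
      intro g hg
      simp only [AlgHom.commutes, ← Algebra.smul_def, map_smul, hg]
      rw [smul_comm]
    | grade1 w =>
      intro g hg
      have h1 := bracket_cyc_mul hL v w g
      have h2 := bracket_cyc_mul hL v' w g
      unfold cyc at h1 h2
      rw [h1, h2, hg, hm, hp, smul_add, smul_mul_assoc, mul_smul_comm, smul_comm]
    | mul a b ha hb =>
      intro g hg
      rw [map_mul (mk k p), mul_assoc]
      exact ha _ (hb _ hg)
    | add a b ha hb =>
      intro g hg
      rw [map_add, add_mul, map_add, map_add, ha _ hg, hb _ hg, smul_add]
  have h1 : ∀ v, bracket hL v 1 = 0 := fun v => by simp [bracket]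
  ext f
  obtain ⟨f, rfl⟩ := mk_surjective f
  have := key f 1 (by simp [h1])
  simpa using this

/-- The operator `f ↦ κ (split w) f + {w, f}`. -/
noncomputable def bvStep (hL : IsEvenGram p L) (κ : k) (w : List (Fin d)) :
    Module.End k (CyclicAlg k p) :=
  LinearMap.mulLeft k (κ • split p L w) + bracket hL w

theorem mulLeft_mul' (x y : CyclicAlg k p) :
    LinearMap.mulLeft k x * LinearMap.mulLeft k y = LinearMap.mulLeft k (x * y) := by
  ext z; simp

theorem mulLeft_smul' (c : k) (x : CyclicAlg k p) :
    LinearMap.mulLeft k (c • x) = c • LinearMap.mulLeft k x := by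
  ext z; simp

theorem mulLeft_swap (v w : List (Fin d)) :
    (ksgn k (cycPar p v) • LinearMap.mulLeft k (cyc k p v)) *
        (ksgn k (cycPar p w) • LinearMap.mulLeft k (cyc k p w)) =
      ksgn k (cycPar p v * cycPar p w) • ((ksgn k (cycPar p w) • LinearMap.mulLeft k (cyc k p w)) *
        (ksgn k (cycPar p v) • LinearMap.mulLeft k (cyc k p v))) := by
  have e := cyc_swap (k := k) (p := p) v w
  ext f
  simp only [Module.End.mul_apply, LinearMap.smul_apply, LinearMap.mulLeft_apply, mul_smul_comm]
  rw [← mul_assoc, ← mul_assoc, e, smul_mul_assoc]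
  change _ • _ • ksgn k (cycPar p v * cycPar p w) • _ = _
  module

theorem bvStep_swap (hL : IsEvenGram p L) (κ : k) (v w : List (Fin d)) :
    (ksgn k (cycPar p v) • LinearMap.mulLeft k (cyc k p v)) * bvStep hL κ w +
        bvStep hL κ v * LinearMap.mulLeft k (cyc k p w) =
      ksgn k (cycPar p v * cycPar p w) •
        ((ksgn k (cycPar p w) • LinearMap.mulLeft k (cyc k p w)) * bvStep hL κ v +
        bvStep hL κ w * LinearMap.mulLeft k (cyc k p v)) := by
  ext f
  have h1 := parityPart_comm (k := k) (cyc_swap (k := k) (p := p)) (split_mem hL v)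
    (gen_mem_parityPart (k := k) (g := cyc k p) (par := cycPar p) w)
  have h2 := parityPart_comm (k := k) (cyc_swap (k := k) (p := p)) (split_mem hL w)
    (gen_mem_parityPart (k := k) (g := cyc k p) (par := cycPar p) v)
  simp only [LinearMap.add_apply, Module.End.mul_apply, LinearMap.smul_apply, bvStep,
    LinearMap.mulLeft_apply, bracket_cyc_mul, smul_mul_assoc, mul_add, smul_add,
    ← mul_assoc, mul_smul_comm]
  rw [h1, h2, merge_symm hL v w]
  change _ = ksgn k (cycPar p v * cycPar p w) • _ + ksgn k (cycPar p v * cycPar p w) • _ +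
    (ksgn k (cycPar p v * cycPar p w) • _ + (ksgn k (cycPar p v * cycPar p w) • _ +
    ksgn k (cycPar p v * cycPar p w) • _))
  simp only [smul_mul_assoc, smul_smul]
  generalize cycPar p v = x
  generalize cycPar p w = y
  have e1 : ksgn k ((x + 1) * y) = ksgn k (x * y) * ksgn k y := by
    rw [← ksgn_add]; congr 1; ring
  have e2 : ksgn k ((y + 1) * x) = ksgn k (x * y) * ksgn k x := by
    rw [← ksgn_add]; congr 1; ring
  have e3 : ∀ z : k, ksgn k (x * y) * (ksgn k (x * y) * z) = z := by
    intro z; rw [← mul_assoc, ksgn_mul_self, one_mul]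
  have e4 : ∀ z : k, ksgn k (x * y) * (z * (ksgn k (x * y) * ksgn k x)) = z * ksgn k x := by
    intro z; rw [mul_left_comm, e3]
  rw [e1, e2]
  simp only [e3, e4]
  module

/-- The algebra map to operators on `F` with `w ↦ !![(-1)^{|w|} w, κ split w + {w, ·}; 0, w]`. -/
noncomputable def bvHom (hL : IsEvenGram p L) (κ : k) :
    CyclicAlg k p →ₐ[k] Matrix (Fin 2) (Fin 2) (Module.End k (CyclicAlg k p)) :=
  lift (fun w => !![ksgn k (cycPar p w) • LinearMap.mulLeft k (cyc k p w), bvStep hL κ w;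
      0, LinearMap.mulLeft k (cyc k p w)])
    (by
      intro v w
      refine triangular_mul_comm (A := Module.End k (CyclicAlg k p)) (mulLeft_swap v w)
        (bvStep_swap hL κ v w) ?_
      rw [mulLeft_mul', mulLeft_mul', cyc_swap v w, mulLeft_smul'])
    (by
      intro a w
      have hp : cycPar p (a :: w) = cycPar p (w ++ [a]) := by simp [cycPar, wordPar, add_comm]
      have hs : split p L (a :: w) = ksgn k (p a * wordPar p w) • split p L (w ++ [a]) := by
        simp only [split, rotSum_rot _ a w, smul_smul, mul_comm]
      have hm : ∀ v, merge p L (a :: w) v = ksgn k (p a * wordPar p w) • merge p L (w ++ [a]) v :=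
        fun v => by simp only [merge, rotSum_rot _ a w]
      have hb : bracket hL (a :: w) = ksgn k (p a * wordPar p w) • bracket hL (w ++ [a]) :=
        bracket_ext hL _ _ _ hp hm
      have hc : bvStep hL κ (a :: w) = ksgn k (p a * wordPar p w) • bvStep hL κ (w ++ [a]) := by
        rw [bvStep, bvStep, hs, hb, smul_comm κ, mulLeft_smul', smul_add]
      rw [hp, cyc_rot, hc, mulLeft_smul', smul_comm (ksgn k (cycPar p (w ++ [a])))]
      ext i j
      fin_cases i <;> fin_cases j <;> simp)
    (by
      have hm : ∀ v, merge p L [] v = (0 : k) • merge p L [] v := fun v => by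
        simp [merge, rotSum]
      have hb : bracket hL [] = 0 := by
        rw [bracket_ext hL [] [] 0 rfl hm, zero_smul]
      have hs : split p L [] = 0 := by simp [split, rotSum]
      rw [bvStep, hb, hs, cyc_nil]
      ext i j
      fin_cases i <;> fin_cases j <;> simp)

theorem bvHom_cyc (hL : IsEvenGram p L) (κ : k) (w : List (Fin d)) :
    bvHom hL κ (cyc k p w) =
      !![ksgn k (cycPar p w) • LinearMap.mulLeft k (cyc k p w), bvStep hL κ w;
        0, LinearMap.mulLeft k (cyc k p w)] :=
  lift_cyc _ _ _ _ w

theorem bvHom_apply_one_one (hL : IsEvenGram p L) (κ : k) (f : CyclicAlg k p) :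
    bvHom hL κ f 1 0 = 0 ∧ bvHom hL κ f 1 1 = LinearMap.mulLeft k f := by
  obtain ⟨f, rfl⟩ := mk_surjective f
  induction f using FreeAlgebra.induction with
  | grade0 r =>
    simp only [AlgHom.commutes, Matrix.algebraMap_matrix_apply]
    refine ⟨by simp, ?_⟩
    ext z; simp [Algebra.smul_def]
  | grade1 w =>
    have h := bvHom_cyc hL κ w
    unfold cyc at h
    rw [h]
    exact ⟨rfl, rfl⟩
  | mul a b ha hb =>
    rw [map_mul (mk k p), map_mul (bvHom hL κ)]
    rw [Matrix.mul_apply, Matrix.mul_apply, Fin.sum_univ_two, Fin.sum_univ_two,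
      ha.1, ha.2, hb.1, hb.2, mulLeft_mul']
    simp
  | add a b ha hb =>
    rw [map_add (mk k p), map_add (bvHom hL κ)]
    rw [Matrix.add_apply, Matrix.add_apply, ha.1, ha.2, hb.1, hb.2]
    refine ⟨by simp, ?_⟩
    ext z; simp [add_mul]

/-- The noncommutative Batalin-Vilkovisky differential `Δ` on `F`: the second order operator that
sends a product of cyclic words to the sum, with Koszul signs, of the contractions of all pairs of
letters by the scalar product. Contracting letters of two different words glues these words into
one, contracting two letters of a word cuts it into two. The terms of the second kind carry the
weight `κ`; see `CyclicAlg.ncBV_one` and `CyclicAlg.ncBV_cyc_mul`. -/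
noncomputable def ncBV (hL : IsEvenGram p L) (κ : k) : CyclicAlg k p →ₗ[k] CyclicAlg k p where
  toFun f := bvHom hL κ f 0 1 1
  map_add' := by simp
  map_smul' := by simp

theorem ncBV_one (hL : IsEvenGram p L) (κ : k) : ncBV hL κ 1 = 0 := by
  simp [ncBV]

theorem ncBV_cyc_mul (hL : IsEvenGram p L) (κ : k) (w : List (Fin d)) (f : CyclicAlg k p) :
    ncBV hL κ (cyc k p w * f) = (κ • split p L w) * f + bracket hL w f +
      ksgn k (cycPar p w) • (cyc k p w * ncBV hL κ f) := by
  simp only [ncBV, LinearMap.coe_mk, AddHom.coe_mk]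
  rw [map_mul, bvHom_cyc, Matrix.mul_apply, Fin.sum_univ_two, (bvHom_apply_one_one hL κ f).2]
  simp [bvStep, add_comm]

end CyclicAlg

end Cyclic

section Comparison

variable {k : Type u} [Field k] {d : ℕ}

theorem genericMatrix_isQ (p : Fin d → ZMod 2) (N : ℕ) (i : Fin d) :
    IsQ (parityPart k (SuperPoly.gen k (qVarPar p N)) (qVarPar p N)) (p i)
      (genericMatrix k p N i) := by
  have h0 := fun a b => gen_mem_parityPart (k := k) (g := SuperPoly.gen k (qVarPar p N))
    (par := qVarPar p N) (0, i, a, b)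
  have h1 := fun a b => gen_mem_parityPart (k := k) (g := SuperPoly.gen k (qVarPar p N))
    (par := qVarPar p N) (1, i, a, b)
  refine ⟨?_, ?_⟩
  · have e : p i + 1 + 1 = p i + 0 := by generalize p i = x; revert x; decide
    rintro (a | a) (b | b)
    · simpa [genericMatrix, qIdxPar, qVarPar] using h0 a b
    · simpa [genericMatrix, qIdxPar, qVarPar] using h1 a b
    · simpa [genericMatrix, qIdxPar, qVarPar] using Submodule.smul_mem _ (ksgn k (p i)) (h1 a b)
    · simp only [qIdxPar, Sum.elim_inr, e]
      exact Submodule.smul_mem _ (ksgn k (p i)) (h0 a b)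
  · ext (a | a) (b | b) <;>
      simp [mul_oddInv_apply, oddInv_mul_apply, genericMatrix, smul_smul, ksgn_mul_self]

theorem parity_mul (p : Fin d → ZMod 2) (N : ℕ) (i j : ZMod 2) (x y : MatrixAlg k p N)
    (hx : x ∈ parityPart k (SuperPoly.gen k (qVarPar p N)) (qVarPar p N) i)
    (hy : y ∈ parityPart k (SuperPoly.gen k (qVarPar p N)) (qVarPar p N) j) :
    x * y ∈ parityPart k (SuperPoly.gen k (qVarPar p N)) (qVarPar p N) (i + j) :=
  mul_mem_parityPart hx hy

theorem parity_comm (p : Fin d → ZMod 2) (N : ℕ) (i j : ZMod 2) (x y : MatrixAlg k p N)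
    (hx : x ∈ parityPart k (SuperPoly.gen k (qVarPar p N)) (qVarPar p N) i)
    (hy : y ∈ parityPart k (SuperPoly.gen k (qVarPar p N)) (qVarPar p N) j) :
    x * y = ksgn k (i * j) • (y * x) :=
  parityPart_comm SuperPoly.gen_swap hx hy

theorem wordMatrix_isQ (p : Fin d → ZMod 2) (N : ℕ) (w : List (Fin d)) :
    IsQ (parityPart k (SuperPoly.gen k (qVarPar p N)) (qVarPar p N)) (wordPar p w)
      (w.map (genericMatrix k p N)).prod := by
  induction w with
  | nil =>
    refine ⟨fun a b => ?_, by simp [wordPar, ksgn_zero]⟩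
    by_cases hab : a = b
    · subst hab
      have e : ∀ x : ZMod 2, 0 + x + x = 0 := by decide
      have h : wordPar p [] + qIdxPar a + qIdxPar a = 0 := e _
      rw [h, List.map_nil, List.prod_nil, Matrix.one_apply_eq]
      exact one_mem_parityPart
    · rw [List.map_nil, List.prod_nil, Matrix.one_apply_ne hab]
      exact Submodule.zero_mem _
  | cons i w ih =>
    have h := IsQ.mul (parity_mul p N) (genericMatrix_isQ (k := k) p N i) ih
    rw [List.map_cons, List.prod_cons]
    exact h

theorem oddTraceWord_mem [CharZero k] (p : Fin d → ZMod 2) (N : ℕ) (w : List (Fin d)) :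
    oddTraceWord k p N w ∈
      parityPart k (SuperPoly.gen k (qVarPar p N)) (qVarPar p N) (wordPar p w + 1) := by
  rw [oddTraceWord, (wordMatrix_isQ p N w).oddTrace_eq]
  refine Submodule.sum_mem _ fun a _ => ?_
  simpa [qIdxPar] using (wordMatrix_isQ (k := k) p N w).1 (Sum.inl a) (Sum.inr a)

theorem oddTraceWord_rot [CharZero k] (p : Fin d → ZMod 2) (N : ℕ) (a : Fin d)
    (w : List (Fin d)) : oddTraceWord k p N (a :: w) =
      ksgn k (p a * wordPar p w) • oddTraceWord k p N (w ++ [a]) := by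
  have h := IsQ.oddTrace_mul_comm (k := k) (parity_mul p N) (parity_comm p N)
    (genericMatrix_isQ (k := k) p N a) (wordMatrix_isQ p N w)
  have e1 : wordPar p (a :: w) = p a + wordPar p w := by simp [wordPar]
  have e2 : wordPar p (w ++ [a]) = wordPar p w + p a := by simp [wordPar]
  rw [oddTraceWord, oddTraceWord, e1, e2, List.map_cons, List.prod_cons, List.map_append,
    List.prod_append, List.map_singleton, List.prod_singleton]
  exact h

theorem oddTraceWord_nil [CharZero k] (p : Fin d → ZMod 2) (N : ℕ) :
    oddTraceWord k p N [] = 0 := by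
  rw [oddTraceWord, (wordMatrix_isQ (k := k) p N []).oddTrace_eq, List.map_nil, List.prod_nil]
  exact Finset.sum_eq_zero fun a _ => Matrix.one_apply_ne (by simp)

/-- The algebra map from `F` to functions on `Hom(ΠV, q(U))`, sending a product of cyclic words
to the product of the odd traces, each multiplied by the normalization constant `c`. -/
noncomputable def traceMap [CharZero k] (p : Fin d → ZMod 2) (N : ℕ) (c : k) :
    CyclicAlg k p →ₐ[k] MatrixAlg k p N :=
  CyclicAlg.lift (fun w => c • oddTraceWord k p N w)
    (by
      intro v w
      rw [smul_mul_smul_comm, smul_mul_smul_comm,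
        parity_comm p N _ _ _ _ (oddTraceWord_mem p N v) (oddTraceWord_mem p N w),
        smul_comm])
    (by
      intro a w
      rw [oddTraceWord_rot, smul_comm])
    (by
      rw [oddTraceWord_nil, smul_zero])

theorem traceMap_cyc [CharZero k] (p : Fin d → ZMod 2) (N : ℕ) (c : k) (w : List (Fin d)) :
    traceMap p N c (CyclicAlg.cyc k p w) = c • oddTraceWord k p N w :=
  CyclicAlg.lift_cyc _ _ _ _ w

end Comparison

section GradedSpaces

variable {k : Type u} [Field k] {V : Type v} [AddCommGroup V] [Module k V]

/-- An even supersymmetric bilinear form on the super vector space `V = V₀ ⊕ V₁`. -/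
structure EvenForm (𝒱 : ZMod 2 → Submodule k V) where
  form : V →ₗ[k] V →ₗ[k] k
  even : ∀ i j, ∀ x ∈ 𝒱 i, ∀ y ∈ 𝒱 j, i ≠ j → form x y = 0
  symm : ∀ i j, ∀ x ∈ 𝒱 i, ∀ y ∈ 𝒱 j, form x y = ksgn k (i * j) * form y x

/-- A basis of `V` that consists of homogeneous vectors. -/
structure HomogeneousBasis (𝒱 : ZMod 2 → Submodule k V) (d : ℕ) where
  basis : Module.Basis (Fin d) k V
  par : Fin d → ZMod 2
  mem : ∀ i, basis i ∈ 𝒱 (par i)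

variable {𝒱 : ZMod 2 → Submodule k V} {d : ℕ}

/-- The parities of the basis vectors in the space `ΠV`. -/
def HomogeneousBasis.shiftedPar (b : HomogeneousBasis 𝒱 d) (i : Fin d) : ZMod 2 := b.par i + 1

/-- The Gram matrix of a form. -/
noncomputable def EvenForm.gram (l : EvenForm 𝒱) (b : HomogeneousBasis 𝒱 d) (i j : Fin d) : k :=
  l.form (b.basis i) (b.basis j)

theorem EvenForm.gram_isEvenGram (l : EvenForm 𝒱) (b : HomogeneousBasis 𝒱 d) :
    CyclicAlg.IsEvenGram b.shiftedPar (l.gram b) where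
  even i j h := l.even _ _ _ (b.mem i) _ (b.mem j) fun e => h (by
    simp [HomogeneousBasis.shiftedPar, e])
  symm i j := by
    have e : ∀ x : ZMod 2, x + 1 + 1 = x := by decide
    simpa [HomogeneousBasis.shiftedPar, e, EvenForm.gram] using l.symm _ _ _ (b.mem i) _ (b.mem j)

end GradedSpaces

/-!
The theorem is the first and second fundamental theorem of invariant theory for the queer group
`GQ(U)`, in the range of degrees where the traces have no relations, together with a computation
of second order operators.

**Invariants are functions of points.** Invariance under the supergroup is tested on points over
all superalgebras `R`. A family of elements `M_i` of `q(U) ⊗ R` of the right parities is an algebra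
map `matrixPoint` from the polynomial functions to `R`, and an invariant takes the same value at
`g M_i` and at `M_i g` (`IsGQInvariant.matrixPoint_mul`). In particular odd traces of words are
invariant.

**Comparison of the operators.** Both operators are of second order, so that it is enough to
compare them on one odd trace and on the bracket of two. By cyclicity the letter that is derived
can be moved to the front of the trace. Summing over dual pairs of coordinates, two words are
glued (`oddBracket_oddTraceWord`), and one word is cut into two pieces, with an additional factor
`2` (`matrixBV_oddTraceWord`): the products of the traces of the blocks `X` of the two pieces
cancel, and those of the traces of the blocks `Y` double. The weights `c` of the traces turn this
factor into `2 / c ^ 2` (`matrixBV_traceMap`).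

**Reduction to multilinear functions.** In characteristic zero polarization and restitution embed
both spaces of degree `n` into direct sums of multilinear parts of the analogous spaces for `n`
new letters, in a way compatible with traces and invariance (`bijOn_traceMap_of_multilinear`). The polarization is
written as an alternating sum of substitutions, so that its compatibilities are formal.

**Multilinear invariants.** Evaluate a multilinear function at elementary matrices with independent
parameters `t_s`, of types `ε s` (block `X` or `Y`) and positions `(α s, β s)`: this extracts one
coefficient `F (ε, α, β)`. As `n ≤ N`, distinct indices `ι s` are available.
Even group elements, and by density all even matrices, reduce the coefficients to those with
`α = ι` (`eq_zero_of_standard_rows`), and the torus leaves only `β = ι ∘ σ` for permutations `σ`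
(`exists_perm_of_ne_zero`). The odd unipotent elements `1 + η D p`, `D` diagonal, give linear
relations between the types (`exists_sum_coeff_eq`): entries in the block `Y` move along the cycles
of `σ` and cancel in pairs, and a cycle without such an entry forces the coefficient to vanish
(`eq_zero_of_repIndicator`). Hence an invariant is determined by one coefficient for each `σ`
(`eq_zero_of_coeff_repIndicator`). On the other side, products of cyclic words in which each of the
`n` letters occurs once correspond, up to sign, to permutations (`multilinearCyclic_eq_span`), and
the trace functions of distinct permutations are separated by exactly these coefficients
(`exists_elementaryPoint_cycleProduct`). Bijectivity follows.
-/

/-! ### Free supercommutative algebras -/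

theorem ksgn_ne_zero (k : Type u) [Field k] (z : ZMod 2) : ksgn k z ≠ 0 := by
  unfold ksgn; split_ifs <;> simp

namespace SuperPoly

variable {k : Type u} [Field k] {G : Type} {par : G → ZMod 2}

theorem mk_surjective : Function.Surjective (mk k par) :=
  RingQuot.mkAlgHom_surjective k (SuperPoly.Rel k par)

theorem lift_gen {A : Type v} [Ring A] [Algebra k A] (f : G → A)
    (hf : ∀ x y, f x * f y = ksgn k (par x * par y) • (f y * f x)) (x : G) :
    lift f hf (gen k par x) = f x := by
  have h : lift f hf (gen k par x) = FreeAlgebra.lift k f (FreeAlgebra.ι k x) :=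
    RingQuot.liftAlgHom_mkAlgHom_apply _ _ _ _
  rw [h, FreeAlgebra.lift_ι_apply]

theorem algHom_ext {A : Type v} [Ring A] [Algebra k A] {f g : SuperPoly k par →ₐ[k] A}
    (h : ∀ x, f (gen k par x) = g (gen k par x)) : f = g := by
  have : f.comp (mk k par) = g.comp (mk k par) := FreeAlgebra.hom_ext (funext h)
  ext x
  obtain ⟨x, rfl⟩ := mk_surjective x
  exact DFunLike.congr_fun this x

/-- Induction on the number of left factors that are generators. -/
theorem induction_gen_mul {P : SuperPoly k par → Prop} (one : P 1)
    (add : ∀ f g, P f → P g → P (f + g)) (smul : ∀ (c : k) f, P f → P (c • f))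
    (gen_mul : ∀ x f, P f → P (gen k par x * f)) (f : SuperPoly k par) : P f := by
  have key : ∀ (a : FreeAlgebra k G) (f : SuperPoly k par), P f → P (mk k par a * f) := by
    intro a
    induction a using FreeAlgebra.induction with
    | grade0 r =>
      intro f hf
      rw [AlgHom.commutes, ← Algebra.smul_def]
      exact smul _ _ hf
    | grade1 x => exact fun f hf => gen_mul x f hf
    | mul a b ha hb =>
      intro f hf
      rw [map_mul, mul_assoc]
      exact ha _ (hb _ hf)
    | add a b ha hb =>
      intro f hf
      rw [map_add, add_mul]
      exact add _ _ (ha _ hf) (hb _ hf)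
  obtain ⟨a, rfl⟩ := mk_surjective f
  simpa using key a 1 one

theorem power_mul {m n : ℕ} {f g : SuperPoly k par} (hf : f ∈ power k par m)
    (hg : g ∈ power k par n) : f * g ∈ power k par (m + n) := by
  have h := Submodule.mul_mem_mul hf hg
  unfold power at h
  rw [Submodule.span_mul_span] at h
  refine Submodule.span_mono ?_ h
  rintro _ ⟨_, ⟨w, hw, rfl⟩, _, ⟨w', hw', rfl⟩, rfl⟩
  exact ⟨w ++ w', by simp [hw, hw'], by simp⟩

theorem one_mem_power : (1 : SuperPoly k par) ∈ power k par 0 :=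
  Submodule.subset_span ⟨[], rfl, by simp⟩

theorem gen_mem_power (x : G) : gen k par x ∈ power k par 1 :=
  Submodule.subset_span ⟨[x], rfl, by simp⟩

/-- Reordering a product of generators changes it by a sign. -/
theorem exists_ksgn_of_perm {l l' : List G} (h : l.Perm l') :
    ∃ z, (l.map (gen k par)).prod = ksgn k z • (l'.map (gen k par)).prod := by
  induction h with
  | nil => exact ⟨0, by simp [ksgn_zero]⟩
  | cons x _ ih =>
    obtain ⟨z, hz⟩ := ih
    exact ⟨z, by simp [hz]⟩
  | swap x y l =>
    refine ⟨par y * par x, ?_⟩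
    simp only [List.map_cons, List.prod_cons]
    rw [← mul_assoc, gen_swap, smul_mul_assoc, mul_assoc]
  | trans _ _ ih ih' =>
    obtain ⟨z, hz⟩ := ih
    obtain ⟨z', hz'⟩ := ih'
    exact ⟨z + z', by rw [hz, hz', smul_smul, ksgn_add]⟩

section Grading

instance : SetLike.GradedMonoid (parityPart k (gen k par) par) where
  one_mem := one_mem_parityPart
  mul_mem _ _ _ _ := mul_mem_parityPart

open DirectSum in
/-- The decomposition of a polynomial into its even and its odd part. -/
noncomputable def decomposeHom :
    SuperPoly k par →ₐ[k] ⨁ i, parityPart k (gen k par) par i :=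
  lift (fun x => DirectSum.of (fun i => parityPart k (gen k par) par i) (par x)
      ⟨gen k par x, gen_mem_parityPart x⟩) <| by
    intro x y
    rw [DirectSum.of_mul_of, DirectSum.of_mul_of, ← DirectSum.lof_eq_of k, ← DirectSum.lof_eq_of k,
      ← map_smul]
    rw [DirectSum.lof_eq_of k, DirectSum.lof_eq_of k]
    apply DirectSum.of_eq_of_gradedMonoid_eq
    refine Sigma.subtype_ext (add_comm _ _) ?_
    exact gen_swap x y

noncomputable instance : GradedAlgebra (parityPart k (gen k par) par) :=
  GradedAlgebra.ofAlgHom _ decomposeHom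
    (by
      refine algHom_ext fun x => ?_
      simp [decomposeHom, lift_gen])
    (by
      intro i x
      obtain ⟨x, hx⟩ := x
      have key : ∀ w : List G, decomposeHom (w.map (gen k par)).prod =
          DirectSum.of (fun i => parityPart k (gen k par) par i) (w.map par).sum
            ⟨(w.map (gen k par)).prod, Submodule.subset_span ⟨w, rfl, rfl⟩⟩ := by
        intro w
        induction w with
        | nil => simp only [List.map_nil, List.prod_nil, map_one]; rfl
        | cons a w ih =>
          simp only [List.map_cons, List.prod_cons, map_mul, ih]
          rw [decomposeHom, lift_gen, DirectSum.of_mul_of]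
          rfl
      induction hx using Submodule.span_induction with
      | mem x hx =>
        obtain ⟨w, rfl, rfl⟩ := hx
        exact key w
      | zero =>
        rw [map_zero]
        exact (map_zero (DirectSum.of (fun i => parityPart k (gen k par) par i) i)).symm
      | add x y hx hy ihx ihy =>
        rw [map_add, ihx, ihy, ← map_add]; rfl
      | smul c x hx ihx =>
        rw [map_smul, ihx, ← DirectSum.lof_eq_of k, ← DirectSum.lof_eq_of k, ← map_smul]; rfl)

theorem graded_comm (i j : ZMod 2) (x : SuperPoly k par)
    (hx : x ∈ parityPart k (gen k par) par i) (y : SuperPoly k par)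
    (hy : y ∈ parityPart k (gen k par) par j) : x * y = ksgn k (i * j) • (y * x) :=
  parityPart_comm gen_swap hx hy

end Grading

section Derivative

variable [DecidableEq G]

theorem derivHom_gen (x y : G) : derivHom k par x (gen k par y) =
    !![ksgn k (par x * par y) • gen k par y, if y = x then 1 else 0; 0, gen k par y] :=
  lift_gen _ _ _

theorem derivHom_one_zero (x : G) (f : SuperPoly k par) :
    derivHom k par x f 1 0 = 0 ∧ derivHom k par x f 1 1 = f := by
  induction f using induction_gen_mul with
  | one => simp
  | add f g hf hg => simp [hf.1, hf.2, hg.1, hg.2]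
  | smul c f hf => simp [hf.1, hf.2]
  | gen_mul y f hf =>
    simp only [map_mul, Matrix.mul_apply, Fin.sum_univ_two, hf.1, hf.2, derivHom_gen]
    simp

theorem derivHom_zero_zero (x : G) {e : ZMod 2} {f : SuperPoly k par}
    (hf : f ∈ parityPart k (gen k par) par e) :
    derivHom k par x f 0 0 = ksgn k (par x * e) • f := by
  induction hf using Submodule.span_induction with
  | mem f hf =>
    obtain ⟨w, rfl, rfl⟩ := hf
    induction w with
    | nil => simp [ksgn_zero]
    | cons y w ih =>
      simp only [List.map_cons, List.prod_cons, List.sum_cons, map_mul, Matrix.mul_apply,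
        Fin.sum_univ_two, ih, (derivHom_one_zero x _).1, derivHom_gen]
      simp [smul_smul, mul_add, ksgn_add, mul_comm]
  | zero => simp
  | add f g _ _ hf hg => simp [hf, hg]
  | smul c f _ hf => simp [hf, smul_comm c]

theorem pderiv_mul (x : G) {e : ZMod 2} {f : SuperPoly k par}
    (hf : f ∈ parityPart k (gen k par) par e) (g : SuperPoly k par) :
    pderiv k par x (f * g) =
      pderiv k par x f * g + ksgn k (par x * e) • (f * pderiv k par x g) := by
  simp only [pderiv, LinearMap.coe_mk, AddHom.coe_mk, map_mul, Matrix.mul_apply,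
    Fin.sum_univ_two, derivHom_zero_zero x hf, (derivHom_one_zero x g).2, smul_mul_assoc]
  rw [add_comm]

theorem pderiv_one (x : G) : pderiv k par x 1 = 0 := by simp [pderiv]

theorem pderiv_gen (x y : G) : pderiv k par x (gen k par y) = if y = x then 1 else 0 := by
  simp [pderiv, derivHom_gen]

theorem pderiv_mem (x : G) {e : ZMod 2} {f : SuperPoly k par}
    (hf : f ∈ parityPart k (gen k par) par e) :
    pderiv k par x f ∈ parityPart k (gen k par) par (par x + e) := by
  induction hf using Submodule.span_induction with
  | mem f hf =>
    obtain ⟨w, rfl, rfl⟩ := hf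
    induction w with
    | nil => simp [pderiv_one]
    | cons y w ih =>
      simp only [List.map_cons, List.prod_cons, List.sum_cons]
      rw [pderiv_mul x (gen_mem_parityPart y), pderiv_gen]
      refine Submodule.add_mem _ ?_ (Submodule.smul_mem _ _ ?_)
      · split_ifs with h
        · subst h
          have e : par y + (par y + (w.map par).sum) = (w.map par).sum := by
            rw [← add_assoc, CharTwo.add_self_eq_zero, zero_add]
          rw [e, one_mul]
          exact Submodule.subset_span ⟨w, rfl, rfl⟩
        · simp
      · have h := mul_mem_parityPart
          (gen_mem_parityPart (k := k) (g := gen k par) (par := par) y) ih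
        rwa [add_left_comm] at h
  | zero => simp
  | add f g _ _ hf hg => rw [map_add]; exact Submodule.add_mem _ hf hg
  | smul c f _ hf => rw [map_smul]; exact Submodule.smul_mem _ _ hf

theorem pderiv_prod_of_notMem (x : G) (l : List G) (h : x ∉ l) :
    pderiv k par x (l.map (gen k par)).prod = 0 := by
  induction l with
  | nil => simp [pderiv_one]
  | cons y l ih =>
    rw [List.mem_cons, not_or] at h
    rw [List.map_cons, List.prod_cons, pderiv_mul x (gen_mem_parityPart y), pderiv_gen, ih h.2,
      if_neg (Ne.symm h.1)]
    simp

/-- A product of distinct generators does not vanish: deriving it successively along its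
factors leads to `1`. -/
theorem prod_ne_zero (l : List G) (h : l.Nodup) : (l.map (gen k par)).prod ≠ 0 := by
  induction l with
  | nil =>
    have h1 : lift (k := k) (par := par) (fun _ => (0 : k)) (fun _ _ => by simp) 1 ≠ 0 := by
      rw [map_one]; exact one_ne_zero
    intro h2
    rw [List.map_nil, List.prod_nil] at h2
    rw [h2, map_zero] at h1
    exact h1 rfl
  | cons y l ih =>
    rw [List.nodup_cons] at h
    intro h2
    apply ih h.2
    have h3 := congrArg (pderiv k par y) h2
    rw [List.map_cons, List.prod_cons, pderiv_mul y (gen_mem_parityPart y), pderiv_gen,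
      pderiv_prod_of_notMem y l h.1, if_pos rfl, map_zero] at h3
    simpa using h3

end Derivative

end SuperPoly

/-! ### Points of `Hom(ΠV, q(U))` and invariance of odd traces -/

section Points

variable {k : Type u} [Field k] {R : Type u} [Ring R] [Algebra k R] {d N : ℕ}
  {p : Fin d → ZMod 2} {𝓡 : ZMod 2 → Submodule k R}

theorem IsQ.apply_inr_inr {e : ZMod 2} {M : Matrix (QIdx N) (QIdx N) R} (h : IsQ 𝓡 e M)
    (a b : Fin N) : M (Sum.inr a) (Sum.inr b) = ksgn k e • M (Sum.inl a) (Sum.inl b) :=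
  h.swap_apply (Sum.inr a) (Sum.inl b)

theorem IsQ.apply_inr_inl {e : ZMod 2} {M : Matrix (QIdx N) (QIdx N) R} (h : IsQ 𝓡 e M)
    (a b : Fin N) : M (Sum.inr a) (Sum.inl b) = ksgn k e • M (Sum.inl a) (Sum.inr b) :=
  h.swap_apply (Sum.inr a) (Sum.inr b)

/-- The entry of an element of `q(U)` that is named by a coordinate: in the block `X` for
`e = 0` and in the block `Y` for `e = 1`. -/
def qEntry (M : Matrix (QIdx N) (QIdx N) R) (e : ZMod 2) (a b : Fin N) : R :=
  if e = 0 then M (Sum.inl a) (Sum.inl b) else M (Sum.inl a) (Sum.inr b)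

theorem IsQ.qEntry_mem {e : ZMod 2} {M : Matrix (QIdx N) (QIdx N) R} (h : IsQ 𝓡 e M)
    (z : ZMod 2) (a b : Fin N) : qEntry M z a b ∈ 𝓡 (e + z) := by
  have h2 : ∀ z : ZMod 2, z = 0 ∨ z = 1 := by decide
  rcases h2 z with rfl | rfl
  · simpa [qIdxPar, qEntry] using h.1 (Sum.inl a) (Sum.inl b)
  · simpa [qIdxPar, qEntry] using h.1 (Sum.inl a) (Sum.inr b)

/-- The `R`-point of `Hom(ΠV, q(U))` that maps the basis vectors of `ΠV` to given elements of
`q(U) ⊗ R`. -/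
def matrixPoint (hcomm : ∀ i j, ∀ a ∈ 𝓡 i, ∀ b ∈ 𝓡 j, a * b = ksgn k (i * j) • (b * a))
    (M : Fin d → Matrix (QIdx N) (QIdx N) R) (hM : ∀ i, IsQ 𝓡 (p i) (M i)) :
    MatrixAlg k p N →ₐ[k] R :=
  SuperPoly.lift (fun x => qEntry (M x.2.1) x.1 x.2.2.1 x.2.2.2)
    fun x y => hcomm _ _ _ ((hM x.2.1).qEntry_mem _ _ _) _ ((hM y.2.1).qEntry_mem _ _ _)

section

variable (hcomm : ∀ i j, ∀ a ∈ 𝓡 i, ∀ b ∈ 𝓡 j, a * b = ksgn k (i * j) • (b * a))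
  (M : Fin d → Matrix (QIdx N) (QIdx N) R) (hM : ∀ i, IsQ 𝓡 (p i) (M i))

theorem matrixPoint_gen (x : QVar d N) : matrixPoint hcomm M hM (SuperPoly.gen k _ x) =
    qEntry (M x.2.1) x.1 x.2.2.1 x.2.2.2 :=
  SuperPoly.lift_gen _ _ _

theorem matrixPoint_gen_mem (x : QVar d N) :
    matrixPoint hcomm M hM (SuperPoly.gen k _ x) ∈ 𝓡 (qVarPar p N x) := by
  rw [matrixPoint_gen]
  exact (hM x.2.1).qEntry_mem _ _ _

theorem genericMatrix_map_matrixPoint (i : Fin d) :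
    (genericMatrix k p N i).map (matrixPoint hcomm M hM) = M i := by
  ext (a | a) (b | b)
  · simp [genericMatrix, matrixPoint_gen, qEntry]
  · simp [genericMatrix, matrixPoint_gen, qEntry]
  · simp [genericMatrix, matrixPoint_gen, qEntry, (hM i).apply_inr_inl]
  · simp [genericMatrix, matrixPoint_gen, qEntry, (hM i).apply_inr_inr]

end

/-- An invariant function takes the same values at `g M` and `M g`. -/
theorem IsGQInvariant.matrixPoint_mul [GradedAlgebra 𝓡] {f : MatrixAlg k p N}
    (hf : IsGQInvariant f)
    (hcomm : ∀ i j, ∀ a ∈ 𝓡 i, ∀ b ∈ 𝓡 j, a * b = ksgn k (i * j) • (b * a))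
    {M : Fin d → Matrix (QIdx N) (QIdx N) R}
    {g g' : Matrix (QIdx N) (QIdx N) R} (hg : IsQ 𝓡 0 g) (h : g * g' = 1) (h' : g' * g = 1)
    (h1 : ∀ i, IsQ 𝓡 (p i) (g * M i)) (h2 : ∀ i, IsQ 𝓡 (p i) (M i * g)) :
    matrixPoint hcomm (fun i => g * M i) h1 f = matrixPoint hcomm (fun i => M i * g) h2 f := by
  refine hf R 𝓡 hcomm _ _ (matrixPoint_gen_mem _ _ _) (matrixPoint_gen_mem _ _ _) g g' hg h h' ?_
  intro i
  rw [genericMatrix_map_matrixPoint, genericMatrix_map_matrixPoint, Matrix.mul_assoc,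
    Matrix.mul_assoc, h, Matrix.mul_one]

/-- The inverse of an even element of `q(U) ⊗ R` is again one. -/
theorem IsQ.inverse [GradedAlgebra 𝓡] {g g' : Matrix (QIdx N) (QIdx N) R} (hg : IsQ 𝓡 0 g)
    (h : g * g' = 1) (h' : g' * g = 1) : IsQ 𝓡 0 g' := by
  -- the entrywise projection of `g'` to the expected parities is a right inverse of `g` as well
  let g'' : Matrix (QIdx N) (QIdx N) R := Matrix.of fun a b =>
    (DirectSum.decompose 𝓡 (g' a b) (0 + qIdxPar a + qIdxPar b) : R)
  have h1 : g * g'' = 1 := by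
    ext a b
    have e : (g * g'') a b =
        (DirectSum.decompose 𝓡 ((g * g') a b) (0 + qIdxPar a + qIdxPar b) : R) := by
      rw [Matrix.mul_apply, Matrix.mul_apply, DirectSum.decompose_sum, DFinsupp.finsetSum_apply,
        AddSubmonoidClass.coe_finsetSum]
      refine Finset.sum_congr rfl fun c _ => ?_
      have e2 : ∀ a b c : ZMod 2, 0 + a + b = (0 + a + c) + (0 + c + b) := by decide
      rw [e2 _ _ (qIdxPar c), DirectSum.coe_decompose_mul_add_of_left_mem 𝓡 (hg.1 a c)]
      rfl
    rw [e, h]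
    by_cases hab : a = b
    · subst hab
      have e2 : ∀ a : ZMod 2, 0 + a + a = 0 := by decide
      rw [e2, Matrix.one_apply_eq, DirectSum.decompose_of_mem_same 𝓡 SetLike.GradedOne.one_mem]
    · rw [Matrix.one_apply_ne hab, DirectSum.decompose_zero]; simp
  have h2 : g' = g'' := by
    calc g' = g' * (g * g'') := by rw [h1, Matrix.mul_one]
      _ = g'' := by rw [← Matrix.mul_assoc, h', Matrix.one_mul]
  refine ⟨fun a b => ?_, ?_⟩
  · rw [h2]; exact SetLike.coe_mem _
  · have e : g' * (g * oddInv R N) * g' = g' * (oddInv R N * g) * g' := by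
      rw [hg.2, ksgn_zero, one_smul]
    rw [← Matrix.mul_assoc, h', Matrix.one_mul, Matrix.mul_assoc, Matrix.mul_assoc, h,
      Matrix.mul_one] at e
    rw [ksgn_zero, one_smul, e]

theorem genericMatrix_map_isQ {φ : MatrixAlg k p N →ₐ[k] R}
    (hφ : ∀ x, φ (SuperPoly.gen k _ x) ∈ 𝓡 (qVarPar p N x)) (i : Fin d) :
    IsQ 𝓡 (p i) ((genericMatrix k p N i).map φ) := by
  refine ⟨?_, ?_⟩
  · have e : p i + 1 + 1 = p i := by rw [add_assoc, CharTwo.add_self_eq_zero, add_zero]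
    rintro (a | a) (b | b)
    · simpa [genericMatrix, qIdxPar, qVarPar] using hφ (0, i, a, b)
    · simpa [genericMatrix, qIdxPar, qVarPar] using hφ (1, i, a, b)
    · simpa [genericMatrix, qIdxPar, qVarPar] using
        Submodule.smul_mem _ (ksgn k (p i)) (hφ (1, i, a, b))
    · simpa [genericMatrix, qIdxPar, qVarPar, e] using
        Submodule.smul_mem _ (ksgn k (p i)) (hφ (0, i, a, b))
  · ext (a | a) (b | b) <;>
      simp [mul_oddInv_apply, oddInv_mul_apply, genericMatrix, smul_smul, ksgn_mul_self]

theorem isQ_one [GradedAlgebra 𝓡] : IsQ 𝓡 0 (1 : Matrix (QIdx N) (QIdx N) R) := by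
  refine ⟨fun a b => ?_, by simp [ksgn_zero]⟩
  by_cases hab : a = b
  · subst hab
    have e : ∀ x : ZMod 2, 0 + x + x = 0 := by decide
    rw [e, Matrix.one_apply_eq]
    exact SetLike.GradedOne.one_mem
  · rw [Matrix.one_apply_ne hab]
    exact Submodule.zero_mem _

theorem isQ_list_prod [GradedAlgebra 𝓡] {M : Fin d → Matrix (QIdx N) (QIdx N) R}
    (hM : ∀ i, IsQ 𝓡 (p i) (M i)) (w : List (Fin d)) :
    IsQ 𝓡 (wordPar p w) (w.map M).prod := by
  induction w with
  | nil => simpa [wordPar] using isQ_one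
  | cons i w ih =>
    rw [List.map_cons, List.prod_cons]
    exact IsQ.mul (fun i j x y hx hy => SetLike.GradedMul.mul_mem hx hy) (hM i) ih

theorem map_oddTrace {S : Type u} [Ring S] [Algebra k S] (φ : R →ₐ[k] S) (e : ZMod 2)
    (M : Matrix (QIdx N) (QIdx N) R) : φ (oddTrace k e M) = oddTrace k e (M.map φ) := by
  simp [oddTrace, superTrace, mul_oddInv_apply]

theorem map_oddTraceWord (φ : MatrixAlg k p N →ₐ[k] R) (w : List (Fin d)) :
    φ (oddTraceWord k p N w) =
      oddTrace k (wordPar p w) (w.map fun i => (genericMatrix k p N i).map φ).prod := by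
  rw [oddTraceWord, map_oddTrace]
  congr 1
  have := map_list_prod φ.mapMatrix (w.map (genericMatrix k p N))
  rw [List.map_map] at this
  exact this

/-- Odd traces are conjugation invariant. -/
theorem oddTraceWord_isGQInvariant [CharZero k] (w : List (Fin d)) :
    IsGQInvariant (oddTraceWord k p N w) := by
  intro R _ _ 𝓡 _ hcomm φ ψ hφ hψ g g' hg h h' hgen
  have hg' := hg.inverse h h'
  rw [map_oddTraceWord, map_oddTraceWord]
  have e1 : (w.map fun i => (genericMatrix k p N i).map ψ).prod =
      g * (w.map fun i => (genericMatrix k p N i).map φ).prod * g' := by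
    induction w with
    | nil => simp [h]
    | cons i w ih =>
      rw [List.map_cons, List.map_cons, List.prod_cons, List.prod_cons, ih, hgen]
      simp only [Matrix.mul_assoc]
      rw [← Matrix.mul_assoc g' g, h', Matrix.one_mul]
  have hmul : ∀ i j x y, x ∈ 𝓡 i → y ∈ 𝓡 j → x * y ∈ 𝓡 (i + j) :=
    fun i j x y hx hy => SetLike.GradedMul.mul_mem hx hy
  have hB := isQ_list_prod (genericMatrix_map_isQ hφ) w
  have e2 := IsQ.oddTrace_mul_comm hmul (fun i j x y hx hy => hcomm i j x hx y hy) hg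
    (hB.mul hmul hg')
  simp only [zero_mul, ksgn_zero, one_smul, add_zero, zero_add] at e2
  rw [e1, Matrix.mul_assoc, e2, Matrix.mul_assoc, h', Matrix.mul_one]

theorem IsGQInvariant.add {f g : MatrixAlg k p N} (hf : IsGQInvariant f)
    (hg : IsGQInvariant g) : IsGQInvariant (f + g) := by
  intro R _ _ 𝓡 _ h1 φ ψ h2 h3 a b h4 h5 h6 h7
  rw [map_add, map_add, hf R 𝓡 h1 φ ψ h2 h3 a b h4 h5 h6 h7, hg R 𝓡 h1 φ ψ h2 h3 a b h4 h5 h6 h7]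

theorem IsGQInvariant.mul {f g : MatrixAlg k p N} (hf : IsGQInvariant f)
    (hg : IsGQInvariant g) : IsGQInvariant (f * g) := by
  intro R _ _ 𝓡 _ h1 φ ψ h2 h3 a b h4 h5 h6 h7
  rw [map_mul, map_mul, hf R 𝓡 h1 φ ψ h2 h3 a b h4 h5 h6 h7, hg R 𝓡 h1 φ ψ h2 h3 a b h4 h5 h6 h7]

theorem IsGQInvariant.smul {f : MatrixAlg k p N} (c : k) (hf : IsGQInvariant f) :
    IsGQInvariant (c • f) := by
  intro R _ _ 𝓡 _ h1 φ ψ h2 h3 a b h4 h5 h6 h7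
  rw [map_smul, map_smul, hf R 𝓡 h1 φ ψ h2 h3 a b h4 h5 h6 h7]

theorem isGQInvariant_one : IsGQInvariant (1 : MatrixAlg k p N) := by
  intro R _ _ 𝓡 _ h1 φ ψ h2 h3 a b h4 h5 h6 h7
  rw [map_one, map_one]

/-- The invariants of degree `n`, as a linear subspace. -/
def invariantSubmodule (k : Type u) [Field k] (p : Fin d → ZMod 2) (N n : ℕ) :
    Submodule k (MatrixAlg k p N) where
  carrier := gqInvariants k p N n
  add_mem' hf hg := ⟨Submodule.add_mem _ hf.1 hg.1, hf.2.add hg.2⟩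
  zero_mem' := ⟨Submodule.zero_mem _, by
    simpa using (isGQInvariant_one (k := k) (p := p) (N := N)).smul 0⟩
  smul_mem' c _ hf := ⟨Submodule.smul_mem _ c hf.1, hf.2.smul c⟩

theorem mem_invariantSubmodule {n : ℕ} {f : MatrixAlg k p N} :
    f ∈ invariantSubmodule k p N n ↔ f ∈ gqInvariants k p N n := Iff.rfl

theorem oddTraceWord_mem_power [CharZero k] (w : List (Fin d)) :
    oddTraceWord k p N w ∈ SuperPoly.power k (qVarPar p N) w.length := by
  have h1 : ∀ i a b, genericMatrix k p N i a b ∈ SuperPoly.power k (qVarPar p N) 1 := by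
    rintro i (a | a) (b | b) <;> simp only [genericMatrix, Matrix.fromBlocks_apply₁₁,
      Matrix.fromBlocks_apply₁₂, Matrix.fromBlocks_apply₂₁, Matrix.fromBlocks_apply₂₂,
      Matrix.smul_apply, Matrix.of_apply]
    · exact SuperPoly.gen_mem_power _
    · exact SuperPoly.gen_mem_power _
    · exact Submodule.smul_mem _ _ (SuperPoly.gen_mem_power _)
    · exact Submodule.smul_mem _ _ (SuperPoly.gen_mem_power _)
  have h2 : ∀ w : List (Fin d), ∀ a b, (w.map (genericMatrix k p N)).prod a b ∈
      SuperPoly.power k (qVarPar p N) w.length := by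
    intro w
    induction w with
    | nil =>
      intro a b
      by_cases hab : a = b
      · subst hab; simpa using SuperPoly.one_mem_power
      · simp [Matrix.one_apply_ne hab]
    | cons i w ih =>
      intro a b
      rw [List.map_cons, List.prod_cons, Matrix.mul_apply, List.length_cons, add_comm]
      exact Submodule.sum_mem _ fun c _ => SuperPoly.power_mul (h1 i a c) (ih c b)
  rw [oddTraceWord, (wordMatrix_isQ p N w).oddTrace_eq]
  exact Submodule.sum_mem _ fun a _ => h2 w _ _

/-- Products of odd traces are invariants. -/
theorem traceMap_mem_gqInvariants [CharZero k] (c : k) {n : ℕ} {x : CyclicAlg k p}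
    (hx : x ∈ CyclicAlg.component k p n) : traceMap p N c x ∈ gqInvariants k p N n := by
  rw [← mem_invariantSubmodule]
  induction hx using Submodule.span_induction with
  | mem x hx =>
    obtain ⟨ws, hn, rfl⟩ := hx
    subst hn
    induction ws with
    | nil => simpa using ⟨SuperPoly.one_mem_power, isGQInvariant_one⟩
    | cons w ws ih =>
      rw [List.map_cons, List.map_cons, List.prod_cons, List.sum_cons, map_mul, traceMap_cyc]
      exact ⟨SuperPoly.power_mul (Submodule.smul_mem _ _ (oddTraceWord_mem_power w)) ih.1,
        ((oddTraceWord_isGQInvariant w).smul c).mul ih.2⟩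
  | zero => rw [map_zero]; exact Submodule.zero_mem _
  | add x y _ _ hx hy => rw [map_add]; exact Submodule.add_mem _ hx hy
  | smul a x _ hx => rw [map_smul]; exact Submodule.smul_mem _ a hx

end Points

/-! ### The product rule of the Batalin-Vilkovisky operator -/

namespace SuperPoly

variable {k : Type u} [Field k] {G : Type} {par : G → ZMod 2} [DecidableEq G] [Fintype G]

/-- The odd Poisson bracket `{f, g}` of the form `B`, where `f` has parity `e`. -/
def oddBracket (par : G → ZMod 2) (B : G → G → k) (e : ZMod 2) (f : SuperPoly k par) :
    SuperPoly k par →ₗ[k] SuperPoly k par :=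
  ∑ x, ∑ y, (B x y * ksgn k (par y * e)) •
    (LinearMap.mulLeft k (pderiv k par x f) ∘ₗ pderiv k par y)

theorem oddBracket_apply (B : G → G → k) (e : ZMod 2) (f g : SuperPoly k par) :
    oddBracket par B e f g =
      ∑ x, ∑ y, (B x y * ksgn k (par y * e)) • (pderiv k par x f * pderiv k par y g) := by
  simp [oddBracket]

theorem oddBracket_one (B : G → G → k) (e : ZMod 2) (f : SuperPoly k par) :
    oddBracket par B e f 1 = 0 := by
  simp [oddBracket_apply, pderiv_one]

theorem oddBracket_mul {B : G → G → k} (hB : ∀ x y, B x y ≠ 0 → par x + par y = 1)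
    {e e' : ZMod 2} {f g : SuperPoly k par} (hf : f ∈ parityPart k (gen k par) par e)
    (hg : g ∈ parityPart k (gen k par) par e') (h : SuperPoly k par) :
    oddBracket par B e f (g * h) = oddBracket par B e f g * h +
      ksgn k ((e + 1) * e') • (g * oddBracket par B e f h) := by
  simp only [oddBracket_apply, Finset.sum_mul, Finset.mul_sum, Finset.smul_sum,
    ← Finset.sum_add_distrib]
  refine Finset.sum_congr rfl fun x _ => Finset.sum_congr rfl fun y _ => ?_
  by_cases hxy : B x y = 0
  · simp [hxy]
  rw [pderiv_mul y hg, mul_add, smul_add, ← mul_assoc, smul_mul_assoc, mul_smul_comm,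
    mul_smul_comm, ← mul_assoc, ← mul_assoc, graded_comm _ _ _ (pderiv_mem x hf) _ hg,
    smul_mul_assoc, smul_smul, smul_smul, smul_smul]
  congr 2
  have e1 : par x = par y + 1 := by
    have := hB x y hxy
    rw [← this, add_left_comm, CharTwo.add_self_eq_zero, add_zero]
  rw [mul_assoc, mul_assoc, ← ksgn_add, ← ksgn_add, mul_left_comm, ← ksgn_add, e1]
  congr 2
  generalize par y = z
  clear hf hg
  revert z e e'; decide

/-- The Batalin-Vilkovisky operator is of second order, with symbol the odd Poisson bracket. -/
theorem bvOperator_mul [CharZero k] {B : G → G → k} (hB : ∀ x y, B x y ≠ 0 → par x + par y = 1)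
    (hsymm : ∀ x y, B x y = B y x) {e : ZMod 2} {f : SuperPoly k par}
    (hf : f ∈ parityPart k (gen k par) par e) (g : SuperPoly k par) :
    bvOperator par B (f * g) = bvOperator par B f * g + oddBracket par B e f g +
      ksgn k e • (f * bvOperator par B g) := by
  have key : ∀ x y, B x y • pderiv k par y (pderiv k par x (f * g)) =
      (B x y • pderiv k par y (pderiv k par x f)) * g +
      (B x y * ksgn k (par y * e)) • (pderiv k par x f * pderiv k par y g) +
      (B y x * ksgn k (par x * e)) • (pderiv k par y f * pderiv k par x g) +
      ksgn k e • (f * (B x y • pderiv k par y (pderiv k par x g))) := by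
    intro x y
    by_cases hxy : B x y = 0
    · rw [← hsymm x y]; simp [hxy]
    rw [pderiv_mul x hf, map_add, map_smul, pderiv_mul y hf, pderiv_mul y (pderiv_mem x hf),
      ← hsymm x y]
    have e1 : par x = par y + 1 := by
      rw [← hB x y hxy, add_left_comm, CharTwo.add_self_eq_zero, add_zero]
    have e2 : ksgn k (par y * (par x + e)) = ksgn k (par y * e) := by
      rw [e1]; congr 1; generalize par y = z; clear hf; revert z e; decide
    have e3 : ksgn k (par x * e) * ksgn k (par y * e) = ksgn k e := by
      clear e2; rw [e1, ← ksgn_add]; congr 1; generalize par y = z; clear hf; revert z e; decide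
    rw [e2, ← e3]
    simp only [smul_add, smul_mul_assoc, mul_smul_comm, smul_smul]
    module
  simp only [bvOperator, LinearMap.smul_apply, LinearMap.sum_apply, LinearMap.comp_apply, key,
    Finset.sum_add_distrib, ← Finset.sum_mul, ← Finset.mul_sum, ← Finset.smul_sum]
  rw [Finset.sum_comm (f := fun x y => (B y x * ksgn k (par x * e)) •
    (pderiv k par y f * pderiv k par x g)), ← oddBracket_apply]
  have h2 : ∀ z : SuperPoly k par, (1 / 2 : k) • z + (1 / 2 : k) • z = z := by
    intro z; rw [← add_smul]; norm_num
  simp only [smul_add, smul_mul_assoc, mul_smul_comm]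
  rw [add_assoc (_ • (_ * g)), h2, smul_comm (ksgn k e)]

end SuperPoly

/-! ### Derivatives of odd traces -/

section TraceDerivative

variable {k : Type u} [Field k] {d N : ℕ} {p : Fin d → ZMod 2}

open SuperPoly CyclicAlg

/-- The sum of the diagonal entries of the block `Y`; on `q(U)` this is the odd trace. -/
def qTrace {R : Type v} [AddCommMonoid R] (M : Matrix (QIdx N) (QIdx N) R) : R :=
  ∑ a, M (Sum.inl a) (Sum.inr a)

/-- The product `A_{w 1} ⋯ A_{w r}` of generic matrices. -/
def wordMatrix (k : Type u) [Field k] (p : Fin d → ZMod 2) (N : ℕ) (w : List (Fin d)) :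
    Matrix (QIdx N) (QIdx N) (MatrixAlg k p N) :=
  (w.map (genericMatrix k p N)).prod

theorem wordMatrix_nil : wordMatrix k p N [] = 1 := rfl

theorem wordMatrix_cons (a : Fin d) (w : List (Fin d)) :
    wordMatrix k p N (a :: w) = genericMatrix k p N a * wordMatrix k p N w := by
  simp [wordMatrix]

theorem wordMatrix_append (v w : List (Fin d)) :
    wordMatrix k p N (v ++ w) = wordMatrix k p N v * wordMatrix k p N w := by
  simp [wordMatrix]

theorem isQ_wordMatrix (w : List (Fin d)) :
    IsQ (parityPart k (gen k (qVarPar p N)) (qVarPar p N)) (wordPar p w) (wordMatrix k p N w) :=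
  wordMatrix_isQ p N w

theorem oddTraceWord_eq_qTrace [CharZero k] (w : List (Fin d)) :
    oddTraceWord k p N w = qTrace (wordMatrix k p N w) :=
  (wordMatrix_isQ p N w).oddTrace_eq

/-- The entrywise left derivative of a supermatrix along `y`, with the Koszul signs
`(-1)^{|y||a|}` for moving the derivative past the row index `a`. With these signs it is a
superderivation of the algebra of supermatrices. -/
def matrixDeriv (y : QVar d N) (M : Matrix (QIdx N) (QIdx N) (MatrixAlg k p N)) :
    Matrix (QIdx N) (QIdx N) (MatrixAlg k p N) :=
  Matrix.of fun a b => ksgn k (qVarPar p N y * qIdxPar a) • pderiv k (qVarPar p N) y (M a b)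

theorem matrixDeriv_inl (y : QVar d N) (M : Matrix (QIdx N) (QIdx N) (MatrixAlg k p N))
    (a : Fin N) (b : QIdx N) :
    matrixDeriv y M (Sum.inl a) b = pderiv k (qVarPar p N) y (M (Sum.inl a) b) := by
  simp [matrixDeriv, qIdxPar, ksgn_zero]

theorem matrixDeriv_mul (y : QVar d N) {e : ZMod 2}
    {M : Matrix (QIdx N) (QIdx N) (MatrixAlg k p N)}
    (hM : IsQ (parityPart k (gen k (qVarPar p N)) (qVarPar p N)) e M)
    (M' : Matrix (QIdx N) (QIdx N) (MatrixAlg k p N)) :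
    matrixDeriv y (M * M') =
      matrixDeriv y M * M' + ksgn k (qVarPar p N y * e) • (M * matrixDeriv y M') := by
  ext a b
  simp only [matrixDeriv, Matrix.of_apply, Matrix.mul_apply, Matrix.add_apply, Matrix.smul_apply,
    map_sum, Finset.smul_sum, ← Finset.sum_add_distrib]
  refine Finset.sum_congr rfl fun c _ => ?_
  rw [pderiv_mul y (hM.1 a c), smul_add, smul_mul_assoc, mul_smul_comm, smul_smul, smul_smul,
    ← ksgn_add, ← ksgn_add]
  congr 3
  generalize qVarPar p N y = z
  generalize qIdxPar a = x
  generalize qIdxPar c = t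
  clear hM
  revert x z t e; decide

theorem matrixDeriv_isQ (y : QVar d N) {e : ZMod 2}
    {M : Matrix (QIdx N) (QIdx N) (MatrixAlg k p N)}
    (hM : IsQ (parityPart k (gen k (qVarPar p N)) (qVarPar p N)) e M) :
    IsQ (parityPart k (gen k (qVarPar p N)) (qVarPar p N)) (qVarPar p N y + e)
      (matrixDeriv y M) := by
  refine ⟨fun a b => Submodule.smul_mem _ _ ?_, ?_⟩
  · have := pderiv_mem y (hM.1 a b)
    rwa [← add_assoc, ← add_assoc] at this
  · ext a b
    rw [mul_oddInv_apply, Matrix.smul_apply, oddInv_mul_apply]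
    simp only [matrixDeriv, Matrix.of_apply]
    rw [hM.swap_apply a b, map_smul, smul_smul, smul_smul, ← ksgn_add, ← ksgn_add]
    congr 2
    have h : qIdxPar a.swap = qIdxPar a + 1 := by
      rcases a with a | a
      · simp [qIdxPar]
      · simp only [qIdxPar, Sum.swap_inr, Sum.elim_inl, Sum.elim_inr]; decide
    rw [h]
    generalize qVarPar p N y = z
    generalize qIdxPar a = x
    clear hM
    revert x z e; decide

theorem qTrace_mul_comm {A B : Matrix (QIdx N) (QIdx N) (MatrixAlg k p N)} [CharZero k]
    {e e' : ZMod 2} (hA : IsQ (parityPart k (gen k (qVarPar p N)) (qVarPar p N)) e A)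
    (hB : IsQ (parityPart k (gen k (qVarPar p N)) (qVarPar p N)) e' B) :
    qTrace (A * B) = ksgn k (e * e') • qTrace (B * A) := by
  have h := IsQ.oddTrace_mul_comm (parity_mul p N) (parity_comm p N) hA hB
  rwa [(hA.mul (parity_mul p N) hB).oddTrace_eq, (hB.mul (parity_mul p N) hA).oddTrace_eq] at h

/-- The derivative of the first letter of a word of generic matrices. -/
def headDeriv (k : Type u) [Field k] (p : Fin d → ZMod 2) (N : ℕ) (y : QVar d N) :
    List (Fin d) → Matrix (QIdx N) (QIdx N) (MatrixAlg k p N)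
  | a :: u => matrixDeriv y (genericMatrix k p N a) * wordMatrix k p N u
  | [] => 0

theorem matrixDeriv_one (y : QVar d N) :
    matrixDeriv y (1 : Matrix (QIdx N) (QIdx N) (MatrixAlg k p N)) = 0 := by
  ext a b
  simp only [matrixDeriv, Matrix.of_apply, Matrix.one_apply]
  split_ifs <;> simp [pderiv_one]

theorem matrixDeriv_wordMatrix (y : QVar d N) (w : List (Fin d)) :
    matrixDeriv y (wordMatrix k p N w) = ∑ i ∈ Finset.range w.length,
      ksgn k (qVarPar p N y * wordPar p (w.take i)) •
        (wordMatrix k p N (w.take i) * headDeriv k p N y (w.drop i)) := by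
  induction w with
  | nil => simp [wordMatrix_nil, matrixDeriv_one]
  | cons a w ih =>
    rw [wordMatrix_cons, matrixDeriv_mul y (genericMatrix_isQ p N a), ih, List.length_cons,
      Finset.sum_range_succ', add_comm]
    congr 1
    · rw [Finset.mul_sum, Finset.smul_sum]
      refine Finset.sum_congr rfl fun i _ => ?_
      rw [List.take_succ_cons, List.drop_succ_cons, wordMatrix_cons, mul_smul_comm, smul_smul,
        ← ksgn_add, ← mul_add, Matrix.mul_assoc]
      simp [wordPar]
    · simp [wordPar, ksgn_zero, wordMatrix_nil, headDeriv]

/-- The derivative of an odd trace: by cyclicity each letter in turn can be moved to the front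
and derived there. -/
theorem pderiv_oddTraceWord [CharZero k] (y : QVar d N) (w : List (Fin d)) :
    pderiv k (qVarPar p N) y (oddTraceWord k p N w) =
      rotSum (k := k) p (fun w' => qTrace (headDeriv k p N y w')) w := by
  have h1 : pderiv k (qVarPar p N) y (oddTraceWord k p N w) =
      qTrace (matrixDeriv y (wordMatrix k p N w)) := by
    rw [oddTraceWord_eq_qTrace]
    simp [qTrace, matrixDeriv_inl]
  have h2 : qTrace (matrixDeriv y (wordMatrix k p N w)) = ∑ i ∈ Finset.range w.length,
      ksgn k (qVarPar p N y * wordPar p (w.take i)) •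
        qTrace (wordMatrix k p N (w.take i) * headDeriv k p N y (w.drop i)) := by
    rw [matrixDeriv_wordMatrix]
    simp only [qTrace, Matrix.sum_apply, Matrix.smul_apply, Finset.smul_sum]
    rw [Finset.sum_comm]
  rw [h1, h2, rotSum]
  refine Finset.sum_congr rfl fun i hi => ?_
  have hi : i < w.length := Finset.mem_range.mp hi
  rw [List.rotate_eq_drop_append_take hi.le]
  obtain ⟨a, u, hu⟩ : ∃ a u, w.drop i = a :: u := by
    rcases h : w.drop i with _ | ⟨a, u⟩
    · rw [List.drop_eq_nil_iff] at h; omega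
    · exact ⟨a, u, rfl⟩
  have hq : IsQ (parityPart k (gen k (qVarPar p N)) (qVarPar p N))
      (qVarPar p N y + wordPar p (w.drop i)) (headDeriv k p N y (w.drop i)) := by
    rw [hu]
    have := (matrixDeriv_isQ y (genericMatrix_isQ p N a)).mul (parity_mul p N)
      (isQ_wordMatrix (k := k) (p := p) u)
    rw [add_assoc] at this
    simpa only [headDeriv, wordPar, List.map_cons, List.sum_cons] using this
  rw [qTrace_mul_comm (isQ_wordMatrix (w.take i)) hq, smul_smul, ← ksgn_add, rotSgn]
  congr 1
  · congr 1
    generalize qVarPar p N y = z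
    generalize wordPar p (w.take i) = x
    generalize wordPar p (w.drop i) = t
    revert x z t; decide
  · rw [hu, List.cons_append, headDeriv, headDeriv, wordMatrix_append, Matrix.mul_assoc]

/-- The derivative of a generic matrix is an elementary element of `q(U)`. -/
theorem matrixDeriv_genericMatrix (e : ZMod 2) (i j : Fin d) (α β : Fin N) :
    matrixDeriv (e, j, α, β) (genericMatrix k p N i) = if i = j then
      (if e = 0 then Matrix.single (Sum.inl α) (Sum.inl β) 1 +
          Matrix.single (Sum.inr α) (Sum.inr β) 1
        else Matrix.single (Sum.inl α) (Sum.inr β) 1 -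
          Matrix.single (Sum.inr α) (Sum.inl β) 1) else 0 := by
  have h2 : ∀ z : ZMod 2, z = 0 ∨ z = 1 := by decide
  by_cases hij : i = j
  · subst hij
    rcases h2 e with rfl | rfl <;>
    · ext (a | a) (b | b) <;>
        simp [matrixDeriv, genericMatrix, pderiv_gen, Matrix.single_apply, qIdxPar, ksgn_zero,
          qVarPar, smul_smul, ksgn_mul_self, ksgn_add, ksgn_one, eq_comm]
      all_goals (split_ifs <;> simp)
  · rcases h2 e with rfl | rfl <;>
    · ext (a | a) (b | b) <;>
        simp [matrixDeriv, genericMatrix, pderiv_gen, hij]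

end TraceDerivative

/-! ### Comparison of the two Batalin-Vilkovisky operators -/

section CompareBV

variable {k : Type u} [Field k] {d N : ℕ} {p : Fin d → ZMod 2} {L : Fin d → Fin d → k}

open SuperPoly CyclicAlg

theorem sum_zmod_two {M : Type v} [AddCommMonoid M] (f : ZMod 2 → M) : ∑ e, f e = f 0 + f 1 :=
  Fin.sum_univ_two f

theorem oddForm_parity (hL : IsEvenGram p L) (x y : QVar d N) (h : oddForm p N L x y ≠ 0) :
    qVarPar p N x + qVarPar p N y = 1 := by
  unfold oddForm at h
  split_ifs at h with h1
  · have h2 : p x.2.1 = p y.2.1 := by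
      by_contra h3
      rw [hL.even _ _ h3] at h
      simp at h
    have e : ∀ a b c : ZMod 2, a + b + (a + c) = b + c := by decide
    rw [qVarPar, qVarPar, h2, e, h1.1]
  · exact absurd rfl h

theorem oddForm_symm (hL : IsEvenGram p L) (x y : QVar d N) :
    oddForm p N L x y = oddForm p N L y x := by
  unfold oddForm
  have hc : (x.1 + y.1 = 1 ∧ x.2.2.1 = y.2.2.2 ∧ x.2.2.2 = y.2.2.1) ↔
      (y.1 + x.1 = 1 ∧ y.2.2.1 = x.2.2.2 ∧ y.2.2.2 = x.2.2.1) := by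
    rw [add_comm]
    constructor <;> rintro ⟨h1, h2, h3⟩ <;> exact ⟨h1, h3.symm, h2.symm⟩
  by_cases h : x.1 + y.1 = 1 ∧ x.2.2.1 = y.2.2.2 ∧ x.2.2.2 = y.2.2.1
  · rw [if_pos h, if_pos (hc.mp h)]
    by_cases hp : p x.2.1 = p y.2.1
    · have e1 : x.1 = y.1 + 1 := by
        rw [← h.1, add_left_comm, CharTwo.add_self_eq_zero, add_zero]
      rw [hL.symm, hp, e1, mul_right_comm, mul_right_comm _ (L y.2.1 x.2.1), ← mul_assoc,
        ← ksgn_add, ← ksgn_add, ← ksgn_add]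
      congr 2
      generalize p y.2.1 = a
      generalize y.1 = b
      revert a b; decide
    · rw [hL.even _ _ hp, hL.even _ _ (Ne.symm hp)]; simp
  · rw [if_neg h, if_neg (fun h' => h (hc.mpr h'))]

/-- A sum weighted by the odd form only involves the pairs of an entry of `X` and the transposed
entry of `Y`. -/
theorem sum_oddForm_smul {M : Type v} [AddCommGroup M] [Module k M]
    (H : QVar d N → QVar d N → M) :
    ∑ x, ∑ y, oddForm p N L x y • H x y = ∑ i, ∑ j, ∑ α, ∑ β,
      L i j • (ksgn k (p j) • H (1, i, α, β) (0, j, β, α) - H (0, i, α, β) (1, j, β, α)) := by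
  have h0 : ∀ i j α β, ∑ γ, ∑ δ, oddForm p N L (0, i, α, β) (1, j, γ, δ) •
      H (0, i, α, β) (1, j, γ, δ) = - (L i j • H (0, i, α, β) (1, j, β, α)) := by
    intro i j α β
    rw [Finset.sum_eq_single β, Finset.sum_eq_single α]
    · simp [oddForm, ksgn_zero, ksgn_one]
    · intro γ _ h; simp [oddForm, Ne.symm h]
    · simp
    · intro γ _ h; exact Finset.sum_eq_zero fun δ _ => by simp [oddForm, Ne.symm h]
    · simp
  have h1 : ∀ i j α β, ∑ γ, ∑ δ, oddForm p N L (1, i, α, β) (0, j, γ, δ) •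
      H (1, i, α, β) (0, j, γ, δ) = L i j • ksgn k (p j) • H (1, i, α, β) (0, j, β, α) := by
    intro i j α β
    rw [Finset.sum_eq_single β, Finset.sum_eq_single α]
    · simp [oddForm, ksgn_zero, smul_smul, mul_comm]
    · intro γ _ h; simp [oddForm, Ne.symm h]
    · simp
    · intro γ _ h; exact Finset.sum_eq_zero fun δ _ => by simp [oddForm, Ne.symm h]
    · simp
  have h2 : ∀ i j α β γ δ, oddForm p N L (0, i, α, β) (0, j, γ, δ) = 0 := by
    intros; simp [oddForm]
  have h3 : ∀ i j α β γ δ, oddForm p N L (1, i, α, β) (1, j, γ, δ) = 0 := by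
    intros
    have : (1 : ZMod 2) + 1 ≠ 1 := by decide
    simp [oddForm, this]
  simp only [Fintype.sum_prod_type, sum_zmod_two, h2, h3, zero_smul, Finset.sum_const_zero,
    zero_add, add_zero, h0, h1]
  simp only [← Finset.sum_add_distrib]
  refine Finset.sum_congr rfl fun i _ => ?_
  conv_rhs => rw [Finset.sum_comm]; enter [2, α]; rw [Finset.sum_comm]
  refine Finset.sum_congr rfl fun α _ => Finset.sum_congr rfl fun β _ => ?_
  refine Finset.sum_congr rfl fun j _ => ?_
  rw [smul_sub]; abel

theorem qTrace_single_mul {R : Type v} [Ring R] (s t : QIdx N)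
    (M : Matrix (QIdx N) (QIdx N) R) :
    qTrace (Matrix.single s t 1 * M) = Sum.elim (fun a => M t (Sum.inr a)) (fun _ => 0) s := by
  rcases s with s | s
  · rw [qTrace, Finset.sum_eq_single s]
    · simp
    · intro b _ h
      rw [Matrix.single_mul_apply_of_ne]
      simpa using h
    · simp
  · rw [qTrace]
    exact Finset.sum_eq_zero fun b _ => by
      rw [Matrix.single_mul_apply_of_ne]; simp

theorem qTrace_add {R : Type v} [Ring R] (A B : Matrix (QIdx N) (QIdx N) R) :
    qTrace (A + B) = qTrace A + qTrace B := by simp [qTrace, Finset.sum_add_distrib]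

theorem qTrace_sub {R : Type v} [Ring R] (A B : Matrix (QIdx N) (QIdx N) R) :
    qTrace (A - B) = qTrace A - qTrace B := by simp [qTrace, Finset.sum_sub_distrib]

/-- Deriving the first letter of an odd trace gives an entry of the product of the others. -/
theorem qTrace_headDeriv (e : ZMod 2) (j a : Fin d) (α β : Fin N) (u : List (Fin d)) :
    qTrace (headDeriv k p N (e, j, α, β) (a :: u)) = if a = j then
      (if e = 0 then wordMatrix k p N u (Sum.inl β) (Sum.inr α)
        else wordMatrix k p N u (Sum.inr β) (Sum.inr α)) else 0 := by
  rw [headDeriv, matrixDeriv_genericMatrix]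
  split_ifs
  · rw [add_mul, qTrace_add, qTrace_single_mul, qTrace_single_mul]; simp
  · rw [sub_mul, qTrace_sub, qTrace_single_mul, qTrace_single_mul]; simp
  · simp [qTrace]

/-- The contraction of the first letters of two odd traces by the odd Poisson bracket. -/
theorem sum_oddForm_headDeriv_mul [CharZero k] (hL : IsEvenGram p L) (v w : List (Fin d)) :
    ∑ x, ∑ y, oddForm p N L x y • (ksgn k (qVarPar p N y * (wordPar p v + 1)) •
      (qTrace (headDeriv k p N x v) * qTrace (headDeriv k p N y w))) =
    traceMap p N 1 (mergeTerm p L v w) := by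
  rcases v with _ | ⟨a, u⟩
  · simp [headDeriv, qTrace, mergeTerm]
  rcases w with _ | ⟨b, u'⟩
  · simp [headDeriv, qTrace, mergeTerm]
  rw [sum_oddForm_smul, Finset.sum_eq_single a, Finset.sum_eq_single b]
  rotate_left
  · intro j _ hj
    simp [qTrace_headDeriv, Ne.symm hj]
  · simp
  · intro j _ hj
    simp [qTrace_headDeriv, Ne.symm hj]
  · simp
  by_cases hab : p a = p b
  swap
  · simp [mergeTerm, hL.even _ _ hab]
  rw [mergeTerm, map_smul, traceMap_cyc, one_smul, oddTraceWord_eq_qTrace, wordMatrix_append,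
    mul_comm (ksgn k _), mul_smul]
  simp only [← Finset.smul_sum]
  congr 1
  rw [Finset.sum_comm, qTrace, Finset.smul_sum]
  refine Finset.sum_congr rfl fun β _ => ?_
  rw [Matrix.mul_apply, Fintype.sum_sum_type, ← Finset.sum_add_distrib, Finset.smul_sum]
  refine Finset.sum_congr rfl fun α _ => ?_
  simp only [qTrace_headDeriv, if_true, one_ne_zero, if_false, qVarPar, hab, wordPar,
    List.map_cons, List.sum_cons]
  have hu := isQ_wordMatrix (k := k) (p := p) (N := N) u
  have hu' := isQ_wordMatrix (k := k) (p := p) (N := N) u'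
  rw [hu.apply_inr_inr, smul_mul_assoc, smul_smul, smul_smul, smul_add, sub_eq_add_neg]
  congr 1
  · congr 1
    rw [← ksgn_add, ← ksgn_add]
    congr 1
    simp only [wordPar]
    generalize (List.map p u).sum = x
    generalize p b = z
    revert x z; decide
  · rw [← neg_smul, ← neg_one_mul, ← ksgn_one k, ← ksgn_add]
    congr 2
    generalize (List.map p u).sum = x
    generalize p b = z
    revert x z; decide

theorem sum_sum_sum_sum_comm {M ι κ : Type*} [AddCommMonoid M] (s : Finset ι) (t : Finset κ)
    {α β : Type*} (a : Finset α) (b : Finset β) (f : ι → κ → α → β → M) :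
    ∑ x ∈ s, ∑ y ∈ t, ∑ i ∈ a, ∑ j ∈ b, f x y i j =
      ∑ i ∈ a, ∑ j ∈ b, ∑ x ∈ s, ∑ y ∈ t, f x y i j := by
  have h1 : ∀ x y, ∑ i ∈ a, ∑ j ∈ b, f x y i j = ∑ z ∈ a ×ˢ b, f x y z.1 z.2 :=
    fun x y => Finset.sum_product' a b (f x y) |>.symm
  have h2 : ∀ i j, ∑ x ∈ s, ∑ y ∈ t, f x y i j = ∑ z ∈ s ×ˢ t, f z.1 z.2 i j :=
    fun i j => Finset.sum_product' s t (fun x y => f x y i j) |>.symm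
  simp only [h1, h2]
  rw [← Finset.sum_product' s t (fun x y => ∑ z ∈ a ×ˢ b, f x y z.1 z.2),
    ← Finset.sum_product' a b (fun i j => ∑ z ∈ s ×ˢ t, f z.1 z.2 i j), Finset.sum_comm]

theorem oddTraceWord_mem' [CharZero k] (w : List (Fin d)) :
    oddTraceWord k p N w ∈ parityPart k (gen k (qVarPar p N)) (qVarPar p N) (cycPar p w) :=
  oddTraceWord_mem p N w

theorem wordPar_rotate (w : List (Fin d)) (i : ℕ) : wordPar p (w.rotate i) = wordPar p w :=
  ((List.rotate_perm w i).map p).sum_eq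

/-- The odd Poisson bracket of two odd traces. -/
theorem oddBracket_oddTraceWord [CharZero k] (hL : IsEvenGram p L) (v w : List (Fin d)) :
    oddBracket (qVarPar p N) (oddForm p N L) (cycPar p v) (oddTraceWord k p N v)
      (oddTraceWord k p N w) = traceMap p N 1 (merge p L v w) := by
  rw [oddBracket_apply]
  simp only [pderiv_oddTraceWord, merge, rotSum, map_sum, map_smul, Finset.sum_mul,
    Finset.mul_sum, Finset.smul_sum, smul_mul_assoc, mul_smul_comm]
  rw [sum_sum_sum_sum_comm, Finset.sum_comm]
  refine Finset.sum_congr rfl fun i _ => Finset.sum_congr rfl fun j _ => ?_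
  rw [← sum_oddForm_headDeriv_mul hL]
  simp only [Finset.smul_sum, wordPar_rotate]
  refine Finset.sum_congr rfl fun x _ => Finset.sum_congr rfl fun y _ => ?_
  simp only [smul_smul, cycPar]
  congr 1; ring

theorem mul_single_mul_apply {R : Type v} [Ring R] (A B : Matrix (QIdx N) (QIdx N) R)
    (s t a b : QIdx N) :
    (A * (Matrix.single s t (1 : R) * B) : Matrix (QIdx N) (QIdx N) R) a b = A a s * B t b := by
  rw [Matrix.mul_apply, Finset.sum_eq_single s]
  · simp
  · intro c _ h
    rw [Matrix.single_mul_apply_of_ne, mul_zero]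
    exact h
  · simp

/-- The contractions of the first letter of an odd trace with its other letters. -/
theorem sum_oddForm_pderiv_headDeriv [CharZero k] (w : List (Fin d)) :
    (1 / 2 : k) • ∑ x, ∑ y, oddForm p N L x y •
      pderiv k (qVarPar p N) y (qTrace (headDeriv k p N x w)) =
    traceMap p N 1 (splitTerm p L w) := by
  rcases w with _ | ⟨a, u⟩
  · simp [headDeriv, qTrace, splitTerm]
  -- the contribution of a letter `b` of `u = u₁ b u₂`: the products of the traces of the blocks `X`
  -- of the two pieces cancel, and those of the traces of the blocks `Y` add up
  have key : ∀ (b : Fin d) (u₁ u₂ : List (Fin d)), u = u₁ ++ b :: u₂ → ∑ j, ∑ α, ∑ β,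
      L a j • (ksgn k (p j) • (ksgn k (wordPar p u) • ksgn k (p j * wordPar p u₁) •
        (wordMatrix k p N u₁ * headDeriv k p N (0, j, β, α) (b :: u₂)) (Sum.inl β) (Sum.inl α)) -
        ksgn k ((p j + 1) * wordPar p u₁) •
        (wordMatrix k p N u₁ * headDeriv k p N (1, j, β, α) (b :: u₂)) (Sum.inl β) (Sum.inr α)) =
      (2 : k) • (ksgn k (p b * wordPar p u₁ + wordPar p u₁) * L a b) •
        (qTrace (wordMatrix k p N u₁) * qTrace (wordMatrix k p N u₂)) := by
    intro b u₁ u₂ hu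
    rw [Finset.sum_eq_single b]
    rotate_left
    · intro j _ hj
      simp [headDeriv, matrixDeriv_genericMatrix, Ne.symm hj]
    · simp
    rw [mul_comm (ksgn k _), mul_smul, smul_comm (2 : k)]
    simp only [← Finset.smul_sum]
    congr 1
    rw [qTrace, qTrace, Finset.sum_mul, Finset.smul_sum, Finset.smul_sum, Finset.sum_comm]
    refine Finset.sum_congr rfl fun β _ => ?_
    rw [Finset.mul_sum, Finset.smul_sum, Finset.smul_sum]
    refine Finset.sum_congr rfl fun α _ => ?_
    have h1 := isQ_wordMatrix (k := k) (p := p) (N := N) u₂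
    have hw : wordPar p u = wordPar p u₁ + p b + wordPar p u₂ := by
      simp [hu, wordPar, add_assoc]
    simp only [headDeriv, matrixDeriv_genericMatrix, if_true, one_ne_zero, if_false, add_mul,
      sub_mul, mul_add, mul_sub, Matrix.add_apply, Matrix.sub_apply, mul_single_mul_apply,
      h1.apply_inr_inr, h1.apply_inr_inl, hw]
    simp only [smul_smul, smul_add, smul_sub, mul_smul_comm, ← ksgn_add]
    generalize wordPar p u₁ = x
    generalize wordPar p u₂ = y
    generalize p b = z
    have h2 : ∀ z : ZMod 2, z = 0 ∨ z = 1 := by decide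
    have h3 : (1 : ZMod 2) + 1 = 0 := by decide
    rcases h2 x with rfl | rfl <;> rcases h2 y with rfl | rfl <;> rcases h2 z with rfl | rfl <;>
      simp only [ksgn_zero, ksgn_one, h3, zero_add, add_zero, mul_zero, mul_one] <;>
      module
  rw [sum_oddForm_smul, Finset.sum_eq_single a]
  rotate_left
  · intro j _ hj
    simp [qTrace_headDeriv, Ne.symm hj]
  · simp
  have e1 : ∀ j α β, pderiv k (qVarPar p N) (0, j, β, α)
      (qTrace (headDeriv k p N (1, a, α, β) (a :: u))) = ∑ i : Fin u.length,
      ksgn k (wordPar p u) • ksgn k (p j * wordPar p (u.take i)) • (wordMatrix k p N (u.take i) *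
        headDeriv k p N (0, j, β, α) (u.get i :: u.drop (i + 1))) (Sum.inl β) (Sum.inl α) := by
    intro j α β
    rw [qTrace_headDeriv, if_pos rfl, if_neg one_ne_zero, (isQ_wordMatrix u).apply_inr_inr,
      map_smul, ← matrixDeriv_inl, matrixDeriv_wordMatrix, Finset.sum_range, Matrix.sum_apply,
      Finset.smul_sum]
    refine Finset.sum_congr rfl fun i _ => ?_
    simp [qVarPar]
  have e2 : ∀ j α β, pderiv k (qVarPar p N) (1, j, β, α)
      (qTrace (headDeriv k p N (0, a, α, β) (a :: u))) = ∑ i : Fin u.length,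
      ksgn k ((p j + 1) * wordPar p (u.take i)) • (wordMatrix k p N (u.take i) *
        headDeriv k p N (1, j, β, α) (u.get i :: u.drop (i + 1))) (Sum.inl β) (Sum.inr α) := by
    intro j α β
    rw [qTrace_headDeriv, if_pos rfl, if_pos rfl, ← matrixDeriv_inl, matrixDeriv_wordMatrix,
      Finset.sum_range, Matrix.sum_apply]
    refine Finset.sum_congr rfl fun i _ => ?_
    simp [qVarPar]
  have e3 : ∀ i : Fin u.length, u = u.take i ++ u.get i :: u.drop (i + 1) := fun i => by simp
  simp only [e1, e2, splitTerm, map_sum, map_smul, map_mul, traceMap_cyc, one_smul]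
  have e4 := Finset.sum_congr rfl fun (i : Fin u.length) (_ : i ∈ Finset.univ) =>
    key (u.get i) (u.take i) (u.drop (i + 1)) (e3 i)
  rw [← Finset.smul_sum (r := (2 : k))] at e4
  simp only [oddTraceWord_eq_qTrace]
  have e5 : ∀ z : MatrixAlg k p N, (1 / 2 : k) • (2 : k) • z = z := by
    intro z; rw [smul_smul]; norm_num
  refine Eq.trans ?_ (e5 _)
  rw [← e4]
  congr 1
  simp only [Finset.smul_sum, ← Finset.sum_sub_distrib]
  conv_rhs =>
    rw [Finset.sum_comm]; enter [2, j]
    rw [Finset.sum_comm]; enter [2, α]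
    rw [Finset.sum_comm]

/-- The Batalin-Vilkovisky operator on an odd trace. -/
theorem matrixBV_oddTraceWord [CharZero k] (w : List (Fin d)) :
    matrixBV p N L (oddTraceWord k p N w) =
      (2 : k) • traceMap p N 1 (split p L w) := by
  have h2 : (2 : k) * (1 / 2) = 1 := by norm_num
  rw [split, map_smul, smul_smul, h2, one_smul]
  simp only [rotSum, map_sum, map_smul, ← sum_oddForm_pderiv_headDeriv]
  simp only [matrixBV, bvOperator, LinearMap.smul_apply, LinearMap.sum_apply,
    LinearMap.comp_apply, pderiv_oddTraceWord, rotSum, map_sum, map_smul, Finset.smul_sum]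
  conv_rhs => rw [Finset.sum_comm]; enter [2, x]; rw [Finset.sum_comm]
  refine Finset.sum_congr rfl fun x _ => Finset.sum_congr rfl fun y _ =>
    Finset.sum_congr rfl fun i _ => ?_
  module

theorem oddBracket_traceMap [CharZero k] (hL : IsEvenGram p L) (c : k) (v : List (Fin d))
    (ws : List (List (Fin d))) :
    oddBracket (qVarPar p N) (oddForm p N L) (cycPar p v) (oddTraceWord k p N v)
      (traceMap p N c (ws.map (cyc k p)).prod) =
    traceMap p N c (bracket hL v (ws.map (cyc k p)).prod) := by
  have hm : ∀ w, c • traceMap p N 1 (merge p L v w) = traceMap p N c (merge p L v w) := by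
    intro w
    simp only [merge, rotSum, map_sum, map_smul, Finset.smul_sum]
    refine Finset.sum_congr rfl fun i _ => Finset.sum_congr rfl fun j _ => ?_
    rw [smul_comm c, smul_comm c]
    congr 2
    rcases v.rotate i with _ | ⟨a, u⟩ <;> rcases w.rotate j with _ | ⟨b, u'⟩ <;>
      simp [mergeTerm, traceMap_cyc, smul_smul, mul_comm]
  induction ws with
  | nil =>
    rw [List.map_nil, List.prod_nil, map_one, oddBracket_one]
    simp [bracket]
  | cons w ws ih =>
    rw [List.map_cons, List.prod_cons, bracket_cyc_mul, map_mul (traceMap p N c), traceMap_cyc,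
      oddBracket_mul (oddForm_parity hL) (oddTraceWord_mem' v)
        (Submodule.smul_mem _ c (oddTraceWord_mem' w)), ih, map_smul, oddBracket_oddTraceWord hL,
      hm, map_add, map_mul, map_smul, map_mul, traceMap_cyc]

/-- The identification by odd traces intertwines the two operators: both are of second order, and
they agree on a single cyclic word and on a pair of them. -/
theorem matrixBV_traceMap [CharZero k] (hL : IsEvenGram p L) {c : k} (hc : c ≠ 0)
    (ws : List (List (Fin d))) :
    c⁻¹ • matrixBV p N L (traceMap p N c (ws.map (cyc k p)).prod) =
    traceMap p N c (ncBV hL (2 / c ^ 2) (ws.map (cyc k p)).prod) := by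
  have hs : ∀ w, c ^ 2 • traceMap p N 1 (split p L w) = traceMap p N c (split p L w) := by
    intro w
    simp only [split, rotSum, map_sum, map_smul, Finset.smul_sum]
    refine Finset.sum_congr rfl fun i _ => ?_
    rw [smul_comm (c ^ 2), smul_comm (c ^ 2)]
    congr 2
    rcases w.rotate i with _ | ⟨a, u⟩
    · simp [splitTerm]
    · simp only [splitTerm, map_sum, map_smul, Finset.smul_sum, map_mul, traceMap_cyc]
      refine Finset.sum_congr rfl fun j _ => ?_
      rw [smul_comm, one_smul, one_smul, smul_mul_smul_comm, pow_two]
  induction ws with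
  | nil =>
    rw [List.map_nil, List.prod_nil, map_one, ncBV_one, map_zero]
    simp [matrixBV, bvOperator, pderiv_one]
  | cons w ws ih =>
    rw [List.map_cons, List.prod_cons, ncBV_cyc_mul, map_mul, traceMap_cyc, smul_mul_assoc,
      map_smul, smul_smul, inv_mul_cancel₀ hc, one_smul, matrixBV,
      bvOperator_mul (oddForm_parity hL) (oddForm_symm hL) (oddTraceWord_mem' w)]
    rw [← matrixBV, oddBracket_traceMap hL, matrixBV_oddTraceWord, map_add, map_add, map_mul,
      map_smul, map_smul, map_mul, traceMap_cyc, ← ih, ← hs]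
    congr 2
    · rw [smul_smul, div_mul_cancel₀ _ (pow_ne_zero 2 hc)]
    · rw [smul_mul_smul_comm, mul_inv_cancel₀ hc, one_smul]

end CompareBV

/-! ### Degrees in the algebra of cyclic words -/

namespace CyclicAlg

variable {k : Type u} [Field k] {d : ℕ} {p : Fin d → ZMod 2} {L : Fin d → Fin d → k}

theorem component_mul {m n : ℕ} {x y : CyclicAlg k p} (hx : x ∈ component k p m)
    (hy : y ∈ component k p n) : x * y ∈ component k p (m + n) := by
  have h := Submodule.mul_mem_mul hx hy
  unfold component at h
  rw [Submodule.span_mul_span] at h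
  refine Submodule.span_mono ?_ h
  rintro _ ⟨_, ⟨w, hw, rfl⟩, _, ⟨w', hw', rfl⟩, rfl⟩
  exact ⟨w ++ w', by simp [hw, hw'], by simp⟩

theorem cyc_mem_component (w : List (Fin d)) : cyc k p w ∈ component k p w.length :=
  Submodule.subset_span ⟨[w], by simp, by simp⟩

theorem prod_cyc_mem_component (ws : List (List (Fin d))) :
    (ws.map (cyc k p)).prod ∈ component k p (ws.map List.length).sum :=
  Submodule.subset_span ⟨ws, rfl, rfl⟩

/-- The component `F_{n-2}`, understood to be zero for `n < 2`. -/
def lowerComponent (k : Type u) [Field k] (p : Fin d → ZMod 2) (n : ℕ) :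
    Submodule k (CyclicAlg k p) :=
  if 2 ≤ n then component k p (n - 2) else ⊥

theorem mem_lowerComponent {n : ℕ} {x : CyclicAlg k p} (hx : x ∈ component k p n) :
    x ∈ lowerComponent k p (n + 2) := by
  rw [lowerComponent, if_pos (by omega)]; exact hx

theorem lowerComponent_mul {m n : ℕ} {x y : CyclicAlg k p} (hx : x ∈ lowerComponent k p m)
    (hy : y ∈ component k p n) : x * y ∈ lowerComponent k p (m + n) := by
  unfold lowerComponent at hx
  split_ifs at hx with h
  · have := component_mul hx hy
    rw [lowerComponent, if_pos (by omega), show m + n - 2 = m - 2 + n by omega]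
    exact this
  · rw [(Submodule.mem_bot k).mp hx, zero_mul]; exact Submodule.zero_mem _

theorem mul_lowerComponent {m n : ℕ} {x y : CyclicAlg k p} (hx : x ∈ component k p m)
    (hy : y ∈ lowerComponent k p n) : x * y ∈ lowerComponent k p (m + n) := by
  unfold lowerComponent at hy
  split_ifs at hy with h
  · have := component_mul hx hy
    rw [lowerComponent, if_pos (by omega), show m + n - 2 = m + (n - 2) by omega]
    exact this
  · rw [(Submodule.mem_bot k).mp hy, mul_zero]; exact Submodule.zero_mem _

theorem merge_mem_lowerComponent (v w : List (Fin d)) :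
    merge p L v w ∈ lowerComponent k p (v.length + w.length) := by
  unfold merge rotSum
  refine Submodule.sum_mem _ fun i _ => Submodule.smul_mem _ _ ?_
  refine Submodule.sum_mem _ fun j _ => Submodule.smul_mem _ _ ?_
  rw [← List.length_rotate v i, ← List.length_rotate w j]
  rcases v.rotate i with _ | ⟨a, u⟩ <;> rcases w.rotate j with _ | ⟨b, u'⟩ <;>
    simp only [mergeTerm, zero_mem]
  refine Submodule.smul_mem _ _ ?_
  have h := mem_lowerComponent (cyc_mem_component (k := k) (p := p) (u ++ u'))
  convert h using 2
  simp only [List.length_cons, List.length_append]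
  omega

theorem split_mem_lowerComponent (w : List (Fin d)) :
    split p L w ∈ lowerComponent k p w.length := by
  unfold split rotSum
  refine Submodule.smul_mem _ _ (Submodule.sum_mem _ fun i _ => Submodule.smul_mem _ _ ?_)
  rw [← List.length_rotate w i]
  rcases w.rotate i with _ | ⟨a, u⟩ <;> simp only [splitTerm, zero_mem]
  refine Submodule.sum_mem _ fun j _ => Submodule.smul_mem _ _ ?_
  have h := mem_lowerComponent (component_mul (cyc_mem_component (k := k) (p := p) (u.take j))
    (cyc_mem_component (k := k) (p := p) (u.drop (j + 1))))
  convert h using 2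
  simp only [List.length_cons, List.length_take, List.length_drop]
  omega

theorem bracket_mem_lowerComponent (hL : IsEvenGram p L) (v : List (Fin d))
    (ws : List (List (Fin d))) : bracket hL v (ws.map (cyc k p)).prod ∈
      lowerComponent k p (v.length + (ws.map List.length).sum) := by
  induction ws with
  | nil => simp [bracket]
  | cons w ws ih =>
    simp only [List.map_cons, List.prod_cons, List.sum_cons, bracket_cyc_mul]
    refine Submodule.add_mem _ ?_ (Submodule.smul_mem _ _ ?_)
    · have := lowerComponent_mul (merge_mem_lowerComponent (L := L) v w)
        (prod_cyc_mem_component (k := k) (p := p) ws)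
      rwa [add_assoc] at this
    · have := mul_lowerComponent (cyc_mem_component w) ih
      rwa [add_left_comm] at this

theorem ncBV_mem_lowerComponent (hL : IsEvenGram p L) (κ : k) {n : ℕ} {x : CyclicAlg k p}
    (hx : x ∈ component k p n) : ncBV hL κ x ∈ lowerComponent k p n := by
  induction hx using Submodule.span_induction with
  | mem x hx =>
    obtain ⟨ws, rfl, rfl⟩ := hx
    induction ws with
    | nil => simp [ncBV_one]
    | cons w ws ih =>
      simp only [List.map_cons, List.prod_cons, List.sum_cons, ncBV_cyc_mul]
      refine Submodule.add_mem _ (Submodule.add_mem _ ?_ (bracket_mem_lowerComponent hL w ws))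
        (Submodule.smul_mem _ _ (mul_lowerComponent (cyc_mem_component w) ih))
      exact lowerComponent_mul (Submodule.smul_mem _ _ (split_mem_lowerComponent w))
        (prod_cyc_mem_component ws)
  | zero => rw [map_zero]; exact Submodule.zero_mem _
  | add x y _ _ hx hy => rw [map_add]; exact Submodule.add_mem _ hx hy
  | smul a x _ hx => rw [map_smul]; exact Submodule.smul_mem _ _ hx

end CyclicAlg

/-! ### Linear substitutions of letters -/

section Substitution

variable {k : Type u} [Field k] {d d' : ℕ} {A : Type v} [AddCommGroup A] [Module k A]

/-- The value at the word `w` of the multilinear extension of a function `f` of words, after the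
linear substitution `a_j ↦ ∑ θ j s a_s` of the letters. -/
def substSum (θ : Fin d → Fin d' → k) : List (Fin d) → (List (Fin d') → A) → A
  | [], f => f []
  | j :: w, f => ∑ s, θ j s • substSum θ w fun v => f (s :: v)

variable (θ : Fin d → Fin d' → k)

theorem substSum_append (w w' : List (Fin d)) (f : List (Fin d') → A) :
    substSum θ (w ++ w') f = substSum θ w fun v => substSum θ w' fun v' => f (v ++ v') := by
  induction w generalizing f with
  | nil => rfl
  | cons j w ih => simp only [List.cons_append, substSum, ih]

theorem map_substSum {B : Type*} [AddCommGroup B] [Module k B] (φ : A →ₗ[k] B)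
    (w : List (Fin d)) (f : List (Fin d') → A) :
    φ (substSum θ w f) = substSum θ w fun v => φ (f v) := by
  induction w generalizing f with
  | nil => rfl
  | cons j w ih => simp only [substSum, map_sum, map_smul, ih]

theorem substSum_smul (c : k) (w : List (Fin d)) (f : List (Fin d') → A) :
    substSum θ w (fun v => c • f v) = c • substSum θ w f :=
  (map_substSum θ (c • LinearMap.id : A →ₗ[k] A) w f).symm

theorem substSum_sum {ι : Type*} (t : Finset ι) (w : List (Fin d)) (f : ι → List (Fin d') → A) :
    substSum θ w (fun v => ∑ i ∈ t, f i v) = ∑ i ∈ t, substSum θ w (f i) := by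
  induction w generalizing f with
  | nil => rfl
  | cons j w ih =>
    simp only [substSum, ih, Finset.smul_sum]
    exact Finset.sum_comm

variable {θ} {p : Fin d → ZMod 2} {p' : Fin d' → ZMod 2}

theorem substSum_congr (hθ : ∀ j s, θ j s ≠ 0 → p' s = p j) (w : List (Fin d))
    {f g : List (Fin d') → A}
    (h : ∀ v, v.length = w.length → wordPar p' v = wordPar p w → f v = g v) :
    substSum θ w f = substSum θ w g := by
  induction w generalizing f g with
  | nil => exact h [] rfl rfl
  | cons j w ih =>
    refine Finset.sum_congr rfl fun s _ => ?_
    by_cases hs : θ j s = 0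
    · simp [hs]
    · rw [ih fun v hv hv' => h (s :: v) (by simp [hv]) ?_]
      simp only [wordPar] at hv'
      simp [wordPar, hθ j s hs, hv']

theorem substSum_mem (hθ : ∀ j s, θ j s ≠ 0 → p' s = p j) (w : List (Fin d))
    {f : List (Fin d') → A} {S : Submodule k A}
    (h : ∀ v, v.length = w.length → wordPar p' v = wordPar p w → f v ∈ S) :
    substSum θ w f ∈ S := by
  induction w generalizing f with
  | nil => exact h [] rfl rfl
  | cons j w ih =>
    refine Submodule.sum_mem _ fun s _ => ?_
    by_cases hs : θ j s = 0
    · simp [hs]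
    · refine Submodule.smul_mem _ _ (ih fun v hv hv' => h (s :: v) (by simp [hv]) ?_)
      simp only [wordPar] at hv'
      simp [wordPar, hθ j s hs, hv']

theorem sum_fin_succ_pi {n : ℕ} {X : Type*} [Fintype X] (g : (Fin (n + 1) → X) → A) :
    ∑ v, g v = ∑ s, ∑ v : Fin n → X, g (Fin.cons s v) := by
  rw [← (Fin.consEquiv fun _ : Fin (n + 1) => X).sum_comp, Fintype.sum_prod_type]
  rfl

theorem substSum_ofFn {n : ℕ} (j : Fin n → Fin d) (f : List (Fin d') → A) :
    substSum θ (List.ofFn j) f = ∑ v : Fin n → Fin d', (∏ u, θ (j u) (v u)) • f (List.ofFn v) := by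
  induction n generalizing f with
  | zero => simp [substSum]
  | succ n ih =>
    rw [List.ofFn_succ, substSum, sum_fin_succ_pi]
    refine Finset.sum_congr rfl fun s _ => ?_
    rw [ih, Finset.smul_sum]
    refine Finset.sum_congr rfl fun v _ => ?_
    rw [Fin.prod_univ_succ, List.ofFn_succ, smul_smul]
    simp

theorem prod_ofFn_sum {R : Type v} [Ring R] {n : ℕ} {X : Type*} [Fintype X]
    (g : Fin n → X → R) :
    (List.ofFn fun u => ∑ s, g u s).prod =
      ∑ v : Fin n → X, (List.ofFn fun u => g u (v u)).prod := by
  induction n with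
  | zero => simp
  | succ n ih =>
    rw [List.ofFn_succ, List.prod_cons, sum_fin_succ_pi, ih, Finset.sum_mul]
    refine Finset.sum_congr rfl fun s _ => ?_
    rw [Finset.mul_sum]
    refine Finset.sum_congr rfl fun v _ => ?_
    rw [List.ofFn_succ, List.prod_cons]
    simp

theorem prod_ofFn_smul {R : Type v} [Ring R] [Algebra k R] {n : ℕ} (c : Fin n → k)
    (g : Fin n → R) :
    (List.ofFn fun u => c u • g u).prod = (∏ u, c u) • (List.ofFn g).prod := by
  induction n with
  | zero => simp
  | succ n ih =>
    rw [List.ofFn_succ, List.ofFn_succ, List.prod_cons, List.prod_cons, Fin.prod_univ_succ, ih,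
      smul_mul_smul_comm]

end Substitution

namespace CyclicAlg

variable {k : Type u} [Field k] {d d' : ℕ} {p : Fin d → ZMod 2} {p' : Fin d' → ZMod 2}
  {θ : Fin d → Fin d' → k}

theorem algHom_ext {A : Type v} [Ring A] [Algebra k A] {f g : CyclicAlg k p →ₐ[k] A}
    (h : ∀ w, f (cyc k p w) = g (cyc k p w)) : f = g := by
  have : f.comp (mk k p) = g.comp (mk k p) := FreeAlgebra.hom_ext (funext h)
  ext x
  obtain ⟨x, rfl⟩ := mk_surjective x
  exact DFunLike.congr_fun this x

/-- The algebra map between algebras of cyclic words that is induced by a parity preserving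
linear substitution of the letters. -/
def substHom (hθ : ∀ j s, θ j s ≠ 0 → p' s = p j) : CyclicAlg k p →ₐ[k] CyclicAlg k p' :=
  lift (fun w => substSum θ w (cyc k p'))
    (by
      have h : ∀ w, substSum θ w (cyc k p') ∈ parityPart k (cyc k p') (cycPar p') (cycPar p w) :=
        fun w => substSum_mem hθ w fun v _ hv => by
          have := gen_mem_parityPart (k := k) (g := cyc k p') (par := cycPar p') v
          rwa [cycPar, hv] at this
      exact fun v w => parityPart_comm cyc_swap (h v) (h w))
    (by
      intro a w
      rw [substSum_append]
      simp only [substSum]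
      rw [substSum_sum, Finset.smul_sum]
      refine Finset.sum_congr rfl fun s _ => ?_
      rw [substSum_smul, smul_comm, ← substSum_smul θ (ksgn k _)]
      by_cases hs : θ a s = 0
      · simp [hs]
      congr 1
      refine substSum_congr hθ w fun v _ hv => ?_
      rw [cyc_rot, hv, hθ a s hs])
    cyc_nil

theorem substHom_cyc (hθ : ∀ j s, θ j s ≠ 0 → p' s = p j) (w : List (Fin d)) :
    substHom hθ (cyc k p w) = substSum θ w (cyc k p') :=
  lift_cyc _ _ _ _ w

theorem substHom_prod_cyc (hθ : ∀ j s, θ j s ≠ 0 → p' s = p j) (ws : List (List (Fin d))) :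
    substHom hθ (ws.map (cyc k p)).prod = substSum θ ws.flatten fun v =>
      (((ws.map List.length).splitLengths v).map (cyc k p')).prod := by
  induction ws with
  | nil => simp [substSum]
  | cons w ws ih =>
    rw [List.map_cons, List.prod_cons, map_mul, ih, substHom_cyc, List.flatten_cons,
      substSum_append]
    have h := map_substSum θ (LinearMap.mulRight k (substSum θ ws.flatten fun v =>
      (((ws.map List.length).splitLengths v).map (cyc k p')).prod)) w (cyc k p')
    rw [LinearMap.mulRight_apply] at h
    rw [h]
    refine substSum_congr hθ w fun v hv _ => ?_
    rw [LinearMap.mulRight_apply, ← LinearMap.mulLeft_apply (R := k), map_substSum]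
    refine substSum_congr hθ _ fun v' _ _ => ?_
    rw [LinearMap.mulLeft_apply, List.map_cons, List.splitLengths, List.splitAt_eq, ← hv]
    simp

end CyclicAlg

section Substitution

variable {k : Type u} [Field k] {d d' N : ℕ} {p : Fin d → ZMod 2} {p' : Fin d' → ZMod 2}
  {θ : Fin d → Fin d' → k}

/-- The algebra map between algebras of functions on `Hom(ΠV, q(U))` that is induced by a parity
preserving linear substitution of the basis of `ΠV`. -/
def matrixSubstHom (N : ℕ) (hθ : ∀ j s, θ j s ≠ 0 → p' s = p j) :
    MatrixAlg k p N →ₐ[k] MatrixAlg k p' N :=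
  SuperPoly.lift
    (fun x => ∑ s, θ x.2.1 s • SuperPoly.gen k (qVarPar p' N) (x.1, s, x.2.2))
    (by
      have h : ∀ x : QVar d N, ∑ s, θ x.2.1 s • SuperPoly.gen k (qVarPar p' N) (x.1, s, x.2.2) ∈
          parityPart k (SuperPoly.gen k (qVarPar p' N)) (qVarPar p' N) (qVarPar p N x) := by
        intro x
        refine Submodule.sum_mem _ fun s _ => ?_
        by_cases hs : θ x.2.1 s = 0
        · simp [hs]
        · refine Submodule.smul_mem _ _ ?_
          have := gen_mem_parityPart (k := k) (g := SuperPoly.gen k (qVarPar p' N))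
            (par := qVarPar p' N) (x.1, s, x.2.2)
          simpa [qVarPar, hθ _ s hs] using this
      exact fun x y => parityPart_comm SuperPoly.gen_swap (h x) (h y))

variable (hθ : ∀ j s, θ j s ≠ 0 → p' s = p j)

theorem matrixSubstHom_gen (x : QVar d N) :
    matrixSubstHom N hθ (SuperPoly.gen k (qVarPar p N) x) =
      ∑ s, θ x.2.1 s • SuperPoly.gen k (qVarPar p' N) (x.1, s, x.2.2) :=
  SuperPoly.lift_gen _ _ _

theorem genericMatrix_map_matrixSubstHom (j : Fin d) :
    (genericMatrix k p N j).map (matrixSubstHom N hθ) =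
      ∑ s, θ j s • genericMatrix k p' N s := by
  have h : ∀ s x, θ j s • ksgn k (p j) • (x : MatrixAlg k p' N) =
      θ j s • ksgn k (p' s) • x := by
    intro s x
    by_cases hs : θ j s = 0
    · simp [hs]
    · rw [hθ j s hs]
  ext (a | a) (b | b) <;>
    simp [genericMatrix, matrixSubstHom_gen, Matrix.sum_apply, Finset.smul_sum,
      smul_comm (ksgn k (p j)), h]

theorem matrixSubstHom_oddTraceWord [CharZero k] (w : List (Fin d)) :
    matrixSubstHom N hθ (oddTraceWord k p N w) = substSum θ w (oddTraceWord k p' N) := by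
  have h : (w.map fun i => (genericMatrix k p N i).map (matrixSubstHom N hθ)).prod =
      substSum θ w (wordMatrix k p' N) := by
    induction w with
    | nil => rfl
    | cons j w ih =>
      rw [List.map_cons, List.prod_cons, ih, genericMatrix_map_matrixSubstHom, Finset.sum_mul,
        substSum]
      refine Finset.sum_congr rfl fun s _ => ?_
      rw [smul_mul_assoc]
      congr 1
      have := map_substSum θ (LinearMap.mulLeft k (genericMatrix k p' N s)) w
        (wordMatrix k p' N)
      simpa only [LinearMap.mulLeft_apply, ← wordMatrix_cons] using this
  let T : Matrix (QIdx N) (QIdx N) (MatrixAlg k p' N) →ₗ[k] MatrixAlg k p' N :=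
    { toFun := qTrace
      map_add' := qTrace_add
      map_smul' := fun c M => by simp [qTrace, Finset.smul_sum] }
  have h2 := (isQ_list_prod (𝓡 := parityPart k (SuperPoly.gen k (qVarPar p' N)) (qVarPar p' N))
    (genericMatrix_map_isQ (φ := matrixSubstHom N hθ) (p := p) fun x => ?_) w).oddTrace_eq
  · rw [map_oddTraceWord, h2, h]
    have h3 := map_substSum θ T w (wordMatrix k p' N)
    have h4 : oddTraceWord k p' N = fun v => qTrace (wordMatrix k p' N v) :=
      funext oddTraceWord_eq_qTrace
    rw [h4]
    exact h3
  · rw [matrixSubstHom_gen]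
    refine Submodule.sum_mem _ fun s _ => ?_
    by_cases hs : θ x.2.1 s = 0
    · simp [hs]
    · refine Submodule.smul_mem _ _ ?_
      have := gen_mem_parityPart (k := k) (g := SuperPoly.gen k (qVarPar p' N))
        (par := qVarPar p' N) (x.1, s, x.2.2)
      simpa [qVarPar, hθ _ s hs] using this

/-- Substitutions of letters are compatible with the map to odd traces. -/
theorem traceMap_substHom [CharZero k] (c : k) (x : CyclicAlg k p) :
    traceMap p' N c (CyclicAlg.substHom hθ x) = matrixSubstHom N hθ (traceMap p N c x) := by
  have h : (traceMap p' N c).comp (CyclicAlg.substHom hθ) =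
      (matrixSubstHom N hθ).comp (traceMap p N c) := by
    refine CyclicAlg.algHom_ext fun w => ?_
    rw [AlgHom.comp_apply, AlgHom.comp_apply, CyclicAlg.substHom_cyc, traceMap_cyc, map_smul,
      matrixSubstHom_oddTraceWord, ← AlgHom.toLinearMap_apply, map_substSum, ← substSum_smul]
    simp only [AlgHom.toLinearMap_apply, traceMap_cyc]
  exact DFunLike.congr_fun h x

theorem IsGQInvariant.matrixSubstHom {f : MatrixAlg k p N} (hf : IsGQInvariant f) :
    IsGQInvariant (matrixSubstHom N hθ f) := by
  intro R _ _ 𝓡 _ hcomm φ ψ hφ hψ g g' hg h h' hgen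
  have hpar : ∀ φ : MatrixAlg k p' N →ₐ[k] R,
      (∀ x, φ (SuperPoly.gen k _ x) ∈ 𝓡 (qVarPar p' N x)) → ∀ x : QVar d N,
      φ.comp (_root_.matrixSubstHom N hθ) (SuperPoly.gen k _ x) ∈ 𝓡 (qVarPar p N x) := by
    intro φ hφ x
    rw [AlgHom.comp_apply, matrixSubstHom_gen, map_sum]
    refine Submodule.sum_mem _ fun s _ => ?_
    rw [map_smul]
    by_cases hs : θ x.2.1 s = 0
    · simp [hs]
    · refine Submodule.smul_mem _ _ ?_
      simpa [qVarPar, hθ _ s hs] using hφ (x.1, s, x.2.2)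
  have hmap : ∀ (φ : MatrixAlg k p' N →ₐ[k] R) (i : Fin d),
      (genericMatrix k p N i).map (φ.comp (_root_.matrixSubstHom N hθ)) =
      ∑ s, θ i s • (genericMatrix k p' N s).map φ := by
    intro φ i
    have e : (genericMatrix k p N i).map (φ.comp (_root_.matrixSubstHom N hθ)) =
      ((genericMatrix k p N i).map (_root_.matrixSubstHom N hθ)).map φ := rfl
    rw [e, genericMatrix_map_matrixSubstHom]
    ext a b
    simp [Matrix.sum_apply]
  refine hf R 𝓡 hcomm (φ.comp (_root_.matrixSubstHom N hθ)) (ψ.comp (_root_.matrixSubstHom N hθ))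
    (hpar φ hφ) (hpar ψ hψ) g g' hg h h' fun i => ?_
  rw [hmap, hmap, Finset.mul_sum, Finset.sum_mul]
  refine Finset.sum_congr rfl fun s _ => ?_
  rw [hgen, mul_smul_comm, smul_mul_assoc]

theorem substHom_mem_component {n : ℕ} {x : CyclicAlg k p} (hx : x ∈ CyclicAlg.component k p n) :
    CyclicAlg.substHom hθ x ∈ CyclicAlg.component k p' n := by
  induction hx using Submodule.span_induction with
  | mem x hx =>
    obtain ⟨ws, rfl, rfl⟩ := hx
    rw [CyclicAlg.substHom_prod_cyc]
    refine substSum_mem hθ _ fun v hv _ => ?_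
    have h := CyclicAlg.prod_cyc_mem_component (k := k) (p := p')
      ((ws.map List.length).splitLengths v)
    rwa [List.map_splitLengths_length] at h
    rw [hv, List.length_flatten]
  | zero => rw [map_zero]; exact Submodule.zero_mem _
  | add x y _ _ hx hy => rw [map_add]; exact Submodule.add_mem _ hx hy
  | smul a x _ hx => rw [map_smul]; exact Submodule.smul_mem _ _ hx

theorem matrixSubstHom_prod_ofFn {n : ℕ} (e : Fin n → ZMod 2 × Fin N × Fin N)
    (j : Fin n → Fin d) : matrixSubstHom N hθ
      (List.ofFn fun u => SuperPoly.gen k (qVarPar p N) ((e u).1, j u, (e u).2)).prod =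
    ∑ v : Fin n → Fin d', (∏ u, θ (j u) (v u)) •
      (List.ofFn fun u => SuperPoly.gen k (qVarPar p' N) ((e u).1, v u, (e u).2)).prod := by
  rw [map_list_prod, List.map_ofFn]
  simp only [Function.comp_def, matrixSubstHom_gen]
  rw [prod_ofFn_sum]
  refine Finset.sum_congr rfl fun v _ => ?_
  rw [prod_ofFn_smul]

end Substitution

/-! ### Polarization -/

section Polarization

variable {k : Type u} [Field k] {d n N : ℕ} {p : Fin d → ZMod 2}

/-- The substitution `a_j ↦ ∑ a_s`, over the positions `s ∉ U` with `i s = j`. -/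
def polarCoeff (k : Type u) [Field k] (i : Fin n → Fin d) (U : Finset (Fin n)) (j : Fin d)
    (s : Fin n) : k :=
  if i s = j ∧ s ∉ U then 1 else 0

theorem polarCoeff_parity (i : Fin n → Fin d) (U : Finset (Fin n)) (j : Fin d) (s : Fin n)
    (h : polarCoeff k i U j s ≠ 0) : (p ∘ i) s = p j := by
  unfold polarCoeff at h
  split_ifs at h with h1
  · rw [Function.comp_apply, h1.1]
  · exact absurd rfl h

/-- The substitution `a_s ↦ a_{i s}`. -/
def restitutionCoeff (k : Type u) [Field k] (i : Fin n → Fin d) (s : Fin n) (j : Fin d) : k :=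
  if i s = j then 1 else 0

theorem restitutionCoeff_parity (i : Fin n → Fin d) (s : Fin n) (j : Fin d)
    (h : restitutionCoeff k i s j ≠ 0) : p j = (p ∘ i) s := by
  unfold restitutionCoeff at h
  split_ifs at h with h1
  · rw [Function.comp_apply, h1]
  · exact absurd rfl h

theorem prod_restitutionCoeff (i : Fin n → Fin d) (v : Fin n → Fin n) (w : Fin n → Fin d) :
    ∏ u, restitutionCoeff k i (v u) (w u) = if i ∘ v = w then 1 else 0 := by
  simp only [restitutionCoeff, Finset.prod_ite_zero, Finset.prod_const_one, Finset.mem_univ,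
    true_implies, funext_iff, Function.comp_apply]

/-- The alternating sum over the sets `U` of omitted letters leaves only the words in which every
letter occurs exactly once. -/
theorem sum_neg_one_pow_prod_polarCoeff (i : Fin n → Fin d) (j : Fin n → Fin d)
    (v : Fin n → Fin n) :
    ∑ U : Finset (Fin n), (-1 : k) ^ U.card * ∏ u, polarCoeff k i U (j u) (v u) =
      if Function.Bijective v ∧ i ∘ v = j then 1 else 0 := by
  classical
  have h1 : ∀ U : Finset (Fin n), ∏ u, polarCoeff k i U (j u) (v u) =
      if i ∘ v = j ∧ U ∈ (Finset.univ.image v)ᶜ.powerset then 1 else 0 := by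
    intro U
    simp only [polarCoeff, Finset.prod_ite_zero, Finset.prod_const_one, Finset.mem_univ,
      true_implies]
    congr 1
    simp only [funext_iff, Function.comp_apply, Finset.mem_powerset, Finset.subset_iff,
      Finset.mem_compl, Finset.mem_image, Finset.mem_univ, true_and, not_exists, eq_iff_iff]
    exact ⟨fun h => ⟨fun u => (h u).1, fun x hx u hu => (h u).2 (hu ▸ hx)⟩,
      fun h u => ⟨h.1 u, fun hx => h.2 hx u rfl⟩⟩
  simp only [h1]
  by_cases hj : i ∘ v = j
  · have h2 := Finset.sum_powerset_neg_one_pow_card (x := (Finset.univ.image v)ᶜ)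
    have h3 := congrArg (Int.cast (R := k)) h2
    push_cast at h3
    simp only [hj, true_and, and_true, mul_ite, mul_one, mul_zero, Finset.sum_ite_mem,
      Finset.univ_inter, h3]
    congr 1
    rw [Finset.compl_eq_empty_iff, ← Finite.surjective_iff_bijective,
      Finset.eq_univ_iff_forall, eq_iff_iff]
    simp [Function.Surjective]
  · simp [hj]

theorem sum_ite_bijective {M : Type*} [AddCommMonoid M] (P : (Fin n → Fin n) → Prop)
    [DecidablePred P] [DecidablePred (Function.Bijective : (Fin n → Fin n) → Prop)]
    (g : (Fin n → Fin n) → M) :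
    ∑ v, (if Function.Bijective v ∧ P v then g v else 0) =
      ∑ σ : Equiv.Perm (Fin n), if P σ then g σ else 0 := by
  symm
  refine Finset.sum_of_injOn (fun σ => ⇑σ) (fun σ _ τ _ h => DFunLike.coe_injective h)
    (fun _ _ => Finset.mem_coe.mpr (Finset.mem_univ _)) ?_ ?_
  · intro v _ hv
    rw [if_neg]
    rintro ⟨h, -⟩
    exact hv ⟨Equiv.ofBijective v h, by simp, rfl⟩
  · intro σ _
    simp

variable (p) in
/-- The polarization of a cyclic word polynomial along `i`: its component that is multilinear in
new letters, of which the `s`-th one replaces the letter `i s`. -/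
noncomputable def polarCyclic (k : Type u) [Field k] (i : Fin n → Fin d) :
    CyclicAlg k p →ₗ[k] CyclicAlg k (p ∘ i) :=
  ∑ U : Finset (Fin n), (-1 : k) ^ U.card •
    (CyclicAlg.substHom (polarCoeff_parity (k := k) (p := p) i U)).toLinearMap

variable (p) in
/-- The polarization of a function on `Hom(ΠV, q(U))` along `i`. -/
noncomputable def polarMatrix (k : Type u) [Field k] (N : ℕ) (i : Fin n → Fin d) :
    MatrixAlg k p N →ₗ[k] MatrixAlg k (p ∘ i) N :=
  ∑ U : Finset (Fin n), (-1 : k) ^ U.card •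
    (matrixSubstHom N (polarCoeff_parity (k := k) (p := p) i U)).toLinearMap

theorem traceMap_polarCyclic [CharZero k] (i : Fin n → Fin d) (c : k) (x : CyclicAlg k p) :
    traceMap (p ∘ i) N c (polarCyclic p k i x) = polarMatrix p k N i (traceMap p N c x) := by
  simp [polarCyclic, polarMatrix, traceMap_substHom]

theorem IsGQInvariant.polarMatrix (i : Fin n → Fin d) {f : MatrixAlg k p N}
    (hf : IsGQInvariant f) : IsGQInvariant (polarMatrix p k N i f) := by
  simp only [_root_.polarMatrix, LinearMap.sum_apply, LinearMap.smul_apply]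
  refine Finset.sum_induction _ IsGQInvariant (fun _ _ => IsGQInvariant.add) ?_ fun U _ => ?_
  · simpa using (isGQInvariant_one (k := k) (p := p ∘ i) (N := N)).smul 0
  · exact (IsGQInvariant.matrixSubstHom _ hf).smul _

/-- The product of cyclic words of lengths `r` that has a given sequence of letters. -/
def cycProd (k : Type u) [Field k] (p : Fin d → ZMod 2) (r : List ℕ) (v : List (Fin d)) :
    CyclicAlg k p :=
  ((r.splitLengths v).map (CyclicAlg.cyc k p)).prod

theorem splitLengths_flatten {α : Type*} (ws : List (List α)) :
    (ws.map List.length).splitLengths ws.flatten = ws := by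
  induction ws with
  | nil => rfl
  | cons w ws ih => simp [ih]

theorem component_eq_span (n : ℕ) : CyclicAlg.component k p n =
    Submodule.span k {x | ∃ (r : List ℕ) (j : Fin n → Fin d), r.sum = n ∧
      x = cycProd k p r (List.ofFn j)} := by
  apply le_antisymm <;> refine Submodule.span_le.mpr ?_
  · rintro _ ⟨ws, rfl, rfl⟩
    refine Submodule.subset_span ⟨ws.map List.length,
      fun u => ws.flatten.get (u.cast (List.length_flatten).symm), rfl, ?_⟩
    have h : List.ofFn (fun u : Fin (ws.map List.length).sum =>
        ws.flatten.get (u.cast (List.length_flatten).symm)) = ws.flatten := by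
      rw [← List.ofFn_congr List.length_flatten, List.ofFn_get]
    rw [h, cycProd, splitLengths_flatten]
  · rintro _ ⟨r, j, rfl, rfl⟩
    have h := CyclicAlg.prod_cyc_mem_component (k := k) (p := p) (r.splitLengths (List.ofFn j))
    rwa [List.map_splitLengths_length _ _ (by simp)] at h

theorem power_eq_span (n : ℕ) : SuperPoly.power k (qVarPar p N) n =
    Submodule.span k {x | ∃ (e : Fin n → ZMod 2 × Fin N × Fin N) (j : Fin n → Fin d),
      x = (List.ofFn fun u => SuperPoly.gen k (qVarPar p N) ((e u).1, j u, (e u).2)).prod} := by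
  apply le_antisymm <;> refine Submodule.span_le.mpr ?_
  · rintro _ ⟨w, rfl, rfl⟩
    refine Submodule.subset_span ⟨fun u => ((w.get u).1, (w.get u).2.2),
      fun u => (w.get u).2.1, ?_⟩
    congr 1
    conv_lhs => rw [← List.ofFn_get w, List.map_ofFn]
    rfl
  · rintro _ ⟨e, j, rfl⟩
    refine Submodule.subset_span ⟨List.ofFn fun u => ((e u).1, j u, (e u).2), by simp, ?_⟩
    rw [List.map_ofFn]
    rfl

theorem substHom_cycProd {d' : ℕ} {p' : Fin d' → ZMod 2} {θ : Fin d → Fin d' → k}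
    (hθ : ∀ j s, θ j s ≠ 0 → p' s = p j) (r : List ℕ) (j : Fin n → Fin d) (hr : r.sum = n) :
    CyclicAlg.substHom hθ (cycProd k p r (List.ofFn j)) =
      ∑ v : Fin n → Fin d', (∏ u, θ (j u) (v u)) • cycProd k p' r (List.ofFn v) := by
  rw [cycProd, CyclicAlg.substHom_prod_cyc, List.flatten_splitLengths _ _ (by simp [hr]),
    List.map_splitLengths_length _ _ (by simp [hr]), substSum_ofFn]
  rfl

theorem polarCyclic_cycProd (i : Fin n → Fin d) (r : List ℕ) (j : Fin n → Fin d)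
    (hr : r.sum = n) : polarCyclic p k i (cycProd k p r (List.ofFn j)) =
      ∑ σ : Equiv.Perm (Fin n), if i ∘ σ = j then cycProd k (p ∘ i) r (List.ofFn σ) else 0 := by
  classical
  rw [← sum_ite_bijective (fun v => i ∘ v = j) fun v => cycProd k (p ∘ i) r (List.ofFn v)]
  simp only [polarCyclic, LinearMap.sum_apply, LinearMap.smul_apply, AlgHom.toLinearMap_apply,
    substHom_cycProd _ r j hr, Finset.smul_sum, smul_smul]
  rw [Finset.sum_comm]
  refine Finset.sum_congr rfl fun v _ => ?_
  rw [← Finset.sum_smul, sum_neg_one_pow_prod_polarCoeff, ite_smul, one_smul, zero_smul]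

theorem polarMatrix_prod_ofFn (i : Fin n → Fin d) (e : Fin n → ZMod 2 × Fin N × Fin N)
    (j : Fin n → Fin d) : polarMatrix p k N i
      (List.ofFn fun u => SuperPoly.gen k (qVarPar p N) ((e u).1, j u, (e u).2)).prod =
    ∑ σ : Equiv.Perm (Fin n), if i ∘ σ = j then
      (List.ofFn fun u => SuperPoly.gen k (qVarPar (p ∘ i) N) ((e u).1, σ u, (e u).2)).prod
      else 0 := by
  classical
  rw [← sum_ite_bijective (fun v => i ∘ v = j) fun v =>
    (List.ofFn fun u => SuperPoly.gen k (qVarPar (p ∘ i) N) ((e u).1, v u, (e u).2)).prod]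
  simp only [polarMatrix, LinearMap.sum_apply, LinearMap.smul_apply, AlgHom.toLinearMap_apply,
    matrixSubstHom_prod_ofFn, Finset.smul_sum, smul_smul]
  rw [Finset.sum_comm]
  refine Finset.sum_congr rfl fun v _ => ?_
  rw [← Finset.sum_smul, sum_neg_one_pow_prod_polarCoeff, ite_smul, one_smul, zero_smul]

theorem sum_sum_ite_comp {M : Type*} [AddCommMonoid M] (j : Fin n → Fin d) (m : M) :
    ∑ i : Fin n → Fin d, ∑ σ : Equiv.Perm (Fin n), (if i ∘ σ = j then m else 0) =
      n.factorial • m := by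
  rw [Finset.sum_comm]
  have h : ∀ σ : Equiv.Perm (Fin n), ∑ i : Fin n → Fin d, (if i ∘ σ = j then m else 0) = m := by
    intro σ
    have h1 : ∀ i : Fin n → Fin d, i ∘ σ = j ↔ j ∘ σ.symm = i := fun i => by
      rw [Equiv.comp_symm_eq, eq_comm]
    simp only [h1, Finset.sum_ite_eq, Finset.mem_univ, if_true]
  simp only [h, Finset.sum_const, Finset.card_univ, Fintype.card_perm, Fintype.card_fin]

/-- Polarization followed by restitution is multiplication by `n!`, on cyclic words. -/
theorem sum_restitution_polarCyclic {x : CyclicAlg k p} (hx : x ∈ CyclicAlg.component k p n) :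
    ∑ i : Fin n → Fin d, CyclicAlg.substHom (restitutionCoeff_parity (k := k) (p := p) i)
      (polarCyclic p k i x) = n.factorial • x := by
  rw [component_eq_span] at hx
  induction hx using Submodule.span_induction with
  | mem x hx =>
    obtain ⟨r, j, hr, rfl⟩ := hx
    simp only [polarCyclic_cycProd _ r j hr, map_sum]
    rw [← sum_sum_ite_comp j]
    refine Finset.sum_congr rfl fun i _ => Finset.sum_congr rfl fun σ _ => ?_
    split_ifs with h
    · rw [substHom_cycProd _ r _ hr]
      simp [prod_restitutionCoeff, h]
    · rw [map_zero]
  | zero => simp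
  | add x y _ _ hx hy => simp only [map_add, Finset.sum_add_distrib, hx, hy, smul_add]
  | smul a x _ hx => simp only [map_smul, ← Finset.smul_sum, hx, smul_comm a]

/-- Polarization followed by restitution is multiplication by `n!`, on functions. -/
theorem sum_restitution_polarMatrix {f : MatrixAlg k p N}
    (hf : f ∈ SuperPoly.power k (qVarPar p N) n) :
    ∑ i : Fin n → Fin d, matrixSubstHom N (restitutionCoeff_parity (k := k) (p := p) i)
      (polarMatrix p k N i f) = n.factorial • f := by
  rw [power_eq_span] at hf
  induction hf using Submodule.span_induction with
  | mem f hf =>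
    obtain ⟨e, j, rfl⟩ := hf
    simp only [polarMatrix_prod_ofFn, map_sum]
    rw [← sum_sum_ite_comp j]
    refine Finset.sum_congr rfl fun i _ => Finset.sum_congr rfl fun σ _ => ?_
    split_ifs with h
    · rw [matrixSubstHom_prod_ofFn]
      simp [prod_restitutionCoeff, h]
    · rw [map_zero]
  | zero => simp
  | add x y _ _ hx hy => simp only [map_add, Finset.sum_add_distrib, hx, hy, smul_add]
  | smul a x _ hx => simp only [map_smul, ← Finset.smul_sum, hx, smul_comm a]

/-- The span of the products of cyclic words in which each of `n` letters occurs once. -/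
def multilinearCyclic (k : Type u) [Field k] (q : Fin n → ZMod 2) : Submodule k (CyclicAlg k q) :=
  Submodule.span k {x | ∃ ws : List (List (Fin n)), ws.flatten.Perm (List.finRange n) ∧
    x = (ws.map (CyclicAlg.cyc k q)).prod}

/-- The function on `Hom(ΠV, q(U))`, multilinear in the images of the `n` basis vectors of `ΠV`,
with given coefficients. -/
noncomputable def multilinearMatrix {q : Fin n → ZMod 2} :
    ((Fin n → ZMod 2 × Fin N × Fin N) → k) →ₗ[k] MatrixAlg k q N :=
  Fintype.linearCombination k fun e : Fin n → ZMod 2 × Fin N × Fin N =>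
    (List.ofFn fun s => SuperPoly.gen k (qVarPar q N) ((e s).1, s, (e s).2)).prod

theorem multilinearMatrix_apply {q : Fin n → ZMod 2}
    (F : (Fin n → ZMod 2 × Fin N × Fin N) → k) :
    multilinearMatrix (q := q) F = ∑ e, F e •
      (List.ofFn fun s => SuperPoly.gen k (qVarPar q N) ((e s).1, s, (e s).2)).prod :=
  Fintype.linearCombination_apply _ _ _

theorem polarCyclic_mem (i : Fin n → Fin d) {x : CyclicAlg k p}
    (hx : x ∈ CyclicAlg.component k p n) :
    polarCyclic p k i x ∈ multilinearCyclic k (p ∘ i) := by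
  rw [component_eq_span] at hx
  induction hx using Submodule.span_induction with
  | mem x hx =>
    obtain ⟨r, j, hr, rfl⟩ := hx
    rw [polarCyclic_cycProd _ r j hr]
    refine Submodule.sum_mem _ fun σ _ => ?_
    split_ifs with h
    · refine Submodule.subset_span ⟨r.splitLengths (List.ofFn σ), ?_, rfl⟩
      rw [List.flatten_splitLengths _ _ (by simp [hr])]
      exact List.ofFn_eq_map (f := σ) ▸ by
        refine (List.perm_ext_iff_of_nodup ?_ (List.nodup_finRange n)).mpr fun a => ?_
        · exact (List.nodup_finRange n).map σ.injective
        · simp only [List.mem_map, List.mem_finRange, true_and, iff_true]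
          exact σ.surjective a
    · exact Submodule.zero_mem _
  | zero => simp
  | add x y _ _ hx hy => rw [map_add]; exact Submodule.add_mem _ hx hy
  | smul a x _ hx => rw [map_smul]; exact Submodule.smul_mem _ _ hx

theorem polarMatrix_mem (i : Fin n → Fin d) {f : MatrixAlg k p N}
    (hf : f ∈ SuperPoly.power k (qVarPar p N) n) :
    polarMatrix p k N i f ∈ LinearMap.range (multilinearMatrix (k := k) (q := p ∘ i) (N := N)) := by
  rw [power_eq_span] at hf
  induction hf using Submodule.span_induction with
  | mem x hx =>
    obtain ⟨e, j, rfl⟩ := hx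
    rw [polarMatrix_prod_ofFn]
    refine Submodule.sum_mem _ fun σ _ => ?_
    split_ifs with h
    · -- reordering the factors by the letters costs a sign
      obtain ⟨z, hz⟩ := SuperPoly.exists_ksgn_of_perm (k := k) (par := qVarPar (p ∘ i) N)
        (l := List.ofFn fun u => ((e u).1, σ u, (e u).2))
        (l' := List.ofFn fun s => ((e (σ.symm s)).1, s, (e (σ.symm s)).2)) (by
          have := Equiv.Perm.ofFn_comp_perm σ
            (fun s => ((e (σ.symm s)).1, s, (e (σ.symm s)).2))
          simpa [Function.comp_def] using this)
      rw [List.map_ofFn, List.map_ofFn] at hz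
      change (List.ofFn fun u => SuperPoly.gen k (qVarPar (p ∘ i) N)
        ((e u).1, σ u, (e u).2)).prod = ksgn k z • (List.ofFn fun s => SuperPoly.gen k
        (qVarPar (p ∘ i) N) ((e (σ.symm s)).1, s, (e (σ.symm s)).2)).prod at hz
      rw [hz]
      refine Submodule.smul_mem _ _ ⟨Pi.single (fun s => e (σ.symm s)) 1, ?_⟩
      rw [multilinearMatrix_apply, Finset.sum_eq_single fun s => e (σ.symm s)]
      · simp
      · intro e' _ he
        simp [he]
      · simp
    · exact Submodule.zero_mem _
  | zero => simp
  | add x y _ _ hx hy => rw [map_add]; exact Submodule.add_mem _ hx hy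
  | smul a x _ hx => rw [map_smul]; exact Submodule.smul_mem _ _ hx

theorem multilinearCyclic_le (q : Fin n → ZMod 2) :
    multilinearCyclic k q ≤ CyclicAlg.component k q n := by
  refine Submodule.span_le.mpr ?_
  rintro _ ⟨ws, hws, rfl⟩
  have h := CyclicAlg.prod_cyc_mem_component (k := k) (p := q) ws
  have h2 := hws.length_eq
  rw [List.length_flatten, List.length_finRange] at h2
  rwa [h2] at h

/-- It suffices to identify multilinear polynomials in cyclic words with multilinear invariants. -/
theorem bijOn_traceMap_of_multilinear [CharZero k] (p : Fin d → ZMod 2) (c : k)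
    (hinj : ∀ (q : Fin n → ZMod 2), ∀ x ∈ multilinearCyclic k q, traceMap q N c x = 0 → x = 0)
    (hsurj : ∀ (q : Fin n → ZMod 2) (F : (Fin n → ZMod 2 × Fin N × Fin N) → k),
      IsGQInvariant (multilinearMatrix (q := q) F) →
      ∃ x ∈ multilinearCyclic k q, traceMap q N c x = multilinearMatrix F) :
    Set.BijOn (traceMap p N c) (CyclicAlg.component k p n) (gqInvariants k p N n) := by
  have hn : (n.factorial : k) ≠ 0 := Nat.cast_ne_zero.mpr n.factorial_ne_zero
  refine ⟨fun x hx => traceMap_mem_gqInvariants c hx, ?_, ?_⟩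
  · intro x hx y hy hxy
    have hz : x - y ∈ CyclicAlg.component k p n := Submodule.sub_mem _ hx hy
    have h0 : traceMap p N c (x - y) = 0 := by rw [map_sub, hxy, sub_self]
    have h1 := sum_restitution_polarCyclic hz
    have h2 : ∀ i : Fin n → Fin d, polarCyclic p k i (x - y) = 0 := fun i =>
      hinj _ _ (polarCyclic_mem i hz) (by rw [traceMap_polarCyclic, h0, map_zero])
    simp only [h2, map_zero, Finset.sum_const_zero] at h1
    rw [← Nat.cast_smul_eq_nsmul k] at h1
    exact sub_eq_zero.mp ((smul_eq_zero.mp h1.symm).resolve_left hn)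
  · rintro f ⟨hf, hinv⟩
    have h1 := sum_restitution_polarMatrix hf
    have h2 : ∀ i : Fin n → Fin d, ∃ x ∈ multilinearCyclic k (p ∘ i),
        traceMap (p ∘ i) N c x = polarMatrix p k N i f := by
      intro i
      obtain ⟨F, hF⟩ := polarMatrix_mem i hf
      have h3 := hinv.polarMatrix i
      rw [← hF] at h3 ⊢
      exact hsurj _ F h3
    choose x hx hx' using h2
    refine ⟨(n.factorial : k)⁻¹ • ∑ i, CyclicAlg.substHom
      (restitutionCoeff_parity (k := k) (p := p) i) (x i), ?_, ?_⟩
    · exact Submodule.smul_mem _ _ (Submodule.sum_mem _ fun i _ =>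
        substHom_mem_component _ (multilinearCyclic_le _ (hx i)))
    · simp only [map_smul, map_sum, traceMap_substHom, hx']
      rw [h1, ← Nat.cast_smul_eq_nsmul k, smul_smul, inv_mul_cancel₀ hn, one_smul]

end Polarization

/-! ### Multilinear functions at elementary points -/

section Elementary

variable {k : Type u} [Field k] {n N : ℕ} {q : Fin n → ZMod 2}

/-- The index of a basis vector of `U = k^{N|N}` of parity `z`. -/
def qIdx (z : ZMod 2) (a : Fin N) : QIdx N := if z = 0 then Sum.inl a else Sum.inr a

/-- The elementary element `r E_{ab}` of `q(U) ⊗ R` of parity `e`, with `r` in the block `X` for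
`z = 0` and in the block `Y` for `z = 1`. -/
def qSingle (k : Type u) [Field k] {R : Type v} [Ring R] [Algebra k R] (e z : ZMod 2)
    (a b : Fin N) (r : R) : Matrix (QIdx N) (QIdx N) R :=
  if z = 0 then Matrix.fromBlocks (Matrix.single a b r) 0 0 (ksgn k e • Matrix.single a b r)
  else Matrix.fromBlocks 0 (Matrix.single a b r) (ksgn k e • Matrix.single a b r) 0

section

variable {R : Type v} [Ring R] [Algebra k R] {𝓡 : ZMod 2 → Submodule k R}

theorem zmod_two_cases (z : ZMod 2) : z = 0 ∨ z = 1 := by revert z; decide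

theorem qSingle_apply (e z : ZMod 2) (a b : Fin N) (r : R) (x y : ZMod 2) (a' b' : Fin N) :
    qSingle k e z a b r (qIdx x a') (qIdx y b') =
      if a = a' ∧ b = b' ∧ y = x + z then ksgn k (x * e) • r else 0 := by
  have h3 : (1 : ZMod 2) + 1 = 0 := by decide
  rcases zmod_two_cases z with rfl | rfl <;> rcases zmod_two_cases x with rfl | rfl <;>
    rcases zmod_two_cases y with rfl | rfl <;>
    simp [qSingle, qIdx, Matrix.single_apply, ksgn_zero, h3]

theorem isQ_qSingle {e z : ZMod 2} {r : R} (hr : r ∈ 𝓡 (e + z)) (a b : Fin N) :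
    IsQ 𝓡 e (qSingle k e z a b r) := by
  have h3 : (1 : ZMod 2) + 1 = 0 := by decide
  have h4 : e + 1 + 1 = e := by rw [add_assoc, h3, add_zero]
  refine ⟨?_, ?_⟩
  · rcases zmod_two_cases z with rfl | rfl <;> rintro (a' | a') (b' | b') <;>
      simp only [qSingle, if_true, one_ne_zero, if_false, Matrix.fromBlocks_apply₁₁,
        Matrix.fromBlocks_apply₁₂, Matrix.fromBlocks_apply₂₁, Matrix.fromBlocks_apply₂₂,
        Matrix.smul_apply, Matrix.single_apply, Matrix.zero_apply, qIdxPar, Sum.elim_inl,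
        Sum.elim_inr, add_zero, h4, zero_mem] at hr ⊢ <;>
      split_ifs <;> simp [hr, Submodule.smul_mem]
  · rcases zmod_two_cases z with rfl | rfl <;> ext (a' | a') (b' | b') <;>
      simp [qSingle, mul_oddInv_apply, oddInv_mul_apply, smul_smul, ksgn_mul_self,
        -Matrix.smul_single]

omit [Ring R] in
theorem qEntry_eq (M : Matrix (QIdx N) (QIdx N) R) (z : ZMod 2) (a b : Fin N) :
    qEntry M z a b = M (qIdx 0 a) (qIdx z b) := by
  rcases zmod_two_cases z with rfl | rfl <;> simp [qEntry, qIdx]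

theorem qEntry_qSingle (e z : ZMod 2) (a b : Fin N) (r : R) (y : ZMod 2) (a' b' : Fin N) :
    qEntry (qSingle k e z a b r) y a' b' = if a = a' ∧ b = b' ∧ y = z then r else 0 := by
  rw [qEntry_eq, qSingle_apply, zero_add, zero_mul, ksgn_zero, one_smul]

end

section

variable {R : Type v} [Ring R] [Algebra k R] {𝓡 : ZMod 2 → Submodule k R}
  {X Y : Matrix (Fin N) (Fin N) R}

theorem isQ_fromBlocks (hX : ∀ a b, X a b ∈ 𝓡 0) (hY : ∀ a b, Y a b ∈ 𝓡 1) :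
    IsQ 𝓡 0 (Matrix.fromBlocks X Y Y X) := by
  have e : (0 : ZMod 2) + 1 + 1 = 0 := by decide
  refine ⟨?_, ?_⟩
  · rintro (a | a) (b | b) <;>
      simp only [Matrix.fromBlocks_apply₁₁, Matrix.fromBlocks_apply₁₂, Matrix.fromBlocks_apply₂₁,
        Matrix.fromBlocks_apply₂₂, qIdxPar, Sum.elim_inl, Sum.elim_inr, e, add_zero] <;>
      first | exact hX a b | simpa using hY a b
  · ext (a | a) (b | b) <;> simp [mul_oddInv_apply, oddInv_mul_apply, ksgn_zero]

theorem qEntry_fromBlocks_mul_qSingle (e z : ZMod 2) (a b : Fin N) (r : R) (y : ZMod 2)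
    (a' b' : Fin N) : qEntry (Matrix.fromBlocks X Y Y X * qSingle k e z a b r) y a' b' =
      if b = b' then (if y = z then X a' a * r else Y a' a * ksgn k e • r) else 0 := by
  rw [qEntry_eq, Matrix.mul_apply, Fintype.sum_sum_type]
  have h0 : ∀ c : Fin N, (Sum.inl c : QIdx N) = qIdx 0 c := fun c => by simp [qIdx]
  have h1 : ∀ c : Fin N, (Sum.inr c : QIdx N) = qIdx 1 c := fun c => by simp [qIdx]
  have hX : ∀ c, Matrix.fromBlocks X Y Y X (qIdx 0 a') (Sum.inl c) = X a' c := fun c => by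
    simp [qIdx]
  have hY : ∀ c, Matrix.fromBlocks X Y Y X (qIdx 0 a') (Sum.inr c) = Y a' c := fun c => by
    simp [qIdx]
  simp only [hX, hY]
  simp only [h0, h1, qSingle_apply]
  rw [Finset.sum_eq_single a, Finset.sum_eq_single a]
  · by_cases hb : b = b'
    · rcases zmod_two_cases z with rfl | rfl <;> rcases zmod_two_cases y with rfl | rfl <;>
        simp [hb, ksgn_zero, CharTwo.add_self_eq_zero]
    · simp [hb]
  all_goals simp +contextual [eq_comm]

theorem qEntry_qSingle_mul_fromBlocks (e z : ZMod 2) (a b : Fin N) (r : R) (y : ZMod 2)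
    (a' b' : Fin N) : qEntry (qSingle k e z a b r * Matrix.fromBlocks X Y Y X) y a' b' =
      if a = a' then (if y = z then r * X b b' else r * Y b b') else 0 := by
  rw [qEntry_eq, Matrix.mul_apply, Fintype.sum_sum_type]
  have h0 : ∀ c : Fin N, (Sum.inl c : QIdx N) = qIdx 0 c := fun c => by simp [qIdx]
  have h1 : ∀ c : Fin N, (Sum.inr c : QIdx N) = qIdx 1 c := fun c => by simp [qIdx]
  simp only [h0, h1, qSingle_apply]
  rw [Finset.sum_eq_single b, Finset.sum_eq_single b]
  · by_cases ha : a = a'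
    · rcases zmod_two_cases z with rfl | rfl <;> rcases zmod_two_cases y with rfl | rfl <;>
        simp [ha, ksgn_zero, qIdx]
    · simp [ha]
  all_goals simp +contextual [eq_comm]

end

theorem matrixPoint_multilinearMatrix {R : Type u} [Ring R] [Algebra k R]
    {𝓡 : ZMod 2 → Submodule k R}
    (hcomm : ∀ i j, ∀ a ∈ 𝓡 i, ∀ b ∈ 𝓡 j, a * b = ksgn k (i * j) • (b * a))
    (M : Fin n → Matrix (QIdx N) (QIdx N) R) (hM : ∀ i, IsQ 𝓡 (q i) (M i))
    (F : (Fin n → ZMod 2 × Fin N × Fin N) → k) :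
    matrixPoint hcomm M hM (multilinearMatrix F) =
      ∑ e, F e • (List.ofFn fun s => qEntry (M s) (e s).1 (e s).2.1 (e s).2.2).prod := by
  simp only [multilinearMatrix_apply, map_sum, map_smul, map_list_prod, List.map_ofFn,
    Function.comp_def, matrixPoint_gen]

/-- Parities of the parameters of a family of elementary elements of `q(U)` of types `ε`: the
parameter `some s` of the `s`-th element, and an additional odd parameter `none`. -/
def paramPar (q ε : Fin n → ZMod 2) : Option (Fin n) → ZMod 2
  | none => 1
  | some s => q s + ε s

/-- The algebra of the parameters of a family of elementary elements of `q(U)`. -/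
abbrev ParamAlg (k : Type u) [Field k] (q ε : Fin n → ZMod 2) : Type u :=
  SuperPoly k (paramPar q ε)

/-- The parameter of the `s`-th elementary element. -/
def param (k : Type u) [Field k] (q ε : Fin n → ZMod 2) (s : Fin n) : ParamAlg k q ε :=
  SuperPoly.gen k (paramPar q ε) (some s)

/-- The additional odd parameter. -/
def oddParam (k : Type u) [Field k] (q ε : Fin n → ZMod 2) : ParamAlg k q ε :=
  SuperPoly.gen k (paramPar q ε) none

variable {ε : Fin n → ZMod 2}

theorem param_mem (s : Fin n) : param k q ε s ∈
    parityPart k (SuperPoly.gen k (paramPar q ε)) (paramPar q ε) (q s + ε s) :=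
  gen_mem_parityPart (some s)

theorem oddParam_mem : oddParam k q ε ∈
    parityPart k (SuperPoly.gen k (paramPar q ε)) (paramPar q ε) 1 :=
  gen_mem_parityPart none

theorem oddParam_mul_self [CharZero k] : oddParam k q ε * oddParam k q ε = 0 := by
  have h := SuperPoly.graded_comm _ _ _ (oddParam_mem (k := k) (q := q) (ε := ε)) _ oddParam_mem
  rw [mul_one, ksgn_one, neg_one_smul] at h
  have h2 : (2 : k) • (oddParam k q ε * oddParam k q ε) = 0 := by
    rw [two_smul]; nth_rewrite 1 [h]; exact neg_add_cancel _
  exact (smul_eq_zero.mp h2).resolve_left two_ne_zero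

theorem prod_param_ne_zero : (List.ofFn (param k q ε)).prod ≠ 0 := by
  have h := SuperPoly.prod_ne_zero (k := k) (par := paramPar q ε)
    ((List.finRange n).map some) ((List.nodup_finRange n).map (Option.some_injective _))
  rwa [List.map_map, ← List.ofFn_eq_map] at h

theorem oddParam_mul_prod_param_ne_zero :
    oddParam k q ε * (List.ofFn (param k q ε)).prod ≠ 0 := by
  have h := SuperPoly.prod_ne_zero (k := k) (par := paramPar q ε)
    (none :: (List.finRange n).map some) (by
      rw [List.nodup_cons]
      exact ⟨by simp, (List.nodup_finRange n).map (Option.some_injective _)⟩)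
  rwa [List.map_cons, List.prod_cons, List.map_map, ← List.ofFn_eq_map] at h

/-- The family of elementary elements of `q(U)` of given types and positions, with independent
parameters. -/
def elementary (k : Type u) [Field k] (q ε : Fin n → ZMod 2) (α β : Fin n → Fin N) (s : Fin n) :
    Matrix (QIdx N) (QIdx N) (ParamAlg k q ε) :=
  qSingle k (q s) (ε s) (α s) (β s) (param k q ε s)

theorem isQ_elementary (α β : Fin n → Fin N) (s : Fin n) :
    IsQ (parityPart k (SuperPoly.gen k (paramPar q ε)) (paramPar q ε)) (q s)
      (elementary k q ε α β s) :=
  isQ_qSingle (param_mem s) _ _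

/-- Evaluation at an elementary point extracts a coefficient. -/
theorem matrixPoint_elementary (α β : Fin n → Fin N)
    (F : (Fin n → ZMod 2 × Fin N × Fin N) → k) :
    matrixPoint SuperPoly.graded_comm (elementary k q ε α β) (isQ_elementary α β)
      (multilinearMatrix F) =
      F (fun s => (ε s, α s, β s)) • (List.ofFn (param k q ε)).prod := by
  rw [matrixPoint_multilinearMatrix, Finset.sum_eq_single fun s => (ε s, α s, β s)]
  · simp [elementary, qEntry_qSingle]
  · intro e _ he
    obtain ⟨s, hs⟩ := Function.ne_iff.mp he
    rw [List.prod_eq_zero, smul_zero]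
    rw [List.mem_ofFn]
    refine ⟨s, ?_⟩
    rw [elementary, qEntry_qSingle, if_neg]
    rintro ⟨h1, h2, h3⟩
    exact hs (by rw [h1, h2, ← h3])
  · simp

/-! ### Invariance under even elements -/

/-- The coefficient of the `s`-th parameter in the entry `x` of `G M_s`. -/
def leftCoeff (ε : Fin n → ZMod 2) (α β : Fin n → Fin N) (G : Matrix (Fin N) (Fin N) k)
    (s : Fin n) (x : ZMod 2 × Fin N × Fin N) : k :=
  if x.1 = ε s ∧ x.2.2 = β s then G x.2.1 (α s) else 0

/-- The coefficient of the `s`-th parameter in the entry `x` of `M_s G`. -/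
def rightCoeff (ε : Fin n → ZMod 2) (α β : Fin n → Fin N) (G : Matrix (Fin N) (Fin N) k)
    (s : Fin n) (x : ZMod 2 × Fin N × Fin N) : k :=
  if x.1 = ε s ∧ x.2.1 = α s then G (β s) x.2.2 else 0

variable {F : (Fin n → ZMod 2 × Fin N × Fin N) → k}

/-- Multiplying an elementary point by an even element of `q(U)` keeps the parities. -/
theorem isQ_mul_elementary {g : Matrix (QIdx N) (QIdx N) (ParamAlg k q ε)}
    (hg : IsQ (parityPart k (SuperPoly.gen k (paramPar q ε)) (paramPar q ε)) 0 g)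
    (α β : Fin n → Fin N) (s : Fin n) :
    IsQ (parityPart k (SuperPoly.gen k (paramPar q ε)) (paramPar q ε)) (q s)
      (g * elementary k q ε α β s) ∧
    IsQ (parityPart k (SuperPoly.gen k (paramPar q ε)) (paramPar q ε)) (q s)
      (elementary k q ε α β s * g) := by
  have hmul : ∀ (i j : ZMod 2) (x y : ParamAlg k q ε),
      x ∈ parityPart k (SuperPoly.gen k (paramPar q ε)) (paramPar q ε) i →
      y ∈ parityPart k (SuperPoly.gen k (paramPar q ε)) (paramPar q ε) j →
      x * y ∈ parityPart k (SuperPoly.gen k (paramPar q ε)) (paramPar q ε) (i + j) :=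
    fun i j x y hx hy => mul_mem_parityPart hx hy
  exact ⟨by simpa using IsQ.mul hmul hg (isQ_elementary α β s),
    by simpa using IsQ.mul hmul (isQ_elementary α β s) hg⟩

/-- Invariance of a multilinear function, evaluated at an elementary point. -/
theorem sum_prod_qEntry_eq (hF : IsGQInvariant (multilinearMatrix (q := q) F))
    {g g' : Matrix (QIdx N) (QIdx N) (ParamAlg k q ε)}
    (hg : IsQ (parityPart k (SuperPoly.gen k (paramPar q ε)) (paramPar q ε)) 0 g)
    (h : g * g' = 1) (h' : g' * g = 1) (α β : Fin n → Fin N) :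
    ∑ e, F e • (List.ofFn fun s =>
      qEntry (g * elementary k q ε α β s) (e s).1 (e s).2.1 (e s).2.2).prod =
    ∑ e, F e • (List.ofFn fun s =>
      qEntry (elementary k q ε α β s * g) (e s).1 (e s).2.1 (e s).2.2).prod := by
  have key := hF.matrixPoint_mul SuperPoly.graded_comm hg h h'
    (fun s => (isQ_mul_elementary hg α β s).1) (fun s => (isQ_mul_elementary hg α β s).2)
  rwa [matrixPoint_multilinearMatrix, matrixPoint_multilinearMatrix] at key

theorem sum_leftCoeff_eq_of_isUnit
    (hF : IsGQInvariant (multilinearMatrix (q := q) F)) (ε : Fin n → ZMod 2)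
    (α β : Fin n → Fin N) {G : Matrix (Fin N) (Fin N) k} (hG : IsUnit G.det) :
    ∑ e, F e * ∏ s, leftCoeff ε α β G s (e s) = ∑ e, F e * ∏ s, rightCoeff ε α β G s (e s) := by
  have h1 : ∀ c : k, algebraMap k (ParamAlg k q ε) c ∈
      parityPart k (SuperPoly.gen k (paramPar q ε)) (paramPar q ε) 0 := fun c => by
    rw [Algebra.algebraMap_eq_smul_one]; exact Submodule.smul_mem _ _ one_mem_parityPart
  have hm : ∀ H H' : Matrix (Fin N) (Fin N) k, H * H' = 1 →
      Matrix.fromBlocks (H.map (algebraMap k (ParamAlg k q ε))) 0 0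
        (H.map (algebraMap k (ParamAlg k q ε))) *
      Matrix.fromBlocks (H'.map (algebraMap k (ParamAlg k q ε))) 0 0
        (H'.map (algebraMap k (ParamAlg k q ε))) = 1 := by
    intro H H' h
    rw [Matrix.fromBlocks_multiply]
    simp only [Matrix.mul_zero, Matrix.zero_mul, add_zero, zero_add, ← Matrix.map_mul, h]
    rw [Matrix.map_one _ (map_zero _) (map_one _), Matrix.fromBlocks_one]
  have key := sum_prod_qEntry_eq hF (ε := ε)
    (isQ_fromBlocks (X := G.map (algebraMap k (ParamAlg k q ε))) (Y := 0)
      (fun a b => h1 (G a b)) fun a b => Submodule.zero_mem _)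
    (hm G G⁻¹ (Matrix.mul_nonsing_inv _ hG)) (hm G⁻¹ G (Matrix.nonsing_inv_mul _ hG)) α β
  have e1 : ∀ s z a b, qEntry (Matrix.fromBlocks (G.map (algebraMap k (ParamAlg k q ε))) 0 0
      (G.map (algebraMap k (ParamAlg k q ε))) * elementary k q ε α β s) z a b =
      leftCoeff ε α β G s (z, a, b) • param k q ε s := by
    intro s z a b
    rw [elementary, qEntry_fromBlocks_mul_qSingle, leftCoeff]
    by_cases h1 : z = ε s <;> by_cases h2 : β s = b <;>
      simp [h1, h2, eq_comm (a := b), Algebra.smul_def]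
  have e2 : ∀ s z a b, qEntry (elementary k q ε α β s *
      Matrix.fromBlocks (G.map (algebraMap k (ParamAlg k q ε))) 0 0
      (G.map (algebraMap k (ParamAlg k q ε)))) z a b =
      rightCoeff ε α β G s (z, a, b) • param k q ε s := by
    intro s z a b
    rw [elementary, qEntry_qSingle_mul_fromBlocks, rightCoeff]
    by_cases h1 : z = ε s <;> by_cases h2 : α s = a <;>
      simp [h1, h2, eq_comm (a := a), Algebra.smul_def, Algebra.commutes]
  simp only [e1, e2, Prod.mk.eta, prod_ofFn_smul, smul_smul, ← Finset.sum_smul] at key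
  exact smul_left_injective k prod_param_ne_zero key

/-- The identity of `sum_leftCoeff_eq_of_isUnit` is polynomial in the matrix, and hence holds for
singular matrices as well. -/
theorem sum_leftCoeff_eq [CharZero k]
    (hF : IsGQInvariant (multilinearMatrix (q := q) F)) (ε : Fin n → ZMod 2)
    (α β : Fin n → Fin N) (G : Matrix (Fin N) (Fin N) k) :
    ∑ e, F e * ∏ s, leftCoeff ε α β G s (e s) = ∑ e, F e * ∏ s, rightCoeff ε α β G s (e s) := by
  open Polynomial in
  -- for `t + G`, both sides are polynomials in `t`, and agree where `t + G` is invertible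
  let H : Matrix (Fin N) (Fin N) k[X] := Matrix.scalar (Fin N) X - (-G).map C
  let P : k[X] := ∑ e, C (F e) *
    ∏ s, if (e s).1 = ε s ∧ (e s).2.2 = β s then H (e s).2.1 (α s) else 0
  let Q : k[X] := ∑ e, C (F e) *
    ∏ s, if (e s).1 = ε s ∧ (e s).2.1 = α s then H (β s) (e s).2.2 else 0
  have hH : ∀ (t : k) a b, (H a b).eval t = (Matrix.scalar (Fin N) t - -G) a b := by
    intro t a b
    by_cases hab : a = b
    · subst hab; simp [H]
    · simp [H, hab]
  have hP : ∀ t, P.eval t =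
      ∑ e, F e * ∏ s, leftCoeff ε α β (Matrix.scalar (Fin N) t - -G) s (e s) := by
    intro t
    simp only [P, Polynomial.eval_finsetSum, Polynomial.eval_mul, Polynomial.eval_C,
      Polynomial.eval_prod, apply_ite (Polynomial.eval t), Polynomial.eval_zero, hH, leftCoeff]
  have hQ : ∀ t, Q.eval t =
      ∑ e, F e * ∏ s, rightCoeff ε α β (Matrix.scalar (Fin N) t - -G) s (e s) := by
    intro t
    simp only [Q, Polynomial.eval_finsetSum, Polynomial.eval_mul, Polynomial.eval_C,
      Polynomial.eval_prod, apply_ite (Polynomial.eval t), Polynomial.eval_zero, hH, rightCoeff]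
  have hdet : (P - Q) * (-G).charpoly = 0 := by
    refine Polynomial.funext fun t => ?_
    rw [Polynomial.eval_mul, Polynomial.eval_zero, Matrix.eval_charpoly]
    by_cases h : (Matrix.scalar (Fin N) t - -G).det = 0
    · rw [h, mul_zero]
    · rw [Polynomial.eval_sub, hP, hQ,
        sum_leftCoeff_eq_of_isUnit hF ε α β (isUnit_iff_ne_zero.mpr h), sub_self, zero_mul]
  have h0 := (mul_eq_zero.mp hdet).resolve_right (Matrix.charpoly_monic _).ne_zero
  have h1 : P.eval 0 = Q.eval 0 := by rw [sub_eq_zero.mp h0]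
  rw [hP, hQ] at h1
  simpa using h1

end Elementary

section Vanishing

variable {k : Type u} [Field k] [CharZero k] {n N : ℕ} {q : Fin n → ZMod 2}
  {F : (Fin n → ZMod 2 × Fin N × Fin N) → k}

omit [CharZero k] in
theorem sum_mul_prod_indicator (c : Fin n → ZMod 2 × Fin N × Fin N → k)
    (e₀ : Fin n → ZMod 2 × Fin N × Fin N) (hc : ∀ s x, c s x = if x = e₀ s then 1 else 0) :
    ∑ e, F e * ∏ s, c s (e s) = F e₀ := by
  rw [Finset.sum_eq_single e₀]
  · simp [hc]
  · intro e _ he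
    obtain ⟨s, hs⟩ := Function.ne_iff.mp he
    rw [Finset.prod_eq_zero (Finset.mem_univ s) (by rw [hc, if_neg hs]), mul_zero]
  · simp

/-- An invariant multilinear function is determined by its coefficients with row indices
`1, …, n`: letting a matrix act that sends these indices to prescribed ones produces all the
other coefficients. -/
theorem eq_zero_of_standard_rows (hF : IsGQInvariant (multilinearMatrix (q := q) F))
    {ι : Fin n → Fin N} (hι : Function.Injective ι)
    (h : ∀ (ε : Fin n → ZMod 2) (β : Fin n → Fin N), F (fun s => (ε s, ι s, β s)) = 0) : F = 0 := by
  classical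
  funext e₀
  -- the matrix sends the basis vector of index `ι s` to the one of index `(e₀ s).2.1`
  have key := sum_leftCoeff_eq hF (fun s => (e₀ s).1) ι (fun s => (e₀ s).2.2)
    (fun a c => if ∃ s, c = ι s ∧ a = (e₀ s).2.1 then 1 else 0)
  rw [sum_mul_prod_indicator _ e₀] at key
  · rw [key, Pi.zero_apply]
    refine Finset.sum_eq_zero fun e _ => ?_
    by_cases he : ∀ s, (e s).2.1 = ι s
    · have : e = fun s => ((e s).1, ι s, (e s).2.2) := by
        funext s; rw [← he s]
      rw [this, h, zero_mul]
    · push Not at he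
      obtain ⟨s, hs⟩ := he
      rw [Finset.prod_eq_zero (Finset.mem_univ s), mul_zero]
      exact if_neg fun h => hs h.2
  · rintro s ⟨z, a, b⟩
    have : (∃ s', ι s = ι s' ∧ a = (e₀ s').2.1) ↔ a = (e₀ s).2.1 :=
      ⟨fun ⟨s', h1, h2⟩ => by rw [h2, hι h1], fun h => ⟨s, rfl, h⟩⟩
    simp only [leftCoeff, this]
    rcases e₀ s with ⟨z', a', b'⟩
    simp only [Prod.mk.injEq]
    split_ifs <;> simp_all

/-- The torus of diagonal matrices forces the row and the column indices of a nonvanishing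
coefficient of an invariant to agree up to a permutation. -/
theorem exists_perm_of_ne_zero (hF : IsGQInvariant (multilinearMatrix (q := q) F))
    {ι : Fin n → Fin N} (hι : Function.Injective ι) {ε : Fin n → ZMod 2} {β : Fin n → Fin N}
    (h : F (fun s => (ε s, ι s, β s)) ≠ 0) :
    ∃ σ : Equiv.Perm (Fin n), β = fun s => ι (σ s) := by
  classical
  have hβ : ∀ s, ∃ u, β u = ι s := by
    intro s
    by_contra! hs
    -- the projection along the basis vector of index `ι s`
    have key := sum_leftCoeff_eq hF ε ι β (Matrix.diagonal fun c => if c = ι s then 0 else 1)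
    refine h ?_
    rw [sum_mul_prod_indicator (rightCoeff ε ι β _) (fun s => (ε s, ι s, β s))] at key
    · rw [← key]
      refine Finset.sum_eq_zero fun e _ => ?_
      rw [Finset.prod_eq_zero (Finset.mem_univ s), mul_zero]
      simp only [leftCoeff, Matrix.diagonal_apply]
      split_ifs <;> simp_all
    · rintro s' ⟨z, a, b⟩
      simp only [rightCoeff, Matrix.diagonal_apply, Prod.mk.injEq, if_neg (hs s')]
      split_ifs <;> simp_all
  choose u hu using hβ
  have hi : Function.Injective u := fun s s' hs => hι (by rw [← hu s, hs, hu s'])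
  refine ⟨(Equiv.ofBijective u (Finite.injective_iff_bijective.mp hi)).symm, funext fun s => ?_⟩
  rw [← hu]
  congr 1
  exact ((Equiv.ofBijective u (Finite.injective_iff_bijective.mp hi)).apply_symm_apply s).symm

/-! ### Invariance under odd elements -/

variable {ε : Fin n → ZMod 2}

omit [CharZero k] in
theorem exists_prod_ite_oddParam (b : Fin n → Prop) [DecidablePred b] (l : List (Fin n)) :
    ∃ z, (l.map fun s => if b s then oddParam k q ε * param k q ε s else param k q ε s).prod =
      ksgn k z • (oddParam k q ε ^ l.countP (fun s => decide (b s)) *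
        (l.map (param k q ε)).prod) := by
  have hpow : ∀ m : ℕ, oddParam k q ε ^ m ∈
      parityPart k (SuperPoly.gen k (paramPar q ε)) (paramPar q ε) (m : ZMod 2) := by
    intro m
    induction m with
    | zero => simpa using one_mem_parityPart
    | succ m ih => rw [pow_succ, Nat.cast_succ]; exact mul_mem_parityPart ih oddParam_mem
  induction l with
  | nil => exact ⟨0, by simp [ksgn_zero]⟩
  | cons a l ih =>
    obtain ⟨z, hz⟩ := ih
    have hc := SuperPoly.graded_comm _ _ _ (param_mem (k := k) (q := q) (ε := ε) a) _
      (hpow (l.countP fun s => decide (b s)))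
    refine ⟨z + (q a + ε a) * (l.countP fun s => decide (b s) : ℕ), ?_⟩
    simp only [List.map_cons, List.prod_cons, hz]
    by_cases hb : b a
    · rw [if_pos hb, List.countP_cons_of_pos (by simpa using hb), mul_smul_comm, mul_assoc,
        ← mul_assoc (param k q ε a), hc, smul_mul_assoc, mul_smul_comm, smul_smul, ksgn_add,
        pow_succ', mul_assoc, mul_assoc]
    · rw [if_neg hb, List.countP_cons_of_neg (by simpa using hb), mul_smul_comm,
        ← mul_assoc (param k q ε a), hc, smul_mul_assoc, smul_smul, ksgn_add, mul_assoc]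

/-- The expansion, to first order in the odd parameter, of a multilinear function at a
perturbation of an elementary point. -/
theorem exists_sum_prod_oddParam (k : Type u) [Field k] [CharZero k] (q ε : Fin n → ZMod 2) :
    ∃ κ : Fin n → ZMod 2, ∀ (N : ℕ) (F : (Fin n → ZMod 2 × Fin N × Fin N) → k)
      (α β : Fin n → Fin N) (c : Fin n → k),
    ∑ e : Fin n → ZMod 2 × Fin N × Fin N, F e • (List.ofFn fun s =>
      if (e s).2.1 = α s ∧ (e s).2.2 = β s then
        (if (e s).1 = ε s then param k q ε s else c s • (oddParam k q ε * param k q ε s))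
      else 0).prod =
    F (fun s => (ε s, α s, β s)) • (List.ofFn (param k q ε)).prod +
      ∑ s, (ksgn k (κ s) * c s * F (fun t => ((ε + Pi.single s 1 : Fin n → ZMod 2) t, α t, β t))) •
        (oddParam k q ε * (List.ofFn (param k q ε)).prod) := by
  classical
  have hcount : ∀ (b : Fin n → Prop) [DecidablePred b],
      (List.finRange n).countP (fun s => decide (b s)) = (Finset.univ.filter b).card := by
    intro b _
    rw [List.countP_eq_length_filter]; rfl
  choose z hz₀ using fun (b : Fin n → Prop) =>
    exists_prod_ite_oddParam (k := k) (q := q) (ε := ε) b (List.finRange n)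
  have hz : ∀ (b : Fin n → Prop) [DecidablePred b], ((List.finRange n).map fun s =>
      if b s then oddParam k q ε * param k q ε s else param k q ε s).prod =
      ksgn k (z b) • (oddParam k q ε ^ (List.finRange n).countP (fun s => decide (b s)) *
        ((List.finRange n).map (param k q ε)).prod) := by
    intro b _
    convert hz₀ b
  refine ⟨fun s => z (· = s), fun N F α β c => ?_⟩
  -- the types that differ from `ε` at no position, or at exactly one
  let φ : Option (Fin n) → Fin n → ZMod 2 × Fin N × Fin N := fun o =>
    o.elim (fun s => (ε s, α s, β s)) fun s t => ((ε + Pi.single s 1 : Fin n → ZMod 2) t, α t, β t)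
  have hprod : ∀ e : Fin n → ZMod 2,
      (List.ofFn fun s => if e s = ε s then param k q ε s
        else c s • (oddParam k q ε * param k q ε s)).prod =
      (∏ s, if e s = ε s then 1 else c s) • ksgn k (z fun s => e s ≠ ε s) •
        (oddParam k q ε ^ (Finset.univ.filter fun s => e s ≠ ε s).card *
        (List.ofFn (param k q ε)).prod) := by
    intro e
    rw [← hcount, List.ofFn_eq_map (f := param k q ε), ← hz, ← List.ofFn_eq_map, ← prod_ofFn_smul]
    congr 2
    funext s
    by_cases h : e s = ε s <;> simp [h]
  have hsingle : ∀ s : Fin n,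
      (fun t => (ε + Pi.single s 1 : Fin n → ZMod 2) t ≠ ε t) = fun t => t = s := by
    intro s; funext t
    by_cases hts : t = s
    · subst hts; simp
    · simp [hts]
  have hφ : Function.Injective φ := by
    have h1 : ∀ s, φ (some s) ≠ φ none := fun s hs => by
      have := congrArg Prod.fst (congrFun hs s)
      simp [φ] at this
    rintro (_ | s) (_ | s') h
    · rfl
    · exact absurd h.symm (h1 s')
    · exact absurd h (h1 s)
    · have := congrArg Prod.fst (congrFun h s)
      by_contra hne
      have hne' : s ≠ s' := fun h => hne (by rw [h])
      simp [φ, Pi.single_apply, hne'] at this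
  rw [← Fintype.sum_of_injective φ hφ
    (fun o => o.elim (F (fun s => (ε s, α s, β s)) • (List.ofFn (param k q ε)).prod) fun s =>
      (ksgn k (z (· = s)) * c s * F (fun t => ((ε + Pi.single s 1 : Fin n → ZMod 2) t, α t, β t))) •
        (oddParam k q ε * (List.ofFn (param k q ε)).prod))]
  · rw [Fintype.sum_option]
    rfl
  · intro e he
    by_cases hab : ∀ s, (e s).2.1 = α s ∧ (e s).2.2 = β s
    · simp only [hab, and_self, if_true]
      rw [hprod fun s => (e s).1]
      have he' : ∀ x : Fin n → ZMod 2, (∀ s, (e s).1 = x s) → e = fun s => (x s, α s, β s) := by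
        intro x hx; funext s; rw [← hx s, ← (hab s).1, ← (hab s).2]
      have hcard : 2 ≤ (Finset.univ.filter fun s => (e s).1 ≠ ε s).card := by
        by_contra! hlt
        have hle := Nat.lt_succ_iff.mp hlt
        rcases Nat.le_one_iff_eq_zero_or_eq_one.mp hle with h0 | h1
        · rw [Finset.card_eq_zero, Finset.filter_eq_empty_iff] at h0
          refine he ⟨none, ?_⟩
          rw [he' ε fun s => not_not.mp (h0 (Finset.mem_univ s))]
          rfl
        · obtain ⟨s, hs⟩ := Finset.card_eq_one.mp h1
          refine he ⟨some s, ?_⟩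
          rw [he' (ε + Pi.single s 1) fun t => ?_]
          · rfl
          · have ht := Finset.ext_iff.mp hs t
            simp only [Finset.mem_filter, Finset.mem_univ, true_and, Finset.mem_singleton] at ht
            by_cases hts : t = s
            · subst hts
              have := ht.mpr rfl
              have h2 : ∀ x y : ZMod 2, x ≠ y → x = y + 1 := by decide
              simpa using h2 _ _ this
            · have := not_not.mp (mt ht.mp hts)
              simpa [hts] using this
      obtain ⟨m, hm⟩ := Nat.exists_eq_add_of_le hcard
      rw [hm, pow_add, pow_two, oddParam_mul_self, zero_mul, zero_mul, smul_zero, smul_zero,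
        smul_zero]
    · push Not at hab
      obtain ⟨s, hs⟩ := hab
      rw [List.prod_eq_zero, smul_zero]
      rw [List.mem_ofFn]
      exact ⟨s, if_neg fun h => hs h.1 h.2⟩
  · rintro (_ | s)
    · simp [φ]
    · simp only [φ, Option.elim_some, and_self, if_true]
      change _ = F (fun t => ((ε + Pi.single s 1 : Fin n → ZMod 2) t, α t, β t)) •
        (List.ofFn fun t => if (ε + Pi.single s 1 : Fin n → ZMod 2) t = ε t then param k q ε t
          else c t • (oddParam k q ε * param k q ε t)).prod
      rw [hprod (ε + Pi.single s 1)]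
      have hif : ∀ t, (if (ε + Pi.single s 1 : Fin n → ZMod 2) t = ε t then (1 : k) else c t) =
          if t = s then c t else 1 := by
        intro t
        have := congrFun (hsingle s) t
        simp only [ne_eq, eq_iff_iff] at this
        by_cases hts : t = s
        · rw [if_neg (this.mpr hts), if_pos hts]
        · rw [if_pos (not_not.mp (mt this.mp hts)), if_neg hts]
      simp only [hif, hsingle]
      have hcard : ∀ [DecidablePred fun t => t = s],
          (Finset.univ.filter fun t => t = s).card = 1 :=
        Finset.card_eq_one.mpr ⟨s, by ext; simp⟩
      rw [hcard, pow_one]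
      simp only [Finset.prod_ite_eq', Finset.mem_univ, if_true, smul_smul]
      congr 1
      ring

/-- Invariance under the odd unipotent elements `1 + η D p`, `D` diagonal: linear relations
between the coefficients of an invariant at the types `ε + single s`. -/
theorem exists_sum_coeff_eq (hF : IsGQInvariant (multilinearMatrix (q := q) F))
    (ι : Fin n → Fin N) (σ : Equiv.Perm (Fin n)) (ε : Fin n → ZMod 2) :
    ∃ κ : Fin n → k, (∀ s, κ s ≠ 0) ∧ ∀ D : Fin N → k,
      ∑ s, κ s * D (ι s) * F (fun t => ((ε + Pi.single s 1 : Fin n → ZMod 2) t, ι t, ι (σ t))) =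
      ∑ s, κ s * ksgn k (ε s) * D (ι (σ s)) *
        F (fun t => ((ε + Pi.single s 1 : Fin n → ZMod 2) t, ι t, ι (σ t))) := by
  classical
  obtain ⟨κ, hκ⟩ := exists_sum_prod_oddParam k q ε
  refine ⟨fun s => ksgn k (κ s) * ksgn k (q s),
    fun s => mul_ne_zero (ksgn_ne_zero k _) (ksgn_ne_zero k _), fun D => ?_⟩
  let Y : Matrix (Fin N) (Fin N) (ParamAlg k q ε) :=
    Matrix.diagonal fun a => D a • oddParam k q ε
  have hYY : Y * Y = 0 := by
    rw [Matrix.diagonal_mul_diagonal]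
    simp [oddParam_mul_self]
  have hX : ∀ a b, (1 : Matrix (Fin N) (Fin N) (ParamAlg k q ε)) a b ∈
      parityPart k (SuperPoly.gen k (paramPar q ε)) (paramPar q ε) 0 := by
    intro a b
    rw [Matrix.one_apply]
    split_ifs
    exacts [one_mem_parityPart, zero_mem _]
  have hY : ∀ a b, Y a b ∈ parityPart k (SuperPoly.gen k (paramPar q ε)) (paramPar q ε) 1 := by
    intro a b
    simp only [Y, Matrix.diagonal_apply]
    split_ifs
    exacts [Submodule.smul_mem _ _ oddParam_mem, zero_mem _]
  have h1 : Matrix.fromBlocks 1 Y Y 1 * Matrix.fromBlocks 1 (-Y) (-Y) 1 = 1 := by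
    rw [Matrix.fromBlocks_multiply]
    simp [hYY, Matrix.fromBlocks_one]
  have h2 : Matrix.fromBlocks 1 (-Y) (-Y) 1 * Matrix.fromBlocks 1 Y Y 1 = 1 := by
    rw [Matrix.fromBlocks_multiply]
    simp [hYY, Matrix.fromBlocks_one]
  have key := sum_prod_qEntry_eq hF (isQ_fromBlocks hX hY) h1 h2 ι fun s => ι (σ s)
  have e1 : ∀ s z a b, qEntry (Matrix.fromBlocks 1 Y Y 1 *
      elementary k q ε ι (fun s => ι (σ s)) s) z a b =
      if a = ι s ∧ b = ι (σ s) then (if z = ε s then param k q ε s else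
        (ksgn k (q s) * D (ι s)) • (oddParam k q ε * param k q ε s)) else 0 := by
    intro s z a b
    rw [elementary, qEntry_fromBlocks_mul_qSingle]
    by_cases h1 : z = ε s <;> by_cases h2 : ι (σ s) = b <;> by_cases h3 : a = ι s <;>
      simp [h1, h2, h3, eq_comm (a := b), Y, smul_smul, Matrix.one_apply]
  have e2 : ∀ s z a b, qEntry (elementary k q ε ι (fun s => ι (σ s)) s *
      Matrix.fromBlocks 1 Y Y 1) z a b =
      if a = ι s ∧ b = ι (σ s) then (if z = ε s then param k q ε s else
        (ksgn k (q s + ε s) * D (ι (σ s))) • (oddParam k q ε * param k q ε s)) else 0 := by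
    intro s z a b
    have hc := SuperPoly.graded_comm _ _ _ (param_mem (k := k) (q := q) (ε := ε) s) _
      oddParam_mem
    rw [mul_one] at hc
    rw [elementary, qEntry_qSingle_mul_fromBlocks]
    by_cases h1 : z = ε s <;> by_cases h2 : ι s = a <;> by_cases h3 : ι (σ s) = b <;>
      simp [h1, h2, h3, eq_comm (a := a), eq_comm (a := b), Y, smul_smul, hc,
        Matrix.one_apply, mul_comm]
  simp only [e1, e2] at key
  rw [hκ, hκ] at key
  have key2 := add_left_cancel key
  rw [← Finset.sum_smul, ← Finset.sum_smul] at key2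
  have key3 := smul_left_injective k oddParam_mul_prod_param_ne_zero key2
  simp only [ksgn_add] at key3
  calc _ = _ := Finset.sum_congr rfl fun s _ => by ring
    _ = _ := key3
    _ = _ := Finset.sum_congr rfl fun s _ => by ring

end Vanishing

/-! ### Reduction to one coefficient for each permutation -/

section CycleRep

variable {n : ℕ}

/-- A representative of the cycle of the permutation `σ` through `s`. -/
noncomputable def cycleRep (σ : Equiv.Perm (Fin n)) (s : Fin n) : Fin n :=
  (Quotient.mk (Equiv.Perm.SameCycle.setoid σ) s).out

theorem sameCycle_cycleRep (σ : Equiv.Perm (Fin n)) (s : Fin n) : σ.SameCycle (cycleRep σ s) s :=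
  Quotient.exact (Quotient.out_eq (Quotient.mk (Equiv.Perm.SameCycle.setoid σ) s))

theorem cycleRep_eq_of_sameCycle {σ : Equiv.Perm (Fin n)} {s t : Fin n} (h : σ.SameCycle s t) :
    cycleRep σ s = cycleRep σ t := by
  rw [cycleRep, cycleRep, Quotient.sound (s := Equiv.Perm.SameCycle.setoid σ) h]

theorem cycleRep_cycleRep (σ : Equiv.Perm (Fin n)) (s : Fin n) :
    cycleRep σ (cycleRep σ s) = cycleRep σ s :=
  cycleRep_eq_of_sameCycle (sameCycle_cycleRep σ s)

theorem cycleRep_apply (σ : Equiv.Perm (Fin n)) (s : Fin n) :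
    cycleRep σ (σ s) = cycleRep σ s :=
  cycleRep_eq_of_sameCycle (Equiv.Perm.SameCycle.refl σ s).apply_left

/-- The type of elementary points that has exactly one entry in the block `Y` on each cycle of `σ`,
so that the odd traces of the words of the cycles do not vanish there. -/
noncomputable def repIndicator (σ : Equiv.Perm (Fin n)) (s : Fin n) : ZMod 2 :=
  if cycleRep σ s = s then 1 else 0

theorem single_add_single_self (s : Fin n) :
    (Pi.single s 1 + Pi.single s 1 : Fin n → ZMod 2) = 0 := by
  rw [← Pi.single_add, CharTwo.add_self_eq_zero, Pi.single_zero]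

/-- Linear relations that carry any type to `repIndicator σ`: first the entries in the block `Y` are
moved along the cycles to the representatives, where they cancel in pairs; then a cycle
without such an entry makes the value vanish. -/
theorem eq_zero_of_repIndicator {k : Type u} [Field k] [CharZero k] (σ : Equiv.Perm (Fin n))
    (f : (Fin n → ZMod 2) → k)
    (hf : ∀ ε : Fin n → ZMod 2, ∃ κ : Fin n → k, (∀ s, κ s ≠ 0) ∧ ∀ D : Fin n → k,
      ∑ s, κ s * D s * f (ε + Pi.single s 1) =
      ∑ s, κ s * ksgn k (ε s) * D (σ s) * f (ε + Pi.single s 1))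
    (h0 : f (repIndicator σ) = 0) (ε : Fin n → ZMod 2) : f ε = 0 := by
  classical
  -- the changes of the type that preserve the vanishing of `f`
  let H : AddSubmonoid (Fin n → ZMod 2) :=
    { carrier := {δ | ∀ ε, f ε = 0 ↔ f (ε + δ) = 0}
      zero_mem' := fun ε => by rw [add_zero]
      add_mem' := fun {a b} ha hb ε => by rw [ha, hb, add_assoc] }
  have hstep : ∀ s, (Pi.single s 1 + Pi.single (σ s) 1 : Fin n → ZMod 2) ∈ H := by
    intro s ε
    obtain ⟨κ, hκ, h⟩ := hf (ε + Pi.single s 1)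
    have h := h (Pi.single (σ s) 1)
    rw [Finset.sum_eq_single (σ s), Finset.sum_eq_single s] at h
    · rw [add_assoc ε (Pi.single s 1) (Pi.single s 1), single_add_single_self, add_zero] at h
      simp only [Pi.single_eq_same, mul_one] at h
      rw [← add_assoc]
      constructor
      · intro h1
        rw [h1, mul_zero] at h
        exact (mul_eq_zero.mp h).resolve_left (hκ _)
      · intro h1
        rw [h1, mul_zero] at h
        exact (mul_eq_zero.mp h.symm).resolve_left (mul_ne_zero (hκ _) (ksgn_ne_zero k _))
    · intro t _ ht
      rw [Pi.single_eq_of_ne fun h => ht (σ.injective h)]; simp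
    · simp
    · intro t _ ht
      rw [Pi.single_eq_of_ne ht]; simp
    · simp
  have hpow : ∀ (s : Fin n) (i : ℕ),
      (Pi.single s 1 + Pi.single ((σ ^ i) s) 1 : Fin n → ZMod 2) ∈ H := by
    intro s i
    induction i with
    | zero => rw [pow_zero, Equiv.Perm.one_apply, single_add_single_self]; exact H.zero_mem
    | succ i ih =>
      have h := H.add_mem ih (hstep ((σ ^ i) s))
      rwa [add_assoc, ← add_assoc (Pi.single ((σ ^ i) s) 1), single_add_single_self, zero_add,
        ← Equiv.Perm.mul_apply, ← pow_succ'] at h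
  have hrep : ∀ s, (Pi.single s 1 + Pi.single (cycleRep σ s) 1 : Fin n → ZMod 2) ∈ H := by
    intro s
    obtain ⟨i, -, hi⟩ := (sameCycle_cycleRep σ s).symm.exists_pow_eq'
    rw [← hi]
    exact hpow s i
  -- the type obtained from `ε` by moving everything to the representatives
  let ε' : Fin n → ZMod 2 := ∑ s, Pi.single (cycleRep σ s) (ε s)
  have hε : ε + ε' ∈ H := by
    have : ε + ε' = ∑ s, (Pi.single s (ε s) + Pi.single (cycleRep σ s) (ε s)) := by
      rw [Finset.sum_add_distrib, Finset.univ_sum_single]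
    rw [this]
    refine H.sum_mem fun s _ => ?_
    rcases zmod_two_cases (ε s) with h | h
    · rw [h, Pi.single_zero, Pi.single_zero, add_zero]; exact H.zero_mem
    · rw [h]; exact hrep s
  have hε' : ∀ t, cycleRep σ t ≠ t → ε' t = 0 := by
    intro t ht
    simp only [ε', Finset.sum_apply]
    refine Finset.sum_eq_zero fun s _ => Pi.single_eq_of_ne ?_ _
    rintro rfl
    exact ht (cycleRep_cycleRep σ s)
  rw [hε ε, ← add_assoc]
  have h2 : ε + ε = 0 := funext fun s => CharTwo.add_self_eq_zero (ε s)
  rw [h2, zero_add]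
  by_cases he : ε' = repIndicator σ
  · rw [he, h0]
  -- otherwise some cycle carries no entry in the block `Y`
  obtain ⟨r, hr⟩ := Function.ne_iff.mp he
  have hrr : cycleRep σ r = r := by
    by_contra h
    exact hr (by rw [hε' r h, repIndicator, if_neg h])
  have hr0 : ε' r = 0 := by
    rw [repIndicator, if_pos hrr] at hr
    exact (zmod_two_cases _).resolve_right hr
  obtain ⟨κ, hκ, h⟩ := hf (ε' + Pi.single r 1)
  have h := sub_eq_zero.mpr (h fun s => if cycleRep σ s = r then 1 else 0)
  rw [← Finset.sum_sub_distrib, Finset.sum_eq_single r] at h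
  · rw [cycleRep_apply, if_pos hrr, add_assoc, single_add_single_self, add_zero, Pi.add_apply,
      hr0, zero_add, Pi.single_eq_same, ksgn_one] at h
    have h3 : κ r * (2 * f ε') = 0 := by rw [← h]; ring
    exact (mul_eq_zero.mp ((mul_eq_zero.mp h3).resolve_left (hκ r))).resolve_left two_ne_zero
  · intro s _ hs
    rw [cycleRep_apply]
    by_cases hsr : cycleRep σ s = r
    · rw [Pi.add_apply, hε' s (by rw [hsr]; exact hs.symm), Pi.single_eq_of_ne hs, add_zero,
        ksgn_zero]
      ring
    · simp [hsr]
  · simp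

end CycleRep

/-- An invariant multilinear function is determined by one coefficient for each permutation. -/
theorem eq_zero_of_coeff_repIndicator {k : Type u} [Field k] [CharZero k] {n N : ℕ}
    {q : Fin n → ZMod 2} {F : (Fin n → ZMod 2 × Fin N × Fin N) → k}
    (hF : IsGQInvariant (multilinearMatrix (q := q) F))
    {ι : Fin n → Fin N} (hι : Function.Injective ι)
    (h : ∀ σ : Equiv.Perm (Fin n), F (fun s => (repIndicator σ s, ι s, ι (σ s))) = 0) : F = 0 := by
  refine eq_zero_of_standard_rows hF hι fun ε β => ?_
  by_contra hne
  obtain ⟨σ, rfl⟩ := exists_perm_of_ne_zero hF hι hne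
  refine hne (eq_zero_of_repIndicator σ (fun ε => F fun s => (ε s, ι s, ι (σ s))) (fun ε => ?_)
    (h σ) ε)
  obtain ⟨κ, hκ, h⟩ := exists_sum_coeff_eq hF ι σ ε
  refine ⟨κ, hκ, fun D => ?_⟩
  have h := h (Function.extend ι D 0)
  simpa only [hι.extend_apply] using h

/-! ### Odd traces at elementary points -/

section TraceElementary

variable {k : Type u} [Field k] [CharZero k] {n N : ℕ} {q ε : Fin n → ZMod 2}
  {ι : Fin n → Fin N} {σ : Equiv.Perm (Fin n)}

theorem eq_qIdx (c : QIdx N) : ∃ z a, c = qIdx z a := by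
  rcases c with a | a
  · exact ⟨0, a, by simp [qIdx]⟩
  · exact ⟨1, a, by simp [qIdx]⟩

omit [CharZero k] in
/-- A product of elementary elements `M_s` with positions `(ι s, ι (σ s))` has at most one nonzero
entry for each parity of the row, and is nonzero only if the letters follow each other as
`s, σ s, σ² s, …`. -/
theorem exists_prod_elementary_apply (w : List (Fin n)) (x y : ZMod 2) (a b : Fin N) :
    ∃ z, (w.map (elementary k q ε ι fun s => ι (σ s))).prod (qIdx x a) (qIdx y b) =
      if a :: w.map (fun s => ι (σ s)) = w.map ι ++ [b] ∧ y = x + (w.map ε).sum then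
        ksgn k z • (w.map (param k q ε)).prod else 0 := by
  induction w generalizing x a with
  | nil =>
    refine ⟨0, ?_⟩
    rcases zmod_two_cases x with rfl | rfl <;> rcases zmod_two_cases y with rfl | rfl <;>
      simp [qIdx, Matrix.one_apply, ksgn_zero]
  | cons s w ih =>
    obtain ⟨z, hz⟩ := ih (x + ε s) (ι (σ s))
    refine ⟨x * q s + z, ?_⟩
    rw [List.map_cons, List.prod_cons, Matrix.mul_apply,
      Finset.sum_eq_single (qIdx (x + ε s) (ι (σ s))), hz, elementary, qSingle_apply]
    · simp only [and_true, List.map_cons, List.cons_append, List.cons.injEq,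
        List.prod_cons, List.sum_cons, ← add_assoc, eq_comm (a := a)]
      by_cases h1 : ι s = a
      · simp only [h1, if_true, true_and]
        split_ifs
        · rw [smul_mul_smul_comm, ksgn_add]
        · rw [mul_zero]
      · simp [h1]
    · intro c _ hc
      obtain ⟨u, c', rfl⟩ := eq_qIdx c
      rw [elementary, qSingle_apply, if_neg, zero_mul]
      rintro ⟨-, rfl, rfl⟩
      exact hc rfl
    · simp

/-- The evaluation of multilinear functions at the elementary point with positions
`(ι s, ι (σ s))` and types `ε`. -/
def elementaryPoint (k : Type u) [Field k] (q ε : Fin n → ZMod 2) (ι : Fin n → Fin N)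
    (σ : Equiv.Perm (Fin n)) : MatrixAlg k q N →ₐ[k] ParamAlg k q ε :=
  matrixPoint SuperPoly.graded_comm (elementary k q ε ι fun s => ι (σ s))
    (isQ_elementary ι fun s => ι (σ s))

omit [CharZero k] in
theorem elementaryPoint_multilinearMatrix (F : (Fin n → ZMod 2 × Fin N × Fin N) → k) :
    elementaryPoint k q ε ι σ (multilinearMatrix F) =
      F (fun s => (ε s, ι s, ι (σ s))) • (List.ofFn (param k q ε)).prod :=
  matrixPoint_elementary _ _ F

/-- The odd trace of a word at an elementary point: the word has to run through a cycle of `σ`,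
and an odd number of its letters has to be in the block `Y`. -/
theorem exists_elementaryPoint_oddTraceWord (hι : Function.Injective ι) (w : List (Fin n)) :
    ∃ z, elementaryPoint k q ε ι σ (oddTraceWord k q N w) =
      if w.map σ = w.rotate 1 ∧ (w.map ε).sum = 1 then
        ksgn k z • (w.map (param k q ε)).prod else 0 := by
  have h1 : elementaryPoint k q ε ι σ (oddTraceWord k q N w) =
      ∑ a, (w.map (elementary k q ε ι fun s => ι (σ s))).prod (qIdx 0 a) (qIdx 1 a) := by
    rw [map_oddTraceWord]
    simp only [elementaryPoint, genericMatrix_map_matrixPoint]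
    have h := (isQ_list_prod (isQ_elementary (k := k) (q := q) (ε := ε) ι fun s => ι (σ s))
      w).oddTrace_eq
    simpa [qIdx] using h
  rcases w with _ | ⟨s, w⟩
  · refine ⟨0, ?_⟩
    rw [h1, if_neg (by simp)]
    simp [qIdx]
  · choose z hz using fun a => exists_prod_elementary_apply (k := k) (q := q) (ε := ε) (ι := ι)
      (σ := σ) (s :: w) 0 1 a a
    refine ⟨z (ι s), ?_⟩
    rw [h1, Finset.sum_eq_single (ι s), hz]
    · congr 1
      rw [zero_add, eq_comm (a := (1 : ZMod 2))]
      congr 1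
      rw [List.rotate_cons_succ, List.rotate_zero, List.map_cons (f := ι), List.cons_append,
        List.cons.injEq]
      have h2 : (s :: w).map (fun s => ι (σ s)) = ((s :: w).map σ).map ι := by simp
      have h3 : w.map ι ++ [ι s] = (w ++ [s]).map ι := by simp
      rw [h2, h3, (List.map_injective_iff.mpr hι).eq_iff]
      simp
    · intro a _ ha
      rw [hz, if_neg]
      rintro ⟨h, -⟩
      rw [List.map_cons (f := ι), List.cons_append, List.cons.injEq] at h
      exact ha h.1
    · simp

theorem exists_elementaryPoint_traceMap (hι : Function.Injective ι) {c : k} (hc : c ≠ 0)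
    (ws : List (List (Fin n))) (hws : ∀ w ∈ ws, w.map σ = w.rotate 1 ∧ (w.map ε).sum = 1) :
    ∃ r : k, r ≠ 0 ∧ elementaryPoint k q ε ι σ
      (traceMap q N c (ws.map (CyclicAlg.cyc k q)).prod) =
        r • (ws.flatten.map (param k q ε)).prod := by
  induction ws with
  | nil => exact ⟨1, one_ne_zero, by simp⟩
  | cons w ws ih =>
    obtain ⟨r, hr, h⟩ := ih fun w' hw' => hws w' (List.mem_cons_of_mem _ hw')
    obtain ⟨z, hz⟩ := exists_elementaryPoint_oddTraceWord (k := k) (q := q) (ε := ε) (σ := σ) hι w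
    rw [if_pos (hws w List.mem_cons_self)] at hz
    refine ⟨c * ksgn k z * r, mul_ne_zero (mul_ne_zero hc (ksgn_ne_zero k z)) hr, ?_⟩
    rw [List.map_cons, List.prod_cons, map_mul, map_mul, h, traceMap_cyc, map_smul, hz,
      smul_smul, smul_mul_smul_comm, List.flatten_cons, List.map_append, List.prod_append]

theorem elementaryPoint_traceMap_eq_zero (hι : Function.Injective ι) (c : k)
    {ws : List (List (Fin n))} {w : List (Fin n)} (hw : w ∈ ws) (h : w.map σ ≠ w.rotate 1) :
    elementaryPoint k q ε ι σ (traceMap q N c (ws.map (CyclicAlg.cyc k q)).prod) = 0 := by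
  rw [map_list_prod, map_list_prod]
  apply List.prod_eq_zero
  obtain ⟨z, hz⟩ := exists_elementaryPoint_oddTraceWord (k := k) (q := q) (ε := ε) (σ := σ) hι w
  rw [if_neg fun h' => h h'.1] at hz
  simp only [List.map_map, List.mem_map, Function.comp_apply]
  exact ⟨w, hw, by rw [traceMap_cyc, map_smul, hz, smul_zero]⟩

end TraceElementary

/-! ### Products of cyclic words and permutations -/

section CycleWords

variable {n : ℕ} {σ : Equiv.Perm (Fin n)}

/-- The word of the cycle of `σ` through `r`. -/
noncomputable def cycleWord (σ : Equiv.Perm (Fin n)) (r : Fin n) : List (Fin n) :=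
  (List.range (Function.minimalPeriod σ r)).map fun i => σ^[i] r

theorem minimalPeriod_perm_pos (σ : Equiv.Perm (Fin n)) (r : Fin n) :
    0 < Function.minimalPeriod σ r :=
  Function.minimalPeriod_pos_of_mem_periodicPts (Function.Injective.mem_periodicPts σ.injective r)

theorem cycleWord_map (r : Fin n) : (cycleWord σ r).map σ = (cycleWord σ r).rotate 1 := by
  obtain ⟨m, hm⟩ := Nat.exists_eq_succ_of_ne_zero (minimalPeriod_perm_pos σ r).ne'
  have h1 : cycleWord σ r = r :: (List.range m).map fun i => σ^[i + 1] r := by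
    rw [cycleWord, hm, List.range_succ_eq_map]; simp [Function.comp_def]
  have h2 : cycleWord σ r = ((List.range m).map fun i => σ^[i] r) ++ [σ^[m] r] := by
    rw [cycleWord, hm, List.range_succ]; simp
  have h3 : σ (σ^[m] r) = r := by
    rw [← Function.iterate_succ_apply' (⇑σ), ← hm,
      Function.iterate_minimalPeriod]
  nth_rewrite 1 [h2]
  rw [h1, List.rotate_cons_succ, List.rotate_zero, List.map_append, List.map_map,
    List.map_singleton, h3]
  simp [Function.comp_def, Function.iterate_succ_apply']

theorem cycleWord_nodup (r : Fin n) : (cycleWord σ r).Nodup := by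
  refine List.Nodup.map_on ?_ List.nodup_range
  intro i hi j hj h
  rw [List.mem_range] at hi hj
  exact (Function.iterate_eq_iterate_iff_of_lt_minimalPeriod hi hj).mp h

theorem mem_cycleWord {r s : Fin n} : s ∈ cycleWord σ r ↔ σ.SameCycle r s := by
  constructor
  · intro h
    obtain ⟨i, -, rfl⟩ := List.mem_map.mp h
    rw [← Equiv.Perm.coe_pow]
    exact (Equiv.Perm.SameCycle.refl σ r).pow_right
  · intro h
    obtain ⟨i, -, hi⟩ := h.exists_pow_eq'
    refine List.mem_map.mpr ⟨i % Function.minimalPeriod σ r,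
      List.mem_range.mpr (Nat.mod_lt _ (minimalPeriod_perm_pos σ r)), ?_⟩
    rw [Function.iterate_mod_minimalPeriod_eq, ← hi, Equiv.Perm.coe_pow]

theorem cycleWord_sum_repIndicator {r : Fin n} (hr : cycleRep σ r = r) :
    ((cycleWord σ r).map (repIndicator σ)).sum = 1 := by
  have h : ∀ s ∈ cycleWord σ r, repIndicator σ s = if s = r then 1 else 0 := by
    intro s hs
    rw [repIndicator, ← cycleRep_eq_of_sameCycle (mem_cycleWord.mp hs), hr]
    simp only [eq_comm]
  rw [List.map_congr_left h, List.sum_map_ite_eq,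
    List.count_eq_one_of_mem (cycleWord_nodup r) (mem_cycleWord.mpr (.refl σ r))]
  simp

/-- The words of the cycles of `σ`. -/
noncomputable def cycleWords (σ : Equiv.Perm (Fin n)) : List (List (Fin n)) :=
  ((List.finRange n).filter fun r => cycleRep σ r = r).map (cycleWord σ)

theorem cycleWords_spec {w : List (Fin n)} (hw : w ∈ cycleWords σ) :
    w.map σ = w.rotate 1 ∧ (w.map (repIndicator σ)).sum = 1 := by
  obtain ⟨r, hr, rfl⟩ := List.mem_map.mp hw
  rw [List.mem_filter] at hr
  exact ⟨cycleWord_map r, cycleWord_sum_repIndicator (by simpa using hr.2)⟩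

theorem mem_cycleWords_flatten (s : Fin n) : s ∈ (cycleWords σ).flatten := by
  rw [List.mem_flatten]
  refine ⟨cycleWord σ (cycleRep σ s), List.mem_map.mpr ⟨cycleRep σ s, ?_, rfl⟩,
    mem_cycleWord.mpr (sameCycle_cycleRep σ s)⟩
  simp [cycleRep_cycleRep]

theorem cycleWords_flatten_perm (σ : Equiv.Perm (Fin n)) :
    (cycleWords σ).flatten.Perm (List.finRange n) := by
  refine (List.perm_ext_iff_of_nodup ?_ (List.nodup_finRange n)).mpr fun s => by
    simp only [mem_cycleWords_flatten, List.mem_finRange]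
  rw [List.nodup_flatten]
  refine ⟨?_, ?_⟩
  · intro w hw
    obtain ⟨r, -, rfl⟩ := List.mem_map.mp hw
    exact cycleWord_nodup r
  · rw [cycleWords, List.pairwise_map]
    refine List.Pairwise.imp_of_mem ?_ ((List.nodup_finRange n).filter _)
    intro r r' hr hr' hne s hs hs'
    simp only [List.mem_filter, decide_eq_true_eq] at hr hr'
    refine hne ?_
    rw [← hr.2, ← hr'.2, cycleRep_eq_of_sameCycle (mem_cycleWord.mp hs),
      cycleRep_eq_of_sameCycle (mem_cycleWord.mp hs')]

theorem exists_cycleWords_map_ne {σ τ : Equiv.Perm (Fin n)} (h : τ ≠ σ) :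
    ∃ w ∈ cycleWords τ, w.map σ ≠ w.rotate 1 := by
  by_contra! hw
  refine h (Equiv.ext fun s => ?_)
  obtain ⟨w, hwτ, hs⟩ := List.mem_flatten.mp (mem_cycleWords_flatten (σ := τ) s)
  exact List.map_inj_left.mp ((cycleWords_spec hwτ).1.trans (hw w hwτ).symm) s hs

/-- The words of any partition of the letters into cyclic words run through the cycles of a
permutation. -/
theorem exists_perm_of_flatten_perm {ws : List (List (Fin n))}
    (h : ws.flatten.Perm (List.finRange n)) :
    ∃ σ : Equiv.Perm (Fin n), ∀ w ∈ ws, w.map σ = w.rotate 1 := by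
  -- the permutation sends the `i`-th letter of `l` to the `i`-th letter of `l'`
  let l := ws.flatten
  let l' := (ws.map fun w => w.rotate 1).flatten
  have hl' : l'.Perm l := by
    have : ∀ ws : List (List (Fin n)), (ws.map fun w => w.rotate 1).flatten.Perm ws.flatten := by
      intro ws
      induction ws with
      | nil => simp
      | cons w ws ih => simpa using (List.rotate_perm w 1).append ih
    exact this ws
  have hnd : l.Nodup := h.nodup_iff.mpr (List.nodup_finRange n)
  have hnd' : l'.Nodup := hl'.nodup_iff.mpr hnd
  have hmem : ∀ s, s ∈ l := fun s => h.mem_iff.mpr (List.mem_finRange s)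
  have hlt : ∀ s, l.idxOf s < l'.length := fun s => by
    rw [hl'.length_eq]; exact List.idxOf_lt_length_iff.mpr (hmem s)
  let f : Fin n → Fin n := fun s => l'[l.idxOf s]'(hlt s)
  have hf : Function.Injective f := by
    intro s t hst
    have h1 := (hnd'.getElem_inj_iff).mp hst
    exact (List.idxOf_inj (hmem s)).mp h1
  have hmap : l.map f = l' := by
    refine List.ext_getElem (by simp [hl'.length_eq]) fun i h1 h2 => ?_
    simp only [List.getElem_map, f]
    congr 1
    exact hnd.idxOf_getElem i _
  refine ⟨Equiv.ofBijective f (Finite.injective_iff_bijective.mp hf), fun w hw => ?_⟩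
  have h3 : ws.map (List.map f) = ws.map fun w => w.rotate 1 := by
    rw [List.eq_iff_flatten_eq]
    refine ⟨by rw [← List.map_flatten]; exact hmap, by simp [Function.comp_def]⟩
  exact List.map_inj_left.mp h3 w hw

/-- A word in which `f` sends each letter to the next one, and the last one to `a`, is determined
by its first letter. -/
theorem eq_of_map_eq_append {f : Fin n → Fin n} {a : Fin n} (x : Fin n) (u u' : List (Fin n))
    (h : (x :: u).map f = u ++ [a]) (h' : (x :: u').map f = u' ++ [a]) (ha : a ∉ u)
    (ha' : a ∉ u') : u = u' := by
  induction u generalizing x u' with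
  | nil =>
    rcases u' with _ | ⟨y, u'⟩
    · rfl
    · simp only [List.map_cons, List.map_nil, List.nil_append, List.cons_append,
        List.cons.injEq] at h h'
      exact absurd (List.mem_cons.mpr (Or.inl (h.1.symm.trans h'.1))) ha'
  | cons y u ih =>
    rcases u' with _ | ⟨y', u'⟩
    · simp only [List.map_cons, List.map_nil, List.nil_append, List.cons_append,
        List.cons.injEq] at h h'
      exact absurd (List.mem_cons.mpr (Or.inl (h'.1.symm.trans h.1))) ha
    · rw [List.map_cons, List.cons_append, List.cons.injEq] at h h'
      obtain rfl : y = y' := h.1.symm.trans h'.1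
      rw [ih y u' h.2 h'.2 (fun h => ha (List.mem_cons_of_mem _ h))
        fun h => ha' (List.mem_cons_of_mem _ h)]

variable {k : Type u} [Field k] {q : Fin n → ZMod 2}

theorem CyclicAlg.exists_ksgn_of_perm {ws ws' : List (List (Fin n))} (h : ws.Perm ws') :
    ∃ z, (ws.map (cyc k q)).prod = ksgn k z • (ws'.map (cyc k q)).prod := by
  induction h with
  | nil => exact ⟨0, by simp [ksgn_zero]⟩
  | cons x _ ih =>
    obtain ⟨z, hz⟩ := ih
    exact ⟨z, by simp [hz]⟩
  | swap x y l =>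
    refine ⟨(wordPar q y + 1) * (wordPar q x + 1), ?_⟩
    simp only [List.map_cons, List.prod_cons]
    rw [← mul_assoc, cyc_swap, smul_mul_assoc, mul_assoc]
  | trans _ _ ih1 ih2 =>
    obtain ⟨z, hz⟩ := ih1
    obtain ⟨z', hz'⟩ := ih2
    exact ⟨z + z', by rw [hz, hz', smul_smul, ksgn_add]⟩

/-- Up to sign, a product of cyclic words without repeated letters is determined by the
permutation that sends every letter to the next one of its word. -/
theorem CyclicAlg.exists_ksgn_of_map_eq_rotate {ws ws' : List (List (Fin n))}
    (hp : ws.flatten.Perm ws'.flatten) (hnd : ws.flatten.Nodup)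
    (hne : [] ∉ ws) (hne' : [] ∉ ws')
    (hws : ∀ w ∈ ws, w.map σ = w.rotate 1) (hws' : ∀ w ∈ ws', w.map σ = w.rotate 1) :
    ∃ z, (ws.map (cyc k q)).prod = ksgn k z • (ws'.map (cyc k q)).prod := by
  induction ws generalizing ws' with
  | nil =>
    rcases ws' with _ | ⟨w, ws'⟩
    · exact ⟨0, by simp [ksgn_zero]⟩
    · rw [List.flatten_nil, List.nil_perm, List.flatten_cons, List.append_eq_nil_iff] at hp
      exact absurd (List.mem_cons.mpr (Or.inl hp.1.symm)) hne'
  | cons w ws ih =>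
    rcases w with _ | ⟨a, u⟩
    · exact absurd List.mem_cons_self hne
    have ha : a ∈ ws'.flatten := hp.mem_iff.mp (by simp)
    obtain ⟨w', hw', haw⟩ := List.mem_flatten.mp ha
    obtain ⟨x, y, rfl⟩ := List.append_of_mem haw
    have hperm := List.perm_cons_erase hw'
    have hrot : (x ++ a :: y).rotate x.length = a :: (y ++ x) := by
      rw [List.rotate_append_length_eq, List.cons_append]
    have hcomp : (a :: (y ++ x)).map σ = (a :: (y ++ x)).rotate 1 := by
      rw [← hrot, List.map_rotate, hws' _ hw', List.rotate_rotate, List.rotate_rotate, add_comm]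
    have hnd' : ws'.flatten.Nodup := hp.nodup_iff.mp hnd
    have hndw : (a :: (y ++ x)).Nodup := by
      rw [← hrot, List.nodup_rotate]
      exact (List.nodup_flatten.mp hnd').1 _ hw'
    have hndu := (List.nodup_flatten.mp hnd).1 _ List.mem_cons_self
    have hu : u = y ++ x := by
      refine eq_of_map_eq_append (f := σ) (a := a) a u (y ++ x) ?_ ?_
        (List.nodup_cons.mp hndu).1 (List.nodup_cons.mp hndw).1
      · rw [hws _ List.mem_cons_self, List.rotate_cons_succ, List.rotate_zero]
      · rw [hcomp, List.rotate_cons_succ, List.rotate_zero]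
    obtain ⟨z₁, hz₁⟩ := exists_ksgn_of_perm (k := k) (q := q) hperm
    have hz₂ := cyc_append_comm (k := k) (p := q) x (a :: y)
    have hflat : ws.flatten.Perm (ws'.erase (x ++ a :: y)).flatten := by
      have h1 := hp.trans hperm.flatten
      rw [List.flatten_cons, List.flatten_cons] at h1
      have h2 : (x ++ a :: y).Perm (a :: u) := by
        rw [hu, ← hrot]; exact (List.rotate_perm _ _).symm
      exact (List.perm_append_left_iff _).mp (h1.trans (h2.append_right _))
    obtain ⟨z₃, hz₃⟩ := ih hflat ((List.flatten_cons ▸ hnd).of_append_right)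
      (fun h => hne (List.mem_cons_of_mem _ h)) (fun h => hne' (List.mem_of_mem_erase h))
      (fun w hw => hws w (List.mem_cons_of_mem _ hw)) fun w hw => hws' w (List.mem_of_mem_erase hw)
    refine ⟨z₃ + z₁ + wordPar q x * wordPar q (a :: y), ?_⟩
    rw [hz₁, List.map_cons, List.prod_cons, List.map_cons, List.prod_cons, hz₃, hz₂, hu,
      List.cons_append, smul_mul_assoc, smul_smul, smul_smul, mul_smul_comm, ksgn_add, ksgn_add,
      mul_assoc (ksgn k z₃ * ksgn k z₁), mul_assoc (ksgn k z₃)]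
    congr 1
    linear_combination (-(ksgn k z₃ * ksgn k (wordPar q x * wordPar q (a :: y)) ^ 2)) *
      ksgn_mul_self k z₁ - ksgn k z₃ * ksgn_mul_self k (wordPar q x * wordPar q (a :: y))

end CycleWords

/-! ### The multilinear case of the main theorem -/

section Multilinear

variable {k : Type u} [Field k] {n N : ℕ} {q : Fin n → ZMod 2}

/-- The product of the cyclic words of the cycles of a permutation. -/
noncomputable def cycleProduct (k : Type u) [Field k] (q : Fin n → ZMod 2)
    (σ : Equiv.Perm (Fin n)) : CyclicAlg k q :=
  ((cycleWords σ).map (CyclicAlg.cyc k q)).prod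

theorem multilinearCyclic_eq_span (q : Fin n → ZMod 2) :
    multilinearCyclic k q = Submodule.span k (Set.range (cycleProduct k q)) := by
  apply le_antisymm <;> refine Submodule.span_le.mpr ?_
  · rintro _ ⟨ws, hws, rfl⟩
    by_cases h0 : [] ∈ ws
    · rw [List.prod_eq_zero (List.mem_map.mpr ⟨[], h0, CyclicAlg.cyc_nil⟩)]
      exact Submodule.zero_mem _
    · obtain ⟨σ, hσ⟩ := exists_perm_of_flatten_perm hws
      have h0' : [] ∉ cycleWords σ := fun h => by simpa using (cycleWords_spec h).2
      obtain ⟨z, hz⟩ := CyclicAlg.exists_ksgn_of_map_eq_rotate (k := k) (q := q)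
        (hws.trans (cycleWords_flatten_perm σ).symm)
        (hws.nodup_iff.mpr (List.nodup_finRange n)) h0 h0' hσ fun w hw => (cycleWords_spec hw).1
      rw [hz]
      exact Submodule.smul_mem _ _ (Submodule.subset_span ⟨σ, rfl⟩)
  · rintro _ ⟨σ, rfl⟩
    exact Submodule.subset_span ⟨_, cycleWords_flatten_perm σ, rfl⟩

variable [CharZero k] {ι : Fin n → Fin N}

/-- Evaluation at elementary points separates the images of the products of cyclic words. -/
theorem exists_elementaryPoint_cycleProduct (hι : Function.Injective ι) {c : k} (hc : c ≠ 0)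
    (q : Fin n → ZMod 2) (σ : Equiv.Perm (Fin n)) :
    ∃ r : k, r ≠ 0 ∧ ∀ a : Equiv.Perm (Fin n) → k,
      elementaryPoint k q (repIndicator σ) ι σ (traceMap q N c (∑ τ, a τ • cycleProduct k q τ)) =
        (a σ * r) • (List.ofFn (param k q (repIndicator σ))).prod := by
  obtain ⟨r, hr, h⟩ := exists_elementaryPoint_traceMap (q := q) hι hc (cycleWords σ)
    fun w hw => cycleWords_spec hw
  obtain ⟨z, hz⟩ := SuperPoly.exists_ksgn_of_perm (k := k) (par := paramPar q (repIndicator σ))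
    ((cycleWords_flatten_perm σ).map some)
  rw [List.map_map, List.map_map, ← List.ofFn_eq_map] at hz
  refine ⟨r * ksgn k z, mul_ne_zero hr (ksgn_ne_zero k z), fun a => ?_⟩
  rw [map_sum, map_sum, Finset.sum_eq_single σ]
  · rw [map_smul, map_smul, cycleProduct, h, mul_smul, mul_smul]
    exact congrArg _ (congrArg _ hz)
  · intro τ _ hτ
    obtain ⟨w, hw, hne⟩ := exists_cycleWords_map_ne hτ
    rw [map_smul, map_smul, cycleProduct, elementaryPoint_traceMap_eq_zero hι c hw hne, smul_zero]
  · simp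

theorem eq_zero_of_traceMap_eq_zero (hn : n ≤ N) {c : k} (hc : c ≠ 0) {x : CyclicAlg k q}
    (hx : x ∈ multilinearCyclic k q) (h : traceMap q N c x = 0) : x = 0 := by
  rw [multilinearCyclic_eq_span, Submodule.mem_span_range_iff_exists_fun] at hx
  obtain ⟨a, rfl⟩ := hx
  refine Finset.sum_eq_zero fun σ _ => ?_
  obtain ⟨r, hr, hσ⟩ := exists_elementaryPoint_cycleProduct (Fin.castLE_injective hn) hc q σ
  have h1 := hσ a
  rw [h, map_zero] at h1
  rw [(mul_eq_zero.mp ((smul_eq_zero.mp h1.symm).resolve_right prod_param_ne_zero)).resolve_right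
    hr, zero_smul]

omit [CharZero k] in
/-- Polarization does not change multilinear elements. -/
theorem polarCyclic_id {x : CyclicAlg k q} (hx : x ∈ multilinearCyclic k q) :
    polarCyclic q k id x = x := by
  induction hx using Submodule.span_induction with
  | mem x hx =>
    obtain ⟨ws, hws, rfl⟩ := hx
    have hlen : ws.flatten.length = n := by rw [hws.length_eq, List.length_finRange]
    have hnd : ws.flatten.Nodup := hws.nodup_iff.mpr (List.nodup_finRange n)
    let j : Fin n → Fin n := fun u => ws.flatten[(u : ℕ)]
    have hj : Function.Injective j := fun u v h => Fin.ext (hnd.getElem_inj_iff.mp h)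
    let σ : Equiv.Perm (Fin n) := Equiv.ofBijective j (Finite.injective_iff_bijective.mp hj)
    have hof : List.ofFn σ = ws.flatten :=
      List.ext_getElem (by simp [hlen]) fun i h1 h2 => by simp [σ, j]
    have hsum : (ws.map List.length).sum = n := by rw [← List.length_flatten, hlen]
    have hprod : ∀ q' : Fin n → ZMod 2, (ws.map (CyclicAlg.cyc k q')).prod =
        cycProd k q' (ws.map List.length) (List.ofFn σ) := fun q' => by
      rw [cycProd, hof, splitLengths_flatten]
    rw [hprod, polarCyclic_cycProd id _ σ hsum, Finset.sum_eq_single σ]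
    · exact if_pos rfl
    · intro τ _ hτ
      exact if_neg fun h => hτ (DFunLike.coe_injective h)
    · simp
  | zero => exact map_zero _
  | add x y _ _ hx hy => exact (map_add _ x y).trans (congrArg₂ _ hx hy)
  | smul a x _ hx => exact (map_smul _ a x).trans (congrArg _ hx)

theorem exists_traceMap_eq_multilinearMatrix (c : k) {x : CyclicAlg k q}
    (hx : x ∈ multilinearCyclic k q) :
    ∃ F, traceMap q N c x = multilinearMatrix (q := q) (N := N) F := by
  have h := traceMap_polarCyclic (N := N) (p := q) id c x
  obtain ⟨F, hF⟩ := polarMatrix_mem (N := N) id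
    (traceMap_mem_gqInvariants (N := N) c (multilinearCyclic_le q hx)).1
  refine ⟨F, ?_⟩
  have e : traceMap q N c (polarCyclic q k id x) = traceMap q N c x :=
    congrArg _ (polarCyclic_id hx)
  exact e.symm.trans (h.trans hF.symm)

theorem exists_traceMap_eq (hn : n ≤ N) {c : k} (hc : c ≠ 0)
    {F : (Fin n → ZMod 2 × Fin N × Fin N) → k}
    (hF : IsGQInvariant (multilinearMatrix (q := q) F)) :
    ∃ x ∈ multilinearCyclic k q, traceMap q N c x = multilinearMatrix F := by
  have hι := Fin.castLE_injective hn
  choose r hr hσ using exists_elementaryPoint_cycleProduct hι hc q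
  let a : Equiv.Perm (Fin n) → k := fun σ =>
    F (fun s => (repIndicator σ s, Fin.castLE hn s, Fin.castLE hn (σ s))) / r σ
  have hx : ∑ τ, a τ • cycleProduct k q τ ∈ multilinearCyclic k q := by
    rw [multilinearCyclic_eq_span]
    exact Submodule.sum_mem _ fun τ _ => Submodule.smul_mem _ _ (Submodule.subset_span ⟨τ, rfl⟩)
  refine ⟨_, hx, ?_⟩
  obtain ⟨F', hF'⟩ := exists_traceMap_eq_multilinearMatrix (N := N) c hx
  have hinv : IsGQInvariant (multilinearMatrix (q := q) (F - F')) := by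
    rw [map_sub, ← hF', sub_eq_add_neg, ← neg_one_smul k (traceMap q N c _)]
    exact hF.add ((traceMap_mem_gqInvariants c (multilinearCyclic_le q hx)).2.smul _)
  have h0 : F - F' = 0 := by
    refine eq_zero_of_coeff_repIndicator hinv hι fun σ => ?_
    have h1 := elementaryPoint_multilinearMatrix (k := k) (q := q) (ε := repIndicator σ)
      (ι := Fin.castLE hn) (σ := σ) F'
    rw [← hF', hσ σ a, div_mul_cancel₀ _ (hr σ)] at h1
    rw [Pi.sub_apply, sub_eq_zero]
    exact smul_left_injective k prod_param_ne_zero h1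
  rw [hF', ← sub_eq_zero.mp h0]

end Multilinear

/-- The first and second fundamental theorems of invariant theory for the group `GQ(U)`, in
degrees up to the size of `U`. -/
theorem bijOn_traceMap {k : Type u} [Field k] [CharZero k] {d N n : ℕ} (p : Fin d → ZMod 2)
    (hn : n ≤ N) {c : k} (hc : c ≠ 0) :
    Set.BijOn (traceMap p N c) (CyclicAlg.component k p n) (gqInvariants k p N n) :=
  bijOn_traceMap_of_multilinear p c (fun _ _ hx h => eq_zero_of_traceMap_eq_zero hn hc hx h)
    fun _ _ hF => exists_traceMap_eq hn hc hF

theorem matrixBV_traceMap_of_mem {k : Type u} [Field k] [CharZero k] {d N n : ℕ}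
    {p : Fin d → ZMod 2} {L : Fin d → Fin d → k} (hL : CyclicAlg.IsEvenGram p L) {c : k}
    (hc : c ≠ 0) {x : CyclicAlg k p} (hx : x ∈ CyclicAlg.component k p n) :
    c⁻¹ • matrixBV p N L (traceMap p N c x) =
      traceMap p N c (CyclicAlg.ncBV hL (2 / c ^ 2) x) := by
  induction hx using Submodule.span_induction with
  | mem x hx =>
    obtain ⟨ws, -, rfl⟩ := hx
    exact matrixBV_traceMap hL hc ws
  | zero => simp
  | add x y _ _ hx hy => rw [map_add, map_add, smul_add, hx, hy, map_add, map_add]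
  | smul a x _ hx => rw [map_smul, map_smul, smul_comm, hx, map_smul, map_smul]

theorem mainTheorem7 {k : Type u} [Field k] [IsAlgClosed k] [CharZero k]
    {V : Type v} [AddCommGroup V] [Module k V]
    (𝒱 : ZMod 2 → Submodule k V) [DirectSum.Decomposition 𝒱]
    (l : EvenForm 𝒱) {d : ℕ} (b : HomogeneousBasis 𝒱 d)
    (N n : ℕ) (hn : n ≤ N) (c : k) (hc : c ≠ 0) :
    -- the identification of `F_n` with the invariants, by odd traces
    (∀ ws : List (List (Fin d)),
      traceMap b.shiftedPar N c (ws.map (CyclicAlg.cyc k b.shiftedPar)).prod =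
        (ws.map fun w => c • oddTraceWord k b.shiftedPar N w).prod) ∧
    Set.BijOn (traceMap b.shiftedPar N c)
      (CyclicAlg.component k b.shiftedPar n) (gqInvariants k b.shiftedPar N n) ∧
    -- both operators lower the degree by two
    (∀ x ∈ CyclicAlg.component k b.shiftedPar n, ∀ κ : k,
      (2 ≤ n → CyclicAlg.ncBV (l.gram_isEvenGram b) κ x ∈
        CyclicAlg.component k b.shiftedPar (n - 2)) ∧
      (n < 2 → CyclicAlg.ncBV (l.gram_isEvenGram b) κ x = 0)) ∧
    (∀ f ∈ gqInvariants k b.shiftedPar N n,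
      (2 ≤ n → matrixBV b.shiftedPar N (l.gram b) f ∈ gqInvariants k b.shiftedPar N (n - 2)) ∧
      (n < 2 → matrixBV b.shiftedPar N (l.gram b) f = 0)) ∧
    -- under the identification they coincide
    (∀ x ∈ CyclicAlg.component k b.shiftedPar n,
      c⁻¹ • matrixBV b.shiftedPar N (l.gram b) (traceMap b.shiftedPar N c x) =
        traceMap b.shiftedPar N c (CyclicAlg.ncBV (l.gram_isEvenGram b) (2 / c ^ 2) x)) := by
  have hbij := bijOn_traceMap b.shiftedPar hn hc
  have hlower : ∀ x ∈ CyclicAlg.component k b.shiftedPar n, ∀ κ : k,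
      (2 ≤ n → CyclicAlg.ncBV (l.gram_isEvenGram b) κ x ∈
        CyclicAlg.component k b.shiftedPar (n - 2)) ∧
      (n < 2 → CyclicAlg.ncBV (l.gram_isEvenGram b) κ x = 0) := by
    intro x hx κ
    have h := CyclicAlg.ncBV_mem_lowerComponent (l.gram_isEvenGram b) κ hx
    unfold CyclicAlg.lowerComponent at h
    refine ⟨fun h2 => ?_, fun h2 => ?_⟩
    · rwa [if_pos h2] at h
    · rwa [if_neg h2.not_ge, Submodule.mem_bot] at h
  refine ⟨fun ws => ?_, hbij, hlower, fun f hf => ?_, fun x hx =>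
    matrixBV_traceMap_of_mem (l.gram_isEvenGram b) hc hx⟩
  · rw [map_list_prod, List.map_map]
    exact congrArg List.prod (List.map_congr_left fun w _ => traceMap_cyc _ _ _ w)
  · -- `f` is an image of some `x`, so that the claim follows from the one for `Δ x`
    obtain ⟨x, hx, rfl⟩ := hbij.surjOn hf
    have h := matrixBV_traceMap_of_mem (N := N) (l.gram_isEvenGram b) hc hx
    rw [inv_smul_eq_iff₀ hc] at h
    rw [h]
    refine ⟨fun h2 => ?_, fun h2 => ?_⟩
    · exact (mem_invariantSubmodule).mp (Submodule.smul_mem _ c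
        (traceMap_mem_gqInvariants c ((hlower x hx _).1 h2)))
    · rw [(hlower x hx _).2 h2, map_zero, smul_zero]
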